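/- All functions are real valued. For a radial function $f$ on $\mathbb R^3$ write $f(r)$ for the value of $f(x)$ at $|x|=r$, and let $$\Phi_0(t)(f_0,f_1)=\cos(t\sqrt{-\Delta})f_0+\frac{\sin(t\sqrt{-\Delta})}{\sqrt{-\Delta}}f_1$$ be the first component of the flow of the linear wave equation on $\mathbb R^3$, acting on pairs of distributions. The projections on outgoing and incoming states are $$P_\pm(f_0,f_1)=\Big(\tfrac12\Big(f_0\mp\frac1r\int_0^r\rho f_1(\rho)\,d\rho\Big),\ \tfrac12\Big(\mp(f_0)_r\mp\frac{f_0}r+f_1\Big)\Big).$$ A radial pair $(u_0,u_1)$ is called outgoing if $P_-(u_0,u_1)=0$; for a function $u_0$ vanishing near the origin this means that $u_1=-(u_0)_r-\frac{u_0}{r}$ as distributions on $\mathbb R^3$. Consider the equation $$u(t)=\Phi_0(t)(u_0,u_1)+\int_0^t\Phi_0(t-s)P_+\big(0,|u(s)|^Nu(s)\big)\,ds. \qquad (1.2)$$ For an interval $I=[0,T]$ or $I=[0,\infty)$, a solution of (1.2) on $I$ means a measurable function $u$ on $I\times\mathbb R^3$, with $u(t)$ radial for each $t\in I$, with $\sup_{t\in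 I,\,t\le T'}\|u(t)\|_{L^{N+2}}<\infty$ for every $T'<\infty$, vanishing for $|x|<r_0$ and all $t\in I$ for some $r_0>0$, such that (1.2) holds in the sense of distributions on $\mathbb R^3$ for every $t\in I$. **Theorem 1.2.** Let $N>2$ be real and $R>0$. Let $(u_0,u_1)$ be radial and outgoing, where $u_0\in L^{N+2}(\mathbb R^3)$ is supported in $\{|x|\ge R\}$ and $u_1$ is a distribution on $\mathbb R^3$. Then (1.2) has a solution $u$ on $[0,\infty)$; for every $T\ge0$, every solution on $[0,T]$ coincides with $u$ on $[0,T]$ (for each $t$, almost everywhere in $x$); and $$\|u(t)\|_{L^{N+2}}\le\|u_0\|_{L^{N+2}}\quad\text{for all }t\ge0,$$ so that $\|u\|_{L^\infty_tL^{N+2}_x}\le\|u_0\|_{L^{N+2}}$. If in addition $N>4$, then $\|u(t)\|_{L^{N+2}}\to0$ as $t\to\infty$. -/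

import Mathlib

open MeasureTheory Set Filter Topology TopologicalSpace
open scoped Distributions ContDiff

noncomputable section

namespace OutgoingWave

/-- Three-dimensional Euclidean space. -/
abbrev E3 : Type := EuclideanSpace ℝ (Fin 3)

/-- Real test functions on `ℝ³`: smooth functions with compact support. -/
abbrev Test : Type := 𝓓((⊤ : Opens E3), ℝ)

/-- Real distributions on `ℝ³`. -/
abbrev Distr : Type := 𝓓'((⊤ : Opens E3), ℝ)

/-! ### Radial functions and the nonlocal operator -/

/-- `f` is radial: `f x` depends only on `‖x‖`. -/
def IsRadial (f : E3 → ℝ) : Prop := ∀ x y : E3, ‖x‖ = ‖y‖ → f x = f y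

/-- For radial `f` and `r ≥ 0`, the value `f(r)`, that is `f x` for any `x` with `‖x‖ = r`. -/
def profile (f : E3 → ℝ) (r : ℝ) : ℝ := f (r • EuclideanSpace.single (0 : Fin 3) (1 : ℝ))

/-- The nonlocal operator `f ↦ (1/r) ∫₀ʳ ρ f(ρ) dρ`, as a radial function on `ℝ³`. -/
def nonlocalOp (f : E3 → ℝ) (x : E3) : ℝ := ‖x‖⁻¹ * ∫ ρ in (0 : ℝ)..‖x‖, ρ * profile f ρ

/-! ### Functions as functionals, and the projections -/

/-- The functional on test functions defined by a function `f`. -/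
def pairing (f : E3 → ℝ) (φ : Test) : ℝ := ∫ x, f x * φ x

/-- The weak radial derivative `f_r`. The transpose of `∂_r = (x/|x|) · ∇` is
`φ ↦ - div (φ x/|x|) = - (φ_r + 2 φ / r)`. -/
def weakRadialDeriv (f : E3 → ℝ) (φ : Test) : ℝ :=
  - ∫ x, f x * (fderiv ℝ φ x (‖x‖⁻¹ • x) + 2 * ‖x‖⁻¹ * φ x)

/-- First component of the projection on outgoing states,
`P₀₊(u₀, u₁) = (1/2) (u₀ - (1/r) ∫₀ʳ ρ u₁(ρ) dρ)`. -/
def projOutFst (u₀ u₁ : E3 → ℝ) (x : E3) : ℝ := 1 / 2 * (u₀ x - nonlocalOp u₁ x)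

/-- Second component of the projection on outgoing states,
`P₁₊(u₀, u₁) = (1/2) (-(u₀)_r - u₀/r + u₁)`, in the weak sense;
`u₁` is a functional on test functions. -/
def projOutSnd (u₀ : E3 → ℝ) (u₁ : Test → ℝ) (φ : Test) : ℝ :=
  1 / 2 * (- weakRadialDeriv u₀ φ - pairing (fun x => u₀ x / ‖x‖) φ + u₁ φ)

/-- Second component of the projection on incoming states,
`P₁₋(u₀, u₁) = (1/2) ((u₀)_r + u₀/r + u₁)`, in the weak sense;
`u₁` is a functional on test functions. -/
def projInSnd (u₀ : E3 → ℝ) (u₁ : Test → ℝ) (φ : Test) : ℝ :=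
  1 / 2 * (weakRadialDeriv u₀ φ + pairing (fun x => u₀ x / ‖x‖) φ + u₁ φ)

/-- The pair `(u₀, u₁)` is outgoing: its incoming part vanishes, i.e. `u₁ = -(u₀)_r - u₀/r` as
distributions on `ℝ³`. The first component of the incoming part,
`(1/2) (u₀ + (1/r) ∫₀ʳ ρ u₁(ρ) dρ)`, need not be required to vanish separately: when `u₀`
vanishes near the origin and `u₁ = -(u₀)_r - u₀/r = -(1/r) (r u₀)_r`, one has
`∫₀ʳ ρ u₁(ρ) dρ = - r u₀(r)`. -/
def IsOutgoing (u₀ : E3 → ℝ) (u₁ : Distr) : Prop := ∀ φ : Test, projInSnd u₀ u₁ φ = 0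

/-! ### The flow of the linear wave equation -/

theorem contDiff_sphere_integral (t : ℝ) (φ : Test) (a b : ℝ) :
    ContDiff ℝ ∞ (fun x : E3 => ∫ θ : Metric.sphere (0 : E3) 1,
      (a * φ (x + t • (θ : E3)) + b * fderiv ℝ φ (x + t • (θ : E3)) (t • (θ : E3)))
        ∂(volume : Measure E3).toSphere) := by
  let μ : Measure E3 :=
    Measure.map (fun θ : Metric.sphere (0 : E3) 1 => -(t • (θ : E3))) (volume : Measure E3).toSphere
  have hm : Measurable (fun θ : Metric.sphere (0 : E3) 1 => -(t • (θ : E3))) :=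
    Continuous.measurable (by fun_prop)
  have : IsFiniteMeasure μ := Measure.isFiniteMeasure_map _ _
  have hφ : ContDiff ℝ ∞ φ := φ.contDiff
  have hφ' : ContDiff ℝ ∞ (fderiv ℝ φ) := hφ.fderiv_right (by simp)
  have k1 := φ.hasCompactSupport.contDiff_convolution_right
    (ContinuousLinearMap.mul ℝ ℝ) (μ := μ) (n := ⊤) (f := fun _ => a)
    continuous_const.locallyIntegrable hφ
  have k2 := (φ.hasCompactSupport.fderiv (𝕜 := ℝ)).contDiff_convolution_right
    (ContinuousLinearMap.id ℝ (E3 →L[ℝ] ℝ)).flip (μ := μ) (n := ⊤) (f := fun y => b • (-y))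
    (Continuous.locallyIntegrable (by fun_prop)) hφ'
  have c1 : Continuous φ := hφ.continuous
  have c2 : Continuous (fderiv ℝ φ) := hφ'.continuous
  have hcomp : IsCompact (univ : Set (Metric.sphere (0 : E3) 1)) := isCompact_univ
  convert ContDiff.add k1 k2 using 1
  funext x
  have d1 : Continuous fun y : E3 => a * φ (x - y) := by fun_prop
  have d2 : Continuous fun y : E3 => fderiv ℝ φ (x - y) (b • (-y)) := by fun_prop
  have e1 : Continuous fun θ : Metric.sphere (0 : E3) 1 => a * φ (x + t • (θ : E3)) := by fun_prop
  have e2 : Continuous fun θ : Metric.sphere (0 : E3) 1 =>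
      b * fderiv ℝ φ (x + t • (θ : E3)) (t • (θ : E3)) := by fun_prop
  rw [integral_add (integrableOn_univ.mp (e1.continuousOn.integrableOn_compact hcomp))
    (integrableOn_univ.mp (e2.continuousOn.integrableOn_compact hcomp))]
  simp only [MeasureTheory.convolution, ContinuousLinearMap.mul_apply',
    ContinuousLinearMap.flip_apply, ContinuousLinearMap.id_apply]
  rw [integral_map hm.aemeasurable d1.aestronglyMeasurable,
    integral_map hm.aemeasurable d2.aestronglyMeasurable]
  simp [sub_neg_eq_add]

theorem hasCompactSupport_sphere_integral (t : ℝ) (φ : Test) (a b : ℝ) :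
    HasCompactSupport (fun x : E3 => ∫ θ : Metric.sphere (0 : E3) 1,
      (a * φ (x + t • (θ : E3)) + b * fderiv ℝ φ (x + t • (θ : E3)) (t • (θ : E3)))
        ∂(volume : Measure E3).toSphere) := by
  obtain ⟨r, hr⟩ := φ.hasCompactSupport.isCompact.isBounded.subset_closedBall (0 : E3)
  obtain ⟨r', hr'⟩ :=
    (φ.hasCompactSupport.fderiv (𝕜 := ℝ)).isCompact.isBounded.subset_closedBall (0 : E3)
  refine HasCompactSupport.intro (isCompact_closedBall (0 : E3) (max r r' + |t|)) (fun x hx => ?_)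
  have hx' : max r r' + |t| < ‖x‖ := by simpa using hx
  have hz : ∀ θ : Metric.sphere (0 : E3) 1, max r r' < ‖x + t • (θ : E3)‖ := fun θ => by
    have h1 : ‖t • (θ : E3)‖ = |t| := by simp [norm_smul]
    have h2 : ‖x‖ ≤ ‖x + t • (θ : E3)‖ + ‖t • (θ : E3)‖ := by
      simpa using norm_sub_le (x + t • (θ : E3)) (t • (θ : E3))
    linarith
  rw [← integral_zero (Metric.sphere (0 : E3) 1) ℝ (μ := (volume : Measure E3).toSphere)]
  congr 1
  funext θ
  have e1 : φ (x + t • (θ : E3)) = 0 := by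
    refine image_eq_zero_of_notMem_tsupport fun h => ?_
    have := hr h
    simp only [Metric.mem_closedBall, dist_zero_right] at this
    exact absurd this (not_le.mpr ((le_max_left r r').trans_lt (hz θ)))
  have e2 : fderiv ℝ φ (x + t • (θ : E3)) = 0 := by
    refine image_eq_zero_of_notMem_tsupport fun h => ?_
    have := hr' h
    simp only [Metric.mem_closedBall, dist_zero_right] at this
    exact absurd this (not_le.mpr ((le_max_right r r').trans_lt (hz θ)))
  simp [e1, e2]

/-- The sine propagator `sin(t√-Δ)/√-Δ` on test functions of `ℝ³`, by Kirchhoff's formula: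
`t` times the mean of `φ` over the sphere of radius `|t|` about `x`
(the unit sphere carries its surface measure, of total mass `4π`). -/
def sinProp (t : ℝ) (φ : Test) : Test where
  toFun x := (4 * Real.pi)⁻¹ * ∫ θ : Metric.sphere (0 : E3) 1,
    t * φ (x + t • (θ : E3)) ∂(volume : Measure E3).toSphere
  contDiff' := by
    have h := contDiff_sphere_integral t φ t 0
    simp only [zero_mul, add_zero] at h
    exact contDiff_const.mul h
  hasCompactSupport' := by
    have h := hasCompactSupport_sphere_integral t φ t 0
    simp only [zero_mul, add_zero] at h
    exact h.mul_left
  tsupport_subset' := fun _ _ => trivial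

/-- The cosine propagator `cos(t√-Δ)` on test functions of `ℝ³`, by Kirchhoff's formula: the
`t`-derivative of the sine propagator, i.e. the mean over `θ ∈ S²` of
`φ(x + tθ) + t θ · ∇φ(x + tθ)`. -/
def cosProp (t : ℝ) (φ : Test) : Test where
  toFun x := (4 * Real.pi)⁻¹ * ∫ θ : Metric.sphere (0 : E3) 1,
    (φ (x + t • (θ : E3)) + fderiv ℝ φ (x + t • (θ : E3)) (t • (θ : E3)))
      ∂(volume : Measure E3).toSphere
  contDiff' := by
    have h := contDiff_sphere_integral t φ 1 1
    simp only [one_mul] at h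
    exact contDiff_const.mul h
  hasCompactSupport' := by
    have h := hasCompactSupport_sphere_integral t φ 1 1
    simp only [one_mul] at h
    exact h.mul_left
  tsupport_subset' := fun _ _ => trivial

/-- First component of the flow of the free wave equation,
`Φ₀(t)(u₀, u₁) = cos(t√-Δ) u₀ + sin(t√-Δ)/√-Δ u₁`, for data given as functionals on test
functions; the propagators are symmetric, so they act on distributions by transposition. -/
def waveFlow (t : ℝ) (u₀ u₁ : Test → ℝ) (φ : Test) : ℝ := u₀ (cosProp t φ) + u₁ (sinProp t φ)

/-! ### The equation -/

/-- The nonlinearity `|u|^N u`. -/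
def nonlin (N : ℝ) (u : E3 → ℝ) (x : E3) : ℝ := |u x| ^ N * u x

/-- `Φ₀(t) P₊(0, f)`, as a functional on test functions. -/
def waveFlowProjOut (t : ℝ) (f : E3 → ℝ) (φ : Test) : ℝ :=
  waveFlow t (pairing (projOutFst 0 f)) (projOutSnd 0 (pairing f)) φ

/-- `u` is a radial solution on the time interval `I` (`[0, T]` or `[0, ∞)`) of
`u(t) = Φ₀(t)(u₀, u₁) + ∫₀ᵗ Φ₀(t-s) P₊(0, |u(s)|^N u(s)) ds`,
in the class `L^∞_{t,loc} L^{N+2}_x` of functions vanishing near `x = 0`. The identity holds as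
distributions on `ℝ³` for every `t ∈ I`. The class makes all the integrals converge. -/
structure IsSolution (N : ℝ) (u₀ : E3 → ℝ) (u₁ : Distr) (I : Set ℝ) (u : ℝ → E3 → ℝ) : Prop where
  radial : ∀ t ∈ I, IsRadial (u t)
  aestronglyMeasurable :
    AEStronglyMeasurable (fun p : ℝ × E3 => u p.1 p.2) ((volume.restrict I).prod volume)
  memLp : ∀ t ∈ I, MemLp (u t) (ENNReal.ofReal (N + 2)) volume
  bounded : ∀ T : ℝ, ∃ C : ℝ, ∀ t ∈ I, t ≤ T →
    eLpNorm (u t) (ENNReal.ofReal (N + 2)) volume ≤ ENNReal.ofReal C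
  vanish_near_zero : ∃ r : ℝ, 0 < r ∧ ∀ t ∈ I, ∀ᵐ x : E3, ‖x‖ < r → u t x = 0
  equation : ∀ t ∈ I, ∀ φ : Test,
    pairing (u t) φ = waveFlow t (pairing u₀) u₁ φ
      + ∫ s in (0 : ℝ)..t, waveFlowProjOut (t - s) (nonlin N (u s)) φ

end OutgoingWave

end

/-! For radial functions the substitution `w = r u` turns the wave equation on ℝ³ into the wave
equation on a half-line, and an outgoing state is a wave that moves to the right. In (1.2) the data
are outgoing and the forcing is projected by `P₊`, so no left-moving part ever appears. In the
variable `z = r - t` the function `W(t, z) = (z + t) u(t, z + t)` satisfies `∂_t W(t, y) = -(1/2)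
∫_R^y |W|^N W (z + t)^{-N} dz`. This is an ordinary differential equation. With `W = w₀ + V` and `w₀
= r u₀` fixed and rough, `V` takes values in bounded continuous functions, where the vector field is
locally Lipschitz.

The linear part rests on `sphMean_shiftMean`, the formula for iterated spherical means. It is
checked on exponentials `exp ⟨ξ, x⟩`, whose spherical mean is `sinh (r‖ξ‖) / (r‖ξ‖)`, and extended
by Stone–Weierstrass. It gives `waveFlow_outgoing` and `waveFlowProjOut_eq_profile`, in which all
terms translated the wrong way cancel.

The energy `∫_R^∞ |W|^{N+2} (z + t)^{-N} dz` equals `‖u(t)‖^{N+2} / 4π` in `L^{N+2}`. If `g = |W|^N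
W (z + t)^{-N}` and `G` is its primitive from `R`, then the contribution of `∂_t W` to the time
derivative is `-((N+2)/2) ∫ G g = -((N+2)/4) (∫ g)² ≤ 0`, and that of the weight is also
nonpositive. So the energy decreases (`charEnergy_antitoneOn`). By Young's inequality it controls
the vector field, hence solutions are global (`exists_isCharSol`, `exists_global`) and the norm
inequality follows.

For decay, the part of the energy due to `w₀` tends to zero by dominated convergence. An optimised
Young inequality yields `‖V(t)‖ ≲ (R + t)^{3/(N+2)}`, so the part due to `V` is `O((R + t)^{4-N})`
(`tendsto_charEnergy`).

A competing solution is not known to have the characteristic form, so uniqueness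
(`IsSolution.ae_eq`) is proved directly from the tested equation: the difference of two solutions is
at most `A (κ t)^n / n! · ‖x‖⁻¹` for every `n`. -/

noncomputable section

namespace OutgoingWave

/-! ### Polar coordinates and radial functions. -/

/-- The unit sphere of `ℝ³`. -/
abbrev S2 : Type := Metric.sphere (0 : E3) 1

/-- The surface measure of the unit sphere. -/
abbrev sphMeas : Measure S2 := (volume : Measure E3).toSphere

/-- The measure `r² dr` on the half-line. -/
def radMeas : Measure ℝ := (volume.restrict (Ioi 0)).withDensity fun r => ENNReal.ofReal (r ^ 2)

instance : SFinite radMeas := by unfold radMeas; infer_instance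

/-- The known decomposition lives on the complement of the origin and on the subtype of positive
reals. Both are pushed forward to full spaces, so that the radius is an ordinary real variable; the
origin is a null set. -/
theorem measurePreserving_polar :
    MeasurePreserving (fun p : S2 × ℝ => p.2 • (p.1 : E3)) (sphMeas.prod radMeas) volume := by
  have hfr : Module.finrank ℝ E3 - 1 = 2 := by simp
  have h0 := ((volume : Measure E3).measurePreserving_homeomorphUnitSphereProd).symm
    (homeomorphUnitSphereProd E3).toMeasurableEquiv
  have h1 : MeasurePreserving (Subtype.val : ({0}ᶜ : Set E3) → E3)
      ((volume : Measure E3).comap (↑)) volume := by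
    have := measurePreserving_subtype_coe (μa := (volume : Measure E3)) (s := ({0}ᶜ : Set E3))
      (measurableSet_singleton _).compl
    rwa [restrict_compl_singleton] at this
  have h2 := h1.comp h0
  rw [hfr] at h2
  have h3 : MeasurePreserving (Subtype.val : Ioi (0 : ℝ) → ℝ) (Measure.volumeIoiPow 2) radMeas := by
    refine ⟨measurable_subtype_coe, ?_⟩
    have hm : MeasurableEmbedding (Subtype.val : Ioi (0 : ℝ) → ℝ) :=
      MeasurableEmbedding.subtype_coe measurableSet_Ioi
    rw [Measure.volumeIoiPow, radMeas]
    ext s hs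
    rw [Measure.map_apply measurable_subtype_coe hs, withDensity_apply _ hs,
      withDensity_apply _ (measurable_subtype_coe hs),
      ← map_comap_subtype_coe (μ := (volume : Measure ℝ)) measurableSet_Ioi,
      hm.restrict_map, hm.lintegral_map]
  have : SigmaFinite (Measure.volumeIoiPow 2) :=
    (Measure.finiteSpanningSetsIn_volumeIoiPow_range_Iio 2).sigmaFinite
  have h4 := (MeasurePreserving.id sphMeas).prod h3
  refine ⟨Continuous.measurable (by fun_prop), ?_⟩
  rw [← h4.map_eq, Measure.map_map (Continuous.measurable (by fun_prop)) h4.measurable]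
  exact h2.map_eq

theorem sphMeas_real_univ : sphMeas.real univ = 4 * Real.pi := by
  rw [Measure.toSphere_real_apply_univ, measureReal_def, EuclideanSpace.volume_ball_fin_three]
  simp
  have := Real.pi_pos
  rw [ENNReal.toReal_ofReal (by positivity)]
  ring

theorem ae_radMeas_iff {p : ℝ → Prop} : (∀ᵐ r ∂radMeas, p r) ↔ ∀ᵐ r : ℝ, 0 < r → p r := by
  unfold radMeas
  rw [ae_withDensity_iff (by fun_prop), ae_restrict_iff' measurableSet_Ioi]
  refine eventually_congr (Eventually.of_forall fun r => forall_congr' fun hr => ?_)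
  have h : 0 < r := hr
  have : ENNReal.ofReal (r ^ 2) ≠ 0 := by simp; positivity
  simp [this]

theorem integral_radMeas (h : ℝ → ℝ) : ∫ r, h r ∂radMeas = ∫ r in Ioi (0 : ℝ), r ^ 2 * h r := by
  unfold radMeas
  rw [integral_withDensity_eq_integral_toReal_smul (by fun_prop) (by simp)]
  refine integral_congr_ae (Eventually.of_forall fun r => ?_)
  simp [ENNReal.toReal_ofReal (sq_nonneg r)]

theorem integral_polar (F : E3 → ℝ) (hF : Integrable F) :
    ∫ x, F x = ∫ r in Ioi (0 : ℝ), r ^ 2 * ∫ θ : S2, F (r • (θ : E3)) ∂sphMeas := by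
  have hm := measurePreserving_polar
  have hF' : Integrable F (Measure.map (fun p : S2 × ℝ => p.2 • (p.1 : E3))
    (sphMeas.prod radMeas)) := by rwa [hm.map_eq]
  rw [← hm.map_eq, integral_map hm.aemeasurable hF'.1]
  have h := integral_prod_symm _ (hF'.comp_aemeasurable hm.aemeasurable)
  simp only [Function.comp_apply] at h
  rw [h, integral_radMeas]

/-- The measures `r² dr` and `dr` have the same null sets on the half-line. In one direction Fubini
provides a single ray that is good for almost every radius; in the other, the sphere times a null
set of radii is null. -/
theorem ae_norm_iff {p : ℝ → Prop} : (∀ᵐ x : E3, p ‖x‖) ↔ ∀ᵐ r : ℝ, 0 < r → p r := by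
  have h := (volume : Measure E3).measurePreserving_homeomorphUnitSphereProd
  rw [← ae_radMeas_iff]
  have hm := measurePreserving_polar
  constructor
  · intro H
    have H2 := hm.quasiMeasurePreserving.ae H
    have H3 := Measure.ae_ae_of_ae_prod H2
    have hne : (ae sphMeas).NeBot := ae_neBot.2 (Measure.toSphere_ne_zero _)
    obtain ⟨θ, hθ⟩ := H3.exists
    rw [ae_radMeas_iff] at hθ ⊢
    filter_upwards [hθ] with r hr h0
    simpa [norm_smul, abs_of_pos h0] using hr h0
  · intro H
    obtain ⟨s, hs, hsm, hs0⟩ := exists_measurable_superset_of_null (ae_iff.1 H)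
    have : volume ((fun x : E3 => ‖x‖) ⁻¹' s) = 0 := by
      rw [← hm.measure_preimage (measurable_norm hsm).nullMeasurableSet]
      have : (fun p : S2 × ℝ => p.2 • (p.1 : E3)) ⁻¹' ((fun x : E3 => ‖x‖) ⁻¹' s)
        ⊆ (univ ×ˢ s) ∪ (univ ×ˢ Iic 0) := by
        rintro ⟨θ, r⟩ hx
        by_cases h0 : 0 < r
        · left; simpa [norm_smul, abs_of_pos h0] using hx
        · right; simpa using h0
      refine measure_mono_null this (measure_union_null ?_ ?_)
      · simp [Measure.prod_prod, hs0]
      · have : radMeas (Iic 0) = 0 := by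
          have : ∀ᵐ r ∂radMeas, ¬ r ≤ 0 := ae_radMeas_iff.2 (by simp)
          exact (ae_iff.1 this) ▸ (by simp; rfl)
        simp [Measure.prod_prod, this]
    refine measure_mono_null (fun x hx => ?_) this
    exact hs hx

theorem IsRadial.eq_profile {f : E3 → ℝ} (hf : IsRadial f) (x : E3) : f x = profile f ‖x‖ :=
  hf _ _ (by simp [norm_smul])

theorem IsRadial.apply_smul {f : E3 → ℝ} (hf : IsRadial f) {r : ℝ} (hr : 0 ≤ r) (θ : S2) :
    f (r • (θ : E3)) = profile f r := by
  rw [hf.eq_profile]; simp [norm_smul, abs_of_nonneg hr]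

/-- A fixed ray is a null set, so measurability cannot be read off there. A measurable
representative agrees with `f` along almost every ray, and by radiality any such ray gives the
profile. -/
theorem IsRadial.aestronglyMeasurable_profile {f : E3 → ℝ} (hf : IsRadial f)
    (hm : AEStronglyMeasurable f) : AEStronglyMeasurable (profile f) (volume.restrict (Ioi 0)) := by
  have hp := measurePreserving_polar
  obtain ⟨g, hg, hfg⟩ := hm
  have H2 := hp.quasiMeasurePreserving.ae hfg
  have H3 := Measure.ae_ae_of_ae_prod H2
  have hne : (ae sphMeas).NeBot := ae_neBot.2 (Measure.toSphere_ne_zero _)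
  obtain ⟨θ, hθ⟩ := H3.exists
  refine ⟨fun r => g (r • (θ : E3)), hg.comp_measurable (Continuous.measurable (by fun_prop)), ?_⟩
  rw [ae_radMeas_iff] at hθ
  rw [EventuallyEq, ae_restrict_iff' measurableSet_Ioi]
  filter_upwards [hθ] with r hr h0
  rw [← hr h0, hf.apply_smul (le_of_lt h0)]

/-- The mean of `φ` over the sphere of radius `|r|` about the origin. -/
def sphMean (φ : E3 → ℝ) (r : ℝ) : ℝ := (4 * Real.pi)⁻¹ * ∫ θ : S2, φ (r • (θ : E3)) ∂sphMeas

theorem IsRadial.integral_mul {g ψ : E3 → ℝ} (hg : IsRadial g)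
    (hI : Integrable fun x => g x * ψ x) :
    ∫ x, g x * ψ x = 4 * Real.pi * ∫ r in Ioi (0 : ℝ), r ^ 2 * profile g r * sphMean ψ r := by
  rw [integral_polar _ hI, ← integral_const_mul]
  refine setIntegral_congr_fun measurableSet_Ioi fun r hr => ?_
  have h : ∀ θ : S2, g (r • (θ : E3)) * ψ (r • (θ : E3)) = profile g r * ψ (r • (θ : E3)) :=
    fun θ => by rw [hg.apply_smul (le_of_lt hr)]
  simp only [h, integral_const_mul, sphMean]
  have := Real.pi_pos
  field_simp

theorem integral_norm_polar (h : ℝ → ℝ) :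
    ∫ x : E3, h ‖x‖ = 4 * Real.pi * ∫ r in Ioi (0 : ℝ), r ^ 2 * h r := by
  rw [integral_fun_norm_addHaar]
  have := sphMeas_real_univ
  rw [Measure.toSphere_real_apply_univ] at this
  simp only [nsmul_eq_mul, smul_eq_mul]
  rw [← mul_assoc, this]
  simp

theorem integrable_norm_iff {h : ℝ → ℝ} :
    Integrable (fun x : E3 => h ‖x‖) ↔ IntegrableOn (fun r => r ^ 2 * h r) (Ioi 0) := by
  rw [integrable_fun_norm_addHaar]; simp

theorem IsRadial.integral_eq {g : E3 → ℝ} (hg : IsRadial g) :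
    ∫ x, g x = 4 * Real.pi * ∫ r in Ioi (0 : ℝ), r ^ 2 * profile g r := by
  rw [← integral_norm_polar]; simp_rw [← hg.eq_profile]

theorem IsRadial.integrable_iff {g : E3 → ℝ} (hg : IsRadial g) :
    Integrable g ↔ IntegrableOn (fun r => r ^ 2 * profile g r) (Ioi 0) := by
  rw [← integrable_norm_iff]; simp_rw [← hg.eq_profile]

/-! ### Gaussian integrals and the moments of the sphere. -/

theorem integral_Ioi_pow_mul_exp_neg_sq (n : ℕ) :
    ∫ x in Ioi (0 : ℝ), x ^ n * Real.exp (-x ^ 2) = 1 / 2 * Real.Gamma ((n + 1) / 2) := by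
  have h := integral_rpow_mul_exp_neg_rpow (p := 2) (q := n) (by norm_num)
    (by have : (0 : ℝ) ≤ n := n.cast_nonneg
        linarith)
  simpa using h

theorem integrableOn_Ioi_pow_mul_exp_neg_sq (n : ℕ) :
    IntegrableOn (fun x : ℝ => x ^ n * Real.exp (-x ^ 2)) (Ioi 0) := by
  have h := integrableOn_rpow_mul_exp_neg_mul_sq (b := 1) (s := n) (by norm_num)
    (by have : (0 : ℝ) ≤ n := n.cast_nonneg
        linarith)
  simpa using h

theorem integral_pow_mul_exp_neg_sq_of_even {n : ℕ} (hn : Even n) :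
    ∫ x : ℝ, x ^ n * Real.exp (-x ^ 2) = Real.Gamma ((n + 1) / 2) := by
  have h := integral_comp_abs (f := fun x => x ^ n * Real.exp (-x ^ 2))
  simp only [hn.pow_abs, sq_abs] at h
  rw [h, integral_Ioi_pow_mul_exp_neg_sq]
  ring

theorem integral_pow_mul_exp_neg_sq_of_odd {n : ℕ} (hn : Odd n) :
    ∫ x : ℝ, x ^ n * Real.exp (-x ^ 2) = 0 := by
  have h := integral_neg_eq_self (fun x : ℝ => x ^ n * Real.exp (-x ^ 2)) volume
  simp only [hn.neg_pow, neg_mul, integral_neg, even_two.neg_pow] at h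
  linarith

theorem integral_exp_neg_sq : ∫ x : ℝ, Real.exp (-x ^ 2) = √Real.pi := by
  simpa using integral_gaussian 1

theorem integral_coord_pow_mul_gaussian (n : ℕ) :
    ∫ x : E3, x 0 ^ n * Real.exp (-‖x‖ ^ 2)
      = Real.pi * ∫ x : ℝ, x ^ n * Real.exp (-x ^ 2) := by
  rw [← (PiLp.volume_preserving_toLp (Fin 3)).integral_comp
    (MeasurableEquiv.toLp 2 (Fin 3 → ℝ)).measurableEmbedding]
  have h := integral_fintype_prod_volume_eq_prod (𝕜 := ℝ) (ι := Fin 3) (E := fun _ => ℝ)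
    ![fun x => x ^ n * Real.exp (-x ^ 2), fun x => Real.exp (-x ^ 2), fun x => Real.exp (-x ^ 2)]
  simp only [Fin.prod_univ_three, Matrix.cons_val_zero, Matrix.cons_val_one,
    Matrix.cons_val_two, Matrix.head_cons, Matrix.tail_cons,
    integral_exp_neg_sq] at h
  rw [mul_assoc, Real.mul_self_sqrt Real.pi_pos.le, mul_comm] at h
  rw [← h]
  congr 1
  funext x
  rw [EuclideanSpace.norm_sq_eq, Fin.sum_univ_three]
  simp only [Real.norm_eq_abs, sq_abs, neg_add, Real.exp_add]
  ring

/-- The Gaussian is invariant under isometries, and the reflection exchanging `e` with the first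
basis vector reduces the integral to a power of one coordinate. -/
theorem integral_inner_pow_mul_gaussian {e : E3} (he : ‖e‖ = 1) (n : ℕ) :
    ∫ x : E3, inner ℝ e x ^ n * Real.exp (-‖x‖ ^ 2)
      = Real.pi * ∫ x : ℝ, x ^ n * Real.exp (-x ^ 2) := by
  rw [← integral_coord_pow_mul_gaussian]
  set e₀ : E3 := EuclideanSpace.single (0 : Fin 3) (1 : ℝ) with he₀
  have hn : ‖e‖ = ‖e₀‖ := by simp [he, he₀]
  set T := (ℝ ∙ (e - e₀))ᗮ.reflection with hT
  have hTe : T e = e₀ := Submodule.reflection_sub hn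
  rw [← T.measurePreserving.integral_comp T.toHomeomorph.measurableEmbedding
    (fun x : E3 => x 0 ^ n * Real.exp (-‖x‖ ^ 2))]
  congr 1
  funext x
  have h1 : (T x) 0 = inner ℝ e x := by
    rw [← T.inner_map_map e x, hTe, he₀]
    simp [EuclideanSpace.inner_single_left]
  simp [h1]

/-- The Gaussian integral of `⟨e, x⟩ ^ n` is computed in Cartesian and in polar coordinates. The two
values involve `Γ((n+1)/2)` and `Γ((n+3)/2)`, whose quotient `(n+1)/2` produces the denominator `n +
1`. -/
theorem integral_sphere_inner_pow {e : E3} (he : ‖e‖ = 1) (n : ℕ) :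
    ∫ θ : S2, inner ℝ e (θ : E3) ^ n ∂sphMeas
      = if Even n then 4 * Real.pi / (n + 1) else 0 := by
  have hint : Integrable fun x : E3 => inner ℝ e x ^ n * Real.exp (-‖x‖ ^ 2) := by
    have h1 : Integrable fun x : E3 => ‖x‖ ^ n * Real.exp (-‖x‖ ^ 2) := by
      rw [integrable_norm_iff (h := fun r => r ^ n * Real.exp (-r ^ 2))]
      have := integrableOn_Ioi_pow_mul_exp_neg_sq (n + 2)
      refine this.congr_fun (fun r _ => ?_) measurableSet_Ioi
      simp only; ring
    refine h1.mono' (by fun_prop) (Eventually.of_forall fun x => ?_)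
    rw [norm_mul, norm_pow, Real.norm_of_nonneg (Real.exp_pos _).le]
    have : ‖inner ℝ e x‖ ≤ ‖x‖ := by simpa [he] using norm_inner_le_norm (𝕜 := ℝ) e x
    gcongr
  have h := integral_polar _ hint
  have h2 : ∀ r ∈ Ioi (0 : ℝ), r ^ 2 * ∫ θ : S2, inner ℝ e (r • (θ : E3)) ^ n *
      Real.exp (-‖r • (θ : E3)‖ ^ 2) ∂sphMeas
      = (∫ θ : S2, inner ℝ e (θ : E3) ^ n ∂sphMeas) * (r ^ (n + 2) * Real.exp (-r ^ 2)) := by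
    intro r hr
    have hr' : 0 < r := hr
    rw [← integral_const_mul, ← integral_mul_const]
    congr 1
    funext θ
    simp only [inner_smul_right, norm_smul, Real.norm_eq_abs, abs_of_pos hr', norm_eq_of_mem_sphere]
    simp only [mul_one, mul_pow]
    ring
  rw [setIntegral_congr_fun measurableSet_Ioi h2, integral_const_mul,
    integral_inner_pow_mul_gaussian he, integral_Ioi_pow_mul_exp_neg_sq] at h
  have hG : Real.Gamma (((n + 2 : ℕ) + 1) / 2) = ((n : ℝ) + 1) / 2 * Real.Gamma ((n + 1) / 2) := by
    rw [← Real.Gamma_add_one (by positivity)]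
    congr 1; push_cast; ring
  have hpos : 0 < Real.Gamma (((n : ℝ) + 1) / 2) := Real.Gamma_pos_of_pos (by positivity)
  have hn1 : (0 : ℝ) < n + 1 := by positivity
  rw [hG] at h
  split_ifs with hev
  · rw [integral_pow_mul_exp_neg_sq_of_even hev] at h
    rw [eq_div_iff hn1.ne']
    have : Real.Gamma (((n : ℝ) + 1) / 2) * (4 * Real.pi) = Real.Gamma (((n : ℝ) + 1) / 2) *
      ((∫ θ : S2, inner ℝ e (θ : E3) ^ n ∂sphMeas) * (n + 1)) := by linarith
    exact (mul_left_cancel₀ hpos.ne' this).symm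
  · rw [integral_pow_mul_exp_neg_sq_of_odd (Nat.not_even_iff_odd.1 hev), mul_zero] at h
    have := h.symm
    have hne : (1 / 2 * (((n : ℝ) + 1) / 2 * Real.Gamma ((n + 1) / 2))) ≠ 0 := by positivity
    exact (mul_eq_zero.1 this).resolve_right hne

-- Expand the exponential and integrate term by term: only even powers survive, and `1 / ((2m)!
-- (2m+1)) = 1 / (2m+1)!` gives the series of `sinh`. Multiplying by `k` instead of dividing keeps
-- the case `k = 0`.
open scoped Nat in
theorem integral_sphere_exp_inner_unit {e : E3} (he : ‖e‖ = 1) (k : ℝ) :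
    k * ∫ θ : S2, Real.exp (k * inner ℝ e (θ : E3)) ∂sphMeas = 4 * Real.pi * Real.sinh k := by
  have hb : ∀ (n : ℕ) (θ : S2), ‖(k * inner ℝ e (θ : E3)) ^ n / (n ! : ℝ)‖ ≤ |k| ^ n / n ! := by
    intro n θ
    have : ‖inner ℝ e (θ : E3)‖ ≤ 1 := by
      simpa [he] using norm_inner_le_norm (𝕜 := ℝ) e (θ : E3)
    rw [norm_div, norm_pow, norm_mul, Real.norm_natCast, Real.norm_eq_abs k]
    gcongr
    exact mul_le_of_le_one_right (abs_nonneg _) this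
  have h1 : HasSum (fun n : ℕ => ∫ θ : S2, (k * inner ℝ e (θ : E3)) ^ n / (n ! : ℝ) ∂sphMeas)
      (∫ θ : S2, Real.exp (k * inner ℝ e (θ : E3)) ∂sphMeas) := by
    refine hasSum_integral_of_dominated_convergence (fun n _ => |k| ^ n / n !)
      (fun n => Continuous.aestronglyMeasurable (by fun_prop))
      (fun n => Eventually.of_forall (hb n))
      (Eventually.of_forall fun _ => Real.summable_pow_div_factorial _)
      (integrable_const _) (Eventually.of_forall fun θ => ?_)
    rw [Real.exp_eq_exp_ℝ]
    exact NormedSpace.expSeries_div_hasSum_exp _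
  have h2 : ∀ n : ℕ, ∫ θ : S2, (k * inner ℝ e (θ : E3)) ^ n / (n ! : ℝ) ∂sphMeas
      = k ^ n / n ! * if Even n then 4 * Real.pi / (n + 1) else 0 := by
    intro n
    rw [← integral_sphere_inner_pow he, ← integral_const_mul]
    congr 1; funext θ; ring
  simp only [h2] at h1
  have h3 : Function.Injective fun n : ℕ => 2 * n := fun a b h => by simpa using h
  rw [← h3.hasSum_iff (by
    intro n hn
    rw [if_neg, mul_zero]
    rintro ⟨m, hm⟩
    exact hn ⟨m, by simp [hm, two_mul]⟩)] at h1
  have h4 := (Real.hasSum_sinh k).mul_left (4 * Real.pi)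
  refine (h1.mul_left k).unique ?_
  convert h4 using 2 with n
  simp only [Function.comp_apply, even_two, Even.mul_right, if_true, Nat.factorial_succ]
  push_cast
  field_simp
  ring

theorem integral_sphere_exp_inner (ξ : E3) :
    ‖ξ‖ * ∫ θ : S2, Real.exp (inner ℝ ξ (θ : E3)) ∂sphMeas = 4 * Real.pi * Real.sinh ‖ξ‖ := by
  rcases eq_or_ne ξ 0 with rfl | h
  · simp
  have hn : ‖ξ‖ ≠ 0 := norm_ne_zero_iff.2 h
  rw [← integral_sphere_exp_inner_unit (e := ‖ξ‖⁻¹ • ξ) (by simp [norm_smul, hn]) ‖ξ‖]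
  congr 2
  funext θ
  rw [real_inner_smul_left, mul_inv_cancel_left₀ hn]

/-! ### Exponentials: spherical means and density. -/

/-- The function `x ↦ exp ⟨ξ, x⟩`. -/
def expInner (ξ : E3) : C(E3, ℝ) where
  toFun x := Real.exp (inner ℝ ξ x)
  continuous_toFun := by fun_prop

/-- Both sides are odd in `r`, so negative radii are allowed; they occur below as `r - t`. -/
theorem sphMean_expInner (ξ : E3) (r : ℝ) :
    (r * ‖ξ‖) * sphMean (expInner ξ) r = Real.sinh (r * ‖ξ‖) := by
  have h := integral_sphere_exp_inner (r • ξ)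
  have h2 : ∀ θ : S2, Real.exp (inner ℝ (r • ξ) (θ : E3)) = expInner ξ (r • (θ : E3)) := by
    intro θ
    simp [expInner, real_inner_smul_left, real_inner_smul_right]
  simp only [h2, norm_smul, Real.norm_eq_abs] at h
  have hpi := Real.pi_pos
  have key : ∀ c : ℝ, |r| * ‖ξ‖ * c = 4 * Real.pi * Real.sinh (|r| * ‖ξ‖) →
      (r * ‖ξ‖) * ((4 * Real.pi)⁻¹ * c) = Real.sinh (r * ‖ξ‖) := by
    intro c hc
    rcases abs_cases r with ⟨hr, _⟩ | ⟨hr, _⟩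
    · rw [hr] at hc
      field_simp
      linarith
    · rw [hr, neg_mul, Real.sinh_neg] at hc
      field_simp
      linarith
  exact key _ h

/-- Stone–Weierstrass. Products of exponentials are exponentials, so their linear span is already an
algebra, and `expInner (x - y)` separates `x` from `y`. -/
theorem exists_near_of_isCompact (φ : C(E3, ℝ)) {K : Set E3} (hK : IsCompact K) {ε : ℝ}
    (hε : 0 < ε) :
    ∃ g ∈ Submodule.span ℝ (range expInner), ∀ x ∈ K, |g x - φ x| < ε := by
  let M : Submonoid C(E3, ℝ) :=
    { carrier := range expInner
      one_mem' := ⟨0, by ext x; simp [expInner]⟩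
      mul_mem' := by
        rintro _ _ ⟨a, rfl⟩ ⟨b, rfl⟩
        exact ⟨a + b, by ext x; simp [expInner, inner_add_left, Real.exp_add]⟩ }
  have hM : (M : Set C(E3, ℝ)) = range expInner := rfl
  let A : Subalgebra ℝ C(E3, ℝ) := Algebra.adjoin ℝ (M : Set C(E3, ℝ))
  have hA : A.SeparatesPoints := by
    intro x y hxy
    refine ⟨expInner (x - y), ⟨expInner (x - y), Algebra.subset_adjoin ⟨_, rfl⟩, rfl⟩, ?_⟩
    intro h
    simp only [expInner, ContinuousMap.coe_mk, Real.exp_eq_exp] at h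
    have : inner ℝ (x - y) (x - y) = 0 := by rw [inner_sub_right, h, sub_self]
    exact hxy (sub_eq_zero.1 (inner_self_eq_zero.1 this))
  obtain ⟨g, hg, hgK⟩ :=
    ContinuousMap.exists_mem_subalgebra_near_continuous_of_isCompact_of_separatesPoints hA φ hK hε
  refine ⟨g, ?_, hgK⟩
  have h := Algebra.adjoin_eq_span (R := ℝ) (s := (M : Set C(E3, ℝ)))
  rw [Submonoid.closure_eq, hM] at h
  rw [← h]
  exact hg

/-! ### Calculus of spherical means. -/

theorem integrable_sphere {f : S2 → ℝ} (hf : Continuous f) : Integrable f sphMeas :=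
  integrableOn_univ.mp (hf.continuousOn.integrableOn_compact isCompact_univ)

theorem sphMean_const (c r : ℝ) : sphMean (fun _ => c) r = c := by
  have := Real.pi_pos
  simp only [sphMean, integral_const, sphMeas_real_univ, smul_eq_mul]
  field_simp

theorem sphMean_add {f g : E3 → ℝ} (hf : Continuous f) (hg : Continuous g) (r : ℝ) :
    sphMean (fun x => f x + g x) r = sphMean f r + sphMean g r := by
  simp only [sphMean]
  rw [integral_add (integrable_sphere (by fun_prop)) (integrable_sphere (by fun_prop)), mul_add]

theorem sphMean_const_mul (f : E3 → ℝ) (c r : ℝ) :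
    sphMean (fun x => c * f x) r = c * sphMean f r := by
  simp only [sphMean, integral_const_mul]; ring

theorem sphMean_congr {f g : E3 → ℝ} {r : ℝ} (h : ∀ x, ‖x‖ = |r| → f x = g x) :
    sphMean f r = sphMean g r := by
  simp only [sphMean]
  congr 2; funext θ
  exact h _ (by simp [norm_smul])

theorem sphMean_mono {f g : E3 → ℝ} (hf : Continuous f) (hg : Continuous g) {r : ℝ}
    (h : ∀ x, ‖x‖ = |r| → f x ≤ g x) : sphMean f r ≤ sphMean g r := by
  have := Real.pi_pos
  simp only [sphMean]
  refine mul_le_mul_of_nonneg_left ?_ (by positivity)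
  exact integral_mono (integrable_sphere (f := fun θ => f (r • (θ : E3))) (by fun_prop))
    (integrable_sphere (f := fun θ => g (r • (θ : E3))) (by fun_prop))
    fun θ => h _ (by simp [norm_smul])

theorem abs_sphMean_sub_le {f g : E3 → ℝ} (hf : Continuous f) (hg : Continuous g) {r ε : ℝ}
    (h : ∀ x, ‖x‖ = |r| → |f x - g x| ≤ ε) : |sphMean f r - sphMean g r| ≤ ε := by
  have h1 : sphMean f r ≤ sphMean g r + ε := by
    rw [← sphMean_const ε r, ← sphMean_add hg continuous_const]
    exact sphMean_mono hf (by fun_prop) fun x hx => by have := abs_le.1 (h x hx); linarith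
  have h2 : sphMean g r ≤ sphMean f r + ε := by
    rw [← sphMean_const ε r, ← sphMean_add hf continuous_const]
    exact sphMean_mono hg (by fun_prop) fun x hx => by have := abs_le.1 (h x hx); linarith
  rw [abs_le]; constructor <;> linarith

theorem continuous_integral_sphere {X : Type*} [TopologicalSpace X] [FirstCountableTopology X]
    [LocallyCompactSpace X] {f : X → S2 → ℝ} (hf : Continuous (Function.uncurry f)) :
    Continuous fun x => ∫ θ, f x θ ∂sphMeas := by
  have := continuous_parametric_integral_of_continuous (μ := sphMeas) hf isCompact_univ
  simpa using this

@[fun_prop]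
theorem continuous_sphMean {f : E3 → ℝ} (hf : Continuous f) : Continuous (sphMean f) := by
  unfold sphMean
  exact continuous_const.mul (continuous_integral_sphere (by
    simp only [Function.uncurry_def]; fun_prop))

/-- The mean over `|y| = |t|` of `φ (x + y)`. -/
def shiftMean (φ : E3 → ℝ) (t : ℝ) (x : E3) : ℝ := sphMean (fun y => φ (x + y)) t

@[fun_prop]
theorem continuous_shiftMean {φ : E3 → ℝ} (hφ : Continuous φ) (t : ℝ) :
    Continuous (shiftMean φ t) := by
  unfold shiftMean sphMean
  exact continuous_const.mul (continuous_integral_sphere (by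
    simp only [Function.uncurry_def]; fun_prop))

/-- For an exponential the iterated mean factors into the product of two means. The formula becomes
`2 sinh a sinh b = cosh (a + b) - cosh (a - b)`. -/
theorem sphMean_shiftMean_expInner (ξ : E3) (r t : ℝ) :
    r * t * sphMean (shiftMean (expInner ξ) t) r
      = 1 / 2 * ∫ ρ in (r - t)..(r + t), ρ * sphMean (expInner ξ) ρ := by
  have h1 : shiftMean (expInner ξ) t = fun x => sphMean (expInner ξ) t * expInner ξ x := by
    funext x
    unfold shiftMean
    rw [mul_comm, ← sphMean_const_mul]
    congr 1; funext y
    simp [expInner, inner_add_right, Real.exp_add]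
  rw [h1, sphMean_const_mul]
  rcases eq_or_ne ξ 0 with rfl | hξ
  · have : ∀ r, sphMean (expInner 0) r = 1 := by
      intro r
      rw [← sphMean_const 1 r]; congr 1; funext x; simp [expInner]
    simp only [this, mul_one, integral_id]
    ring
  have hk : ‖ξ‖ ≠ 0 := norm_ne_zero_iff.2 hξ
  have h2 : ∀ ρ, ρ * sphMean (expInner ξ) ρ = ‖ξ‖⁻¹ * Real.sinh (ρ * ‖ξ‖) := by
    intro ρ
    rw [← sphMean_expInner]; field_simp
  have h3 : ∀ ρ : ℝ, HasDerivAt (fun ρ => ‖ξ‖⁻¹ * ‖ξ‖⁻¹ * Real.cosh (ρ * ‖ξ‖))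
      (‖ξ‖⁻¹ * Real.sinh (ρ * ‖ξ‖)) ρ := by
    intro ρ
    have := ((hasDerivAt_id ρ).mul_const ‖ξ‖).cosh.const_mul (‖ξ‖⁻¹ * ‖ξ‖⁻¹)
    simp only [id] at this
    convert! this using 1
    field_simp
  simp only [h2]
  rw [intervalIntegral.integral_eq_sub_of_hasDerivAt (fun ρ _ => h3 ρ)
    (Continuous.intervalIntegrable (by fun_prop) _ _)]
  have h4 : r * t * (sphMean (expInner ξ) t * sphMean (expInner ξ) r)
    = (r * sphMean (expInner ξ) r) * (t * sphMean (expInner ξ) t) := by ring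
  rw [h4, h2, h2, add_mul, sub_mul, Real.cosh_add, Real.cosh_sub]
  field_simp
  ring

theorem sphMean_shiftMean_of_mem_span {g : C(E3, ℝ)}
    (hg : g ∈ Submodule.span ℝ (range expInner)) (r t : ℝ) :
    r * t * sphMean (shiftMean g t) r = 1 / 2 * ∫ ρ in (r - t)..(r + t), ρ * sphMean g ρ := by
  induction hg using Submodule.span_induction with
  | mem x h => obtain ⟨ξ, rfl⟩ := h; exact sphMean_shiftMean_expInner ξ r t
  | zero =>
    have : ∀ r, sphMean (fun _ => (0 : ℝ)) r = 0 := fun r => sphMean_const 0 r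
    have h1 : shiftMean (0 : C(E3, ℝ)) t = fun _ => 0 := funext fun _ => this t
    rw [h1]
    simp only [ContinuousMap.coe_zero, Pi.zero_def, this]
    simp
  | add f g _ _ hf hg =>
    have h1 : shiftMean (f + g : C(E3, ℝ)) t = fun x => shiftMean f t x + shiftMean g t x := by
      funext x
      exact sphMean_add (by fun_prop) (by fun_prop) t
    have h2 : ∀ r, sphMean (f + g : C(E3, ℝ)) r = sphMean f r + sphMean g r := fun r =>
      sphMean_add f.continuous g.continuous r
    rw [h1, sphMean_add (by fun_prop) (by fun_prop)]
    simp only [h2, mul_add]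
    rw [intervalIntegral.integral_add (Continuous.intervalIntegrable (by fun_prop) _ _)
      (Continuous.intervalIntegrable (by fun_prop) _ _), hf, hg]
    ring
  | smul c f _ hf =>
    have h1 : shiftMean (c • f : C(E3, ℝ)) t = fun x => c * shiftMean f t x := by
      funext x
      exact sphMean_const_mul _ _ _
    have h2 : ∀ r, sphMean (c • f : C(E3, ℝ)) r = c * sphMean f r := fun r =>
      sphMean_const_mul f c r
    rw [h1, sphMean_const_mul]
    simp only [h2, mul_left_comm _ c, intervalIntegral.integral_const_mul]
    rw [hf]

/-- The mean over `|x| = |r|` of the means over the spheres of radius `|t|` about `x`. -/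
theorem sphMean_shiftMean {φ : E3 → ℝ} (hφ : Continuous φ) (r t : ℝ) :
    r * t * sphMean (shiftMean φ t) r = 1 / 2 * ∫ ρ in (r - t)..(r + t), ρ * sphMean φ ρ := by
  set M := |r| + |t| with hM
  -- Both sides involve `φ` only on the ball of radius `|r| + |t|`. Replacing `φ` there by an
  -- `ε`-close combination of exponentials changes them by `O(ε)`.
  have key : ∀ ε > 0, |r * t * sphMean (shiftMean φ t) r
      - 1 / 2 * ∫ ρ in (r - t)..(r + t), ρ * sphMean φ ρ| ≤ ε * (|r * t| + M * |t|) := by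
    intro ε hε
    obtain ⟨g, hg, hgK⟩ := exists_near_of_isCompact ⟨φ, hφ⟩
      (isCompact_closedBall (0 : E3) M) hε
    simp only [mem_closedBall_zero_iff, ContinuousMap.coe_mk] at hgK
    have hgc := g.continuous
    have h1 : |sphMean (shiftMean g t) r - sphMean (shiftMean φ t) r| ≤ ε := by
      refine abs_sphMean_sub_le (by fun_prop) (by fun_prop) fun x hx => ?_
      refine abs_sphMean_sub_le (by fun_prop) (by fun_prop) fun y hy => (hgK _ ?_).le
      exact (norm_add_le _ _).trans (by rw [hx, hy])
    have h2 : |(∫ ρ in (r - t)..(r + t), ρ * sphMean g ρ)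
        - ∫ ρ in (r - t)..(r + t), ρ * sphMean φ ρ| ≤ (M * ε) * |(r + t) - (r - t)| := by
      rw [← intervalIntegral.integral_sub (Continuous.intervalIntegrable (by fun_prop) _ _)
        (Continuous.intervalIntegrable (by fun_prop) _ _)]
      refine intervalIntegral.norm_integral_le_of_norm_le_const (E := ℝ) fun ρ hρ => ?_
      have hρM : |ρ| ≤ M := by
        have h3 : ρ ∈ uIcc (r - t) (r + t) := uIoc_subset_uIcc hρ
        rw [mem_uIcc] at h3
        rw [abs_le]
        have := le_abs_self r; have := neg_abs_le r
        have := le_abs_self t; have := neg_abs_le t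
        rcases h3 with h | h <;> constructor <;> linarith [h.1, h.2]
      rw [← mul_sub, norm_mul]
      refine mul_le_mul hρM ?_ (abs_nonneg _) (by positivity)
      exact abs_sphMean_sub_le (by fun_prop) (by fun_prop) fun x hx => (hgK _ (hx ▸ hρM)).le
    have h3 := sphMean_shiftMean_of_mem_span hg r t
    have h4 : |(r + t) - (r - t)| = 2 * |t| := by
      rw [show (r + t) - (r - t) = 2 * t by ring, abs_mul, abs_two]
    rw [h4] at h2
    have h5 : r * t * sphMean (shiftMean φ t) r
      - 1 / 2 * ∫ ρ in (r - t)..(r + t), ρ * sphMean φ ρ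
      = -(r * t * (sphMean (shiftMean g t) r - sphMean (shiftMean φ t) r))
        + 1 / 2 * ((∫ ρ in (r - t)..(r + t), ρ * sphMean g ρ)
        - ∫ ρ in (r - t)..(r + t), ρ * sphMean φ ρ) := by
      rw [mul_sub, mul_sub, h3]; ring
    rw [h5]
    refine (abs_add_le _ _).trans ?_
    rw [abs_neg, abs_mul, abs_mul (1 / 2 : ℝ), abs_of_pos (by norm_num : (0 : ℝ) < 1 / 2)]
    have h6 : |r * t| * |sphMean (shiftMean g t) r - sphMean (shiftMean φ t) r| ≤ |r * t| * ε := by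
      gcongr
    linarith
  rw [← sub_eq_zero, ← abs_nonpos_iff]
  have hlim : Tendsto (fun ε : ℝ => ε * (|r * t| + M * |t|)) (𝓝[>] 0) (𝓝 0) := by
    have : Tendsto (fun ε : ℝ => ε * (|r * t| + M * |t|)) (𝓝 0) (𝓝 (0 * (|r * t| + M * |t|))) :=
      Continuous.tendsto (by fun_prop) 0
    rw [zero_mul] at this
    exact this.mono_left nhdsWithin_le_nhds
  exact ge_of_tendsto hlim (eventually_mem_nhdsWithin.mono key)

/-! ### Derivatives of spherical means and the propagators. -/

/-- The compact parameter space is general because the lemma is applied both to the sphere and to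
the product of two spheres. -/
theorem hasDerivAt_integral_line {X : Type*} [TopologicalSpace X] [CompactSpace X] [T2Space X]
    [MeasurableSpace X] [OpensMeasurableSpace X] [SecondCountableTopology X]
    {ν : Measure X} [IsFiniteMeasure ν]
    {φ : E3 → ℝ} (hφ : ContDiff ℝ 1 φ) {a b : X → E3} (ha : Continuous a) (hb : Continuous b)
    (s₀ : ℝ) :
    HasDerivAt (fun s => ∫ p, φ (a p + s • b p) ∂ν)
      (∫ p, fderiv ℝ φ (a p + s₀ • b p) (b p) ∂ν) s₀ := by
  have hd : Continuous (fderiv ℝ φ) := hφ.continuous_fderiv (by simp)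
  have hc : Continuous φ := hφ.continuous
  have hint : ∀ {f : X → ℝ}, Continuous f → Integrable f ν := fun hf =>
    integrableOn_univ.mp (hf.continuousOn.integrableOn_compact isCompact_univ)
  have hF' : Continuous fun q : ℝ × X => fderiv ℝ φ (a q.2 + q.1 • b q.2) (b q.2) := by fun_prop
  obtain ⟨C, hC⟩ := ((isCompact_Icc (a := s₀ - 1) (b := s₀ + 1)).prod
    (isCompact_univ (X := X))).exists_bound_of_continuousOn hF'.continuousOn
  refine (hasDerivAt_integral_of_dominated_loc_of_deriv_le (μ := ν)
    (F := fun s p => φ (a p + s • b p)) (bound := fun _ => C)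
    (F' := fun s p => fderiv ℝ φ (a p + s • b p) (b p)) (Icc_mem_nhds (a := s₀ - 1)
      (b := s₀ + 1) (by linarith) (by linarith))
    (Eventually.of_forall fun s => (Continuous.aestronglyMeasurable (by fun_prop)))
    (hint (by fun_prop)) (Continuous.aestronglyMeasurable (by fun_prop))
    (Eventually.of_forall fun p s hs => hC (s, p) ⟨hs, mem_univ _⟩) (integrable_const _)
    (Eventually.of_forall fun p s _ => ?_)).2
  have h1 : HasDerivAt (fun s : ℝ => a p + s • b p) (b p) s := by
    simpa using ((hasDerivAt_id s).smul_const (b p)).const_add (a p)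
  exact ((hφ.differentiable (by simp)) _).hasFDerivAt.comp_hasDerivAt s h1

theorem hasDerivAt_sphMean {ψ : E3 → ℝ} (hψ : ContDiff ℝ 1 ψ) {r : ℝ} (hr : 0 < r) :
    HasDerivAt (sphMean ψ) (sphMean (fun x => fderiv ℝ ψ x (‖x‖⁻¹ • x)) r) r := by
  have h := (hasDerivAt_integral_line (ν := sphMeas) hψ (a := fun _ => 0)
    (b := fun θ : S2 => (θ : E3)) (by fun_prop) (by fun_prop) r).const_mul (4 * Real.pi)⁻¹
  simp only [zero_add] at h
  have h2 : sphMean (fun x => fderiv ℝ ψ x (‖x‖⁻¹ • x)) r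
      = (4 * Real.pi)⁻¹ * ∫ θ : S2, fderiv ℝ ψ (r • (θ : E3)) (θ : E3) ∂sphMeas := by
    unfold sphMean
    congr 2; funext θ
    simp [norm_smul, abs_of_pos hr, smul_smul, hr.ne']
  rw [h2]
  exact h

theorem sinProp_apply (t : ℝ) (φ : Test) (x : E3) :
    sinProp t φ x = t * shiftMean φ t x := by
  change (4 * Real.pi)⁻¹ * ∫ θ : S2, t * φ (x + t • (θ : E3)) ∂sphMeas = _
  rw [integral_const_mul]
  unfold shiftMean sphMean
  ring

theorem cosProp_apply (t : ℝ) (φ : Test) (x : E3) :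
    cosProp t φ x = (4 * Real.pi)⁻¹ * ∫ θ : S2, (φ (x + t • (θ : E3)) +
      fderiv ℝ φ (x + t • (θ : E3)) (t • (θ : E3))) ∂sphMeas := rfl

theorem Test.continuous (φ : Test) : Continuous φ := φ.contDiff.continuous

theorem Test.continuous_fderiv (φ : Test) : Continuous (fderiv ℝ φ) :=
  φ.contDiff.continuous_fderiv (by simp)

theorem mul_sphMean_sinProp (t : ℝ) (φ : Test) (r : ℝ) :
    r * sphMean (sinProp t φ) r = 1 / 2 * ∫ ρ in (r - t)..(r + t), ρ * sphMean φ ρ := by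
  rw [← sphMean_shiftMean φ.continuous, mul_assoc, ← sphMean_const_mul (shiftMean φ t)]
  congr 2
  exact funext fun x => sinProp_apply t φ x

theorem hasDerivAt_integral_sub_add {f : ℝ → ℝ} (hf : Continuous f) (a b : ℝ → ℝ) {a' b' t : ℝ}
    (ha : HasDerivAt a a' t) (hb : HasDerivAt b b' t) :
    HasDerivAt (fun s => ∫ ρ in (a s)..(b s), f ρ) (f (b t) * b' - f (a t) * a') t := by
  have h : ∀ u, HasDerivAt (fun u => ∫ ρ in (0 : ℝ)..u, f ρ) (f u) u := fun u =>
    intervalIntegral.integral_hasDerivAt_right (hf.intervalIntegrable _ _)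
      hf.stronglyMeasurable.stronglyMeasurableAtFilter hf.continuousAt
  have h2 := ((h (b t)).comp t hb).sub ((h (a t)).comp t ha)
  refine h2.congr_of_eventuallyEq (Eventually.of_forall fun s => ?_)
  simp only [Pi.sub_apply, Function.comp_apply]
  rw [intervalIntegral.integral_interval_sub_left (hf.intervalIntegrable _ _)
    (hf.intervalIntegrable _ _)]

/-- The cosine propagator is the `t`-derivative of the sine propagator, so this is
`sphMean_shiftMean` differentiated in `t`. The left side is differentiated as an integral over a
product of two spheres, the right side by the fundamental theorem of calculus. -/
theorem mul_sphMean_cosProp (t : ℝ) (φ : Test) (r : ℝ) :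
    r * sphMean (cosProp t φ) r
      = 1 / 2 * ((r + t) * sphMean φ (r + t) + (r - t) * sphMean φ (r - t)) := by
  have hφ : ContDiff ℝ 1 φ := φ.contDiff.of_le (by simp)
  have hc := φ.continuous
  have hd := φ.continuous_fderiv
  have hint : ∀ {f : S2 × S2 → ℝ}, Continuous f → Integrable f (sphMeas.prod sphMeas) :=
    fun hf => integrableOn_univ.mp (hf.continuousOn.integrableOn_compact isCompact_univ)
  have h1 := (hasDerivAt_integral_line (ν := sphMeas.prod sphMeas) hφ
    (a := fun p : S2 × S2 => r • (p.1 : E3)) (b := fun p : S2 × S2 => (p.2 : E3))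
    (by fun_prop) (by fun_prop) t)
  have h2 := ((hasDerivAt_id t).mul h1).const_mul ((4 * Real.pi)⁻¹ * (4 * Real.pi)⁻¹)
  have h3 : ∀ s, sphMean (shiftMean φ s) r = ((4 * Real.pi)⁻¹ * (4 * Real.pi)⁻¹) *
      ∫ p : S2 × S2, φ (r • (p.1 : E3) + s • (p.2 : E3)) ∂(sphMeas.prod sphMeas) := by
    intro s
    rw [integral_prod _ (hint (by fun_prop))]
    simp only [sphMean, shiftMean, integral_const_mul]
    ring
  have h4 : sphMean (cosProp t φ) r = ((4 * Real.pi)⁻¹ * (4 * Real.pi)⁻¹) *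
      (1 * (∫ p : S2 × S2, φ (r • (p.1 : E3) + t • (p.2 : E3)) ∂(sphMeas.prod sphMeas)) +
       t * (∫ p : S2 × S2, fderiv ℝ φ (r • (p.1 : E3) + t • (p.2 : E3)) (p.2 : E3)
        ∂(sphMeas.prod sphMeas))) := by
    rw [one_mul, ← integral_const_mul t, ← integral_add (hint (by fun_prop)) (hint (by fun_prop)),
      integral_prod _ (hint (by fun_prop))]
    simp only [sphMean, cosProp_apply, integral_const_mul, map_smul, smul_eq_mul]
    ring
  simp only [id] at h2
  rw [← h4] at h2
  have h5 : HasDerivAt (fun s => r * s * sphMean (shiftMean φ s) r) (r * sphMean (cosProp t φ) r)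
      t := by
    convert! h2.const_mul r using 1
    funext s
    simp only [Pi.mul_apply, id]
    rw [h3]; ring
  have h6 : HasDerivAt (fun s => r * s * sphMean (shiftMean φ s) r)
      (1 / 2 * ((r + t) * sphMean φ (r + t) * 1 - (r - t) * sphMean φ (r - t) * (-1))) t := by
    simp only [sphMean_shiftMean hc]
    exact (hasDerivAt_integral_sub_add (by fun_prop) (fun s => r - s) (fun s => r + s)
      ((hasDerivAt_id t).const_sub r) ((hasDerivAt_id t).const_add r)).const_mul _
  rw [h5.unique h6]; ring

/-- The last two terms on the left are `∂_r` of `r` times the mean of the sine propagator, which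
contributes half the difference of the values at `r + t` and `r - t`. The cosine contributes half
their sum, so the value at `r - t` cancels: this is why outgoing data are only translated to the
right. -/
theorem sphMean_outgoing (t : ℝ) (φ : Test) {r : ℝ} (hr : 0 < r) :
    r * sphMean (cosProp t φ) r + sphMean (sinProp t φ) r
      + r * sphMean (fun x => fderiv ℝ (sinProp t φ) x (‖x‖⁻¹ • x)) r
      = (r + t) * sphMean φ (r + t) := by
  have hc := φ.continuous
  have h1 := (hasDerivAt_id r).mul (hasDerivAt_sphMean (ψ := sinProp t φ)
    ((sinProp t φ).contDiff.of_le (by simp)) hr)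
  have h2 : HasDerivAt (fun r => r * sphMean (sinProp t φ) r)
      (1 / 2 * ((r + t) * sphMean φ (r + t) * 1 - (r - t) * sphMean φ (r - t) * 1)) r := by
    simp only [mul_sphMean_sinProp]
    exact (hasDerivAt_integral_sub_add (by fun_prop) (fun s => s - t) (fun s => s + t)
      ((hasDerivAt_id r).sub_const t) ((hasDerivAt_id r).add_const t)).const_mul _
  have h3 := h1.unique h2
  simp only [id] at h3
  have h4 := mul_sphMean_cosProp t φ r
  linarith

/-! ### The free flow of outgoing data. -/

theorem integrable_mul_of_bounded_of_isCompact {f h : E3 → ℝ} (hf : LocallyIntegrable f)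
    (hm : AEStronglyMeasurable h) {C : ℝ} (hC : ∀ x, |h x| ≤ C) {K : Set E3} (hK : IsCompact K)
    (hz : ∀ x, x ∉ K → h x = 0) : Integrable fun x => f x * h x := by
  have h1 : Integrable (K.indicator f) :=
    (integrable_indicator_iff hK.measurableSet).2 (hf.integrableOn_isCompact hK)
  have h2 := h1.mul_bdd hm (Eventually.of_forall hC)
  refine h2.congr (Eventually.of_forall fun x => ?_)
  by_cases hx : x ∈ K
  · simp [hx]
  · simp [hx, hz x hx]

theorem Test.exists_bound (φ : Test) : ∃ C, ∀ x, |φ x| ≤ C :=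
  φ.continuous.bounded_above_of_compact_support φ.hasCompactSupport

theorem Test.exists_bound_fderiv (φ : Test) : ∃ C, ∀ x, ‖fderiv ℝ φ x‖ ≤ C :=
  φ.continuous_fderiv.bounded_above_of_compact_support (φ.hasCompactSupport.fderiv (𝕜 := ℝ))

theorem Test.integrable_mul {f : E3 → ℝ} (hf : LocallyIntegrable f) (φ : Test) :
    Integrable fun x => f x * φ x := by
  obtain ⟨C, hC⟩ := φ.exists_bound
  exact integrable_mul_of_bounded_of_isCompact hf φ.continuous.aestronglyMeasurable hC
    φ.hasCompactSupport.isCompact fun x hx => image_eq_zero_of_notMem_tsupport hx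

theorem locallyIntegrable_div_norm {f : E3 → ℝ} (hf : LocallyIntegrable f) {R : ℝ} (hR : 0 < R)
    (hs : ∀ᵐ x : E3, ‖x‖ < R → f x = 0) : LocallyIntegrable fun x => f x / ‖x‖ := by
  -- The weight `1/‖x‖` may be replaced by the continuous weight `1/max(‖x‖, R)`, since `f` vanishes
  -- where they differ.
  have h1 : LocallyIntegrable fun x => f x * (max ‖x‖ R)⁻¹ := by
    have hc : Continuous fun x : E3 => (max ‖x‖ R)⁻¹ :=
      Continuous.inv₀ (by fun_prop) fun x => (lt_of_lt_of_le hR (le_max_right _ _)).ne'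
    exact (hf.locallyIntegrableOn univ).mul_continuousOn hc.continuousOn isOpen_univ.isLocallyClosed
      |> locallyIntegrableOn_univ.1
  refine h1.congr ?_
  filter_upwards [hs] with x hx
  rcases lt_or_ge ‖x‖ R with h | h
  · simp [hx h]
  · rw [max_eq_left h, div_eq_mul_inv]

theorem measurable_norm_inv_smul : Measurable fun x : E3 => ‖x‖⁻¹ • x :=
  (measurable_norm.inv).smul measurable_id

theorem norm_norm_inv_smul_le (x : E3) : ‖‖x‖⁻¹ • x‖ ≤ 1 := by
  rw [norm_smul, norm_inv, norm_norm]; exact inv_mul_le_one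

theorem Test.integrable_mul_radial_fderiv {f : E3 → ℝ} (hf : LocallyIntegrable f) (φ : Test) :
    Integrable fun x => f x * fderiv ℝ φ x (‖x‖⁻¹ • x) := by
  obtain ⟨C, hC⟩ := φ.exists_bound_fderiv
  have hC0 : 0 ≤ C := (norm_nonneg _).trans (hC 0)
  refine integrable_mul_of_bounded_of_isCompact hf ?_ (C := C) (fun x => ?_)
    (φ.hasCompactSupport.fderiv (𝕜 := ℝ)).isCompact fun x hx => ?_
  · have h1 : Measurable fun x : E3 => (fderiv ℝ φ x, ‖x‖⁻¹ • x) :=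
      φ.continuous_fderiv.measurable.prodMk measurable_norm_inv_smul
    have h2 : Continuous fun p : (E3 →L[ℝ] ℝ) × E3 => p.1 p.2 := by fun_prop
    exact (h2.measurable.comp h1).aestronglyMeasurable
  · calc |fderiv ℝ φ x (‖x‖⁻¹ • x)| ≤ ‖fderiv ℝ φ x‖ * ‖‖x‖⁻¹ • x‖ :=
          (fderiv ℝ φ x).le_opNorm _
      _ ≤ C * 1 := mul_le_mul (hC x) (norm_norm_inv_smul_le x) (norm_nonneg _) hC0
      _ = C := mul_one C
  · rw [image_eq_zero_of_notMem_tsupport hx]; rfl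

/-- The free flow of outgoing radial data, tested against `φ`: the function `r u` is translated
to the right by `t`. -/
theorem waveFlow_outgoing {u₀ : E3 → ℝ} {u₁ : Distr} (hrad : IsRadial u₀)
    (hout : IsOutgoing u₀ u₁) (hloc : LocallyIntegrable u₀) {R : ℝ} (hR : 0 < R)
    (hs : ∀ᵐ x : E3, ‖x‖ < R → u₀ x = 0) (t : ℝ) (φ : Test) :
    waveFlow t (pairing u₀) u₁ φ
      = 4 * Real.pi * ∫ r in Ioi (0 : ℝ), r * profile u₀ r * ((r + t) * sphMean φ (r + t)) := by
  set ψ := sinProp t φ with hψ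
  have hdiv := locallyIntegrable_div_norm hloc hR hs
  have h1 := hout ψ
  have i1 : Integrable fun x => u₀ x * cosProp t φ x := Test.integrable_mul hloc _
  have i2 : Integrable fun x => u₀ x * fderiv ℝ ψ x (‖x‖⁻¹ • x) :=
    Test.integrable_mul_radial_fderiv hloc ψ
  have i3 : Integrable fun x => u₀ x / ‖x‖ * ψ x := Test.integrable_mul hdiv ψ
  have h2 : weakRadialDeriv u₀ ψ = - (∫ x, u₀ x * fderiv ℝ ψ x (‖x‖⁻¹ • x))
      - 2 * ∫ x, u₀ x / ‖x‖ * ψ x := by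
    unfold weakRadialDeriv
    have : (fun x => u₀ x * (fderiv ℝ ψ x (‖x‖⁻¹ • x) + 2 * ‖x‖⁻¹ * ψ x))
        = fun x => u₀ x * fderiv ℝ ψ x (‖x‖⁻¹ • x) + 2 * (u₀ x / ‖x‖ * ψ x) := by
      funext x; ring
    rw [this, integral_add i2 (i3.const_mul 2), integral_const_mul]
    ring
  -- The distribution `u₁` enters the flow only through its value at the sine propagator `ψ`, and
  -- the outgoing condition tested on `ψ` expresses that value by `u₀`. The term `2/r` from the
  -- transpose of `∂_r` loses one half to `u₀/r`.
  have h3 : u₁ ψ = (∫ x, u₀ x * fderiv ℝ ψ x (‖x‖⁻¹ • x)) + ∫ x, u₀ x / ‖x‖ * ψ x := by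
    unfold projInSnd at h1
    rw [h2] at h1
    unfold pairing at h1
    linarith
  have h4 : waveFlow t (pairing u₀) u₁ φ = ∫ x, u₀ x * (cosProp t φ x +
      fderiv ℝ ψ x (‖x‖⁻¹ • x) + ‖x‖⁻¹ * ψ x) := by
    unfold waveFlow
    rw [← hψ, h3, pairing, ← add_assoc, ← integral_add i1 i2, ← integral_add
      (f := fun x => u₀ x * cosProp t φ x + u₀ x * fderiv ℝ ψ x (‖x‖⁻¹ • x)) (i1.add i2) i3]
    congr 1; funext x; ring
  have i4 : Integrable fun x => u₀ x * (cosProp t φ x +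
      fderiv ℝ ψ x (‖x‖⁻¹ • x) + ‖x‖⁻¹ * ψ x) := by
    refine ((i1.add i2).add i3).congr (Eventually.of_forall fun x => ?_)
    simp only [Pi.add_apply]; ring
  rw [h4, hrad.integral_mul i4]
  congr 1
  refine setIntegral_congr_fun measurableSet_Ioi fun r hr => ?_
  have hr' : 0 < r := hr
  have hψc := ψ.continuous
  have hψd := ψ.continuous_fderiv
  have hcc := (cosProp t φ).continuous
  -- On the sphere of radius `r` the singular weight is the constant `r⁻¹`, so the mean splits.
  have h5 : sphMean (fun x => cosProp t φ x + fderiv ℝ ψ x (‖x‖⁻¹ • x) + ‖x‖⁻¹ * ψ x) r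
      = sphMean (cosProp t φ) r + sphMean (fun x => fderiv ℝ ψ x (‖x‖⁻¹ • x)) r
        + r⁻¹ * sphMean ψ r := by
    rw [sphMean_congr (g := fun x => cosProp t φ x + fderiv ℝ ψ x (r⁻¹ • x) + r⁻¹ * ψ x)
      (fun x hx => by rw [hx, abs_of_pos hr']),
      sphMean_congr (f := fun x => fderiv ℝ ψ x (‖x‖⁻¹ • x))
        (g := fun x => fderiv ℝ ψ x (r⁻¹ • x)) (fun x hx => by rw [hx, abs_of_pos hr']),
      sphMean_add (by fun_prop) (by fun_prop), sphMean_add (by fun_prop) (by fun_prop),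
      sphMean_const_mul]
  rw [h5, ← sphMean_outgoing t φ hr', ← hψ]
  field_simp
  ring

/-! ### The Duhamel term tested against a function. -/

/-- `r` times the spherical mean of `φ`. -/
def radDensity (φ : E3 → ℝ) (r : ℝ) : ℝ := r * sphMean φ r

/-- The tail integral `∫_a^∞ r Φ(r) dr` of the spherical means `Φ` of `φ`. -/
def tailMean (φ : E3 → ℝ) (a : ℝ) : ℝ := ∫ r in Ioi a, radDensity φ r

theorem continuous_radDensity (φ : Test) : Continuous (radDensity φ) := by
  have := φ.continuous
  unfold radDensity; fun_prop

theorem exists_radDensity_eq_zero (φ : Test) :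
    ∃ M : ℝ, 0 < M ∧ (∀ x, M < ‖x‖ → φ x = 0) ∧ ∀ r, M < |r| → radDensity φ r = 0 := by
  obtain ⟨M, hM⟩ := φ.hasCompactSupport.isCompact.isBounded.subset_closedBall (0 : E3)
  have h0 : ∀ x : E3, max M 1 < ‖x‖ → φ x = 0 := fun x hx => by
    refine image_eq_zero_of_notMem_tsupport fun h => ?_
    have := hM h
    rw [mem_closedBall_zero_iff] at this
    exact absurd (this.trans (le_max_left M 1)) (not_le.2 hx)
  refine ⟨max M 1, by positivity, h0, fun r hr => ?_⟩
  unfold radDensity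
  rw [sphMean_congr (g := fun _ => 0) (fun x hx => h0 x (hx ▸ hr)), sphMean_const, mul_zero]

theorem hasCompactSupport_radDensity (φ : Test) : HasCompactSupport (radDensity φ) := by
  obtain ⟨M, -, -, hM⟩ := exists_radDensity_eq_zero φ
  refine HasCompactSupport.intro (isCompact_Icc (a := -M) (b := M)) fun r hr => hM r ?_
  by_contra h
  exact hr (abs_le.1 (not_lt.1 h))

theorem integrable_radDensity (φ : Test) : Integrable (radDensity φ) :=
  (continuous_radDensity φ).integrable_of_hasCompactSupport (hasCompactSupport_radDensity φ)

theorem tailMean_sub (φ : Test) (a b : ℝ) :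
    tailMean φ a - tailMean φ b = ∫ r in a..b, radDensity φ r := by
  have hi := integrable_radDensity φ
  unfold tailMean
  rw [intervalIntegral.integral_Ioi_sub_Ioi' hi.integrableOn hi.integrableOn]

theorem continuous_tailMean (φ : Test) : Continuous (tailMean φ) := by
  have h : tailMean φ = fun a => tailMean φ 0 - ∫ r in (0 : ℝ)..a, radDensity φ r := by
    funext a; rw [← tailMean_sub]; ring
  rw [h]
  exact continuous_const.sub (intervalIntegral.continuous_primitive
    (fun a b => (continuous_radDensity φ).intervalIntegrable a b) 0)

theorem abs_tailMean_le (φ : Test) (a : ℝ) : |tailMean φ a| ≤ ∫ r, |radDensity φ r| := by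
  have hi := integrable_radDensity φ
  exact (norm_integral_le_integral_norm _).trans
    (setIntegral_le_integral hi.norm (Eventually.of_forall fun _ => norm_nonneg _))

theorem integral_radDensity_shift (φ : E3 → ℝ) (a τ : ℝ) :
    ∫ r in Ioi a, radDensity φ (r + τ) = tailMean φ (a + τ) := by
  unfold tailMean
  have h := (measurePreserving_add_right (volume : Measure ℝ) τ).setIntegral_preimage_emb
    (measurableEmbedding_addRight τ) (radDensity φ) (Ioi (a + τ))
  rw [← h, preimage_add_const_Ioi, add_sub_cancel_right]

/-- Fubini on the triangle `a < z < y`. -/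
theorem integral_primitive_mul {h c : ℝ → ℝ} {a : ℝ} (hh : IntegrableOn h (Ioi a))
    (hc : IntegrableOn c (Ioi a)) :
    ∫ y in Ioi a, (∫ z in a..y, h z) * c y = ∫ z in Ioi a, h z * ∫ y in Ioi z, c y := by
  have hS : MeasurableSet {p : ℝ × ℝ | p.2 < p.1} := measurableSet_lt measurable_snd measurable_fst
  have hI : Integrable ({p : ℝ × ℝ | p.2 < p.1}.indicator fun p => c p.1 * h p.2)
      ((volume.restrict (Ioi a)).prod (volume.restrict (Ioi a))) :=
    (Integrable.mul_prod hc hh).indicator hS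
  have h1 := integral_integral_swap (f := fun y z =>
    ({p : ℝ × ℝ | p.2 < p.1}.indicator fun p => c p.1 * h p.2) (y, z)) hI
  have e1 : ∀ y ∈ Ioi a, (∫ z in a..y, h z) * c y = ∫ z in Ioi a,
      ({p : ℝ × ℝ | p.2 < p.1}.indicator fun p => c p.1 * h p.2) (y, z) := by
    intro y hy
    have : (fun z => ({p : ℝ × ℝ | p.2 < p.1}.indicator fun p => c p.1 * h p.2) (y, z))
        = (Iio y).indicator fun z => c y * h z := by
      funext z; simp [indicator]
    rw [this, setIntegral_indicator measurableSet_Iio, Ioi_inter_Iio, integral_const_mul,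
      ← integral_Ioc_eq_integral_Ioo, ← intervalIntegral.integral_of_le (le_of_lt hy), mul_comm]
  have e2 : ∀ z ∈ Ioi a, h z * ∫ y in Ioi z, c y = ∫ y in Ioi a,
      ({p : ℝ × ℝ | p.2 < p.1}.indicator fun p => c p.1 * h p.2) (y, z) := by
    intro z hz
    have : (fun y => ({p : ℝ × ℝ | p.2 < p.1}.indicator fun p => c p.1 * h p.2) (y, z))
        = (Ioi z).indicator fun y => c y * h z := by
      funext y; simp [indicator]
    rw [this, setIntegral_indicator measurableSet_Ioi,
      inter_eq_self_of_subset_right (Ioi_subset_Ioi (le_of_lt hz)), integral_mul_const, mul_comm]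
  rw [setIntegral_congr_fun measurableSet_Ioi e1, setIntegral_congr_fun measurableSet_Ioi e2, h1]

theorem integral_primitive_mul_radDensity {h : ℝ → ℝ} {a : ℝ} (hh : IntegrableOn h (Ioi a))
    (φ : Test) (τ : ℝ) :
    ∫ y in Ioi a, (∫ z in a..y, h z) * radDensity φ (y + τ)
      = ∫ z in Ioi a, h z * tailMean φ (z + τ) := by
  rw [integral_primitive_mul hh ((integrable_radDensity φ).comp_add_right τ).integrableOn]
  simp only [integral_radDensity_shift]

theorem IsRadial.integrableOn_mul_profile {f : E3 → ℝ} (hf : IsRadial f)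
    (hI : Integrable fun x => f x / ‖x‖) :
    IntegrableOn (fun r => r * profile f r) (Ioi 0) := by
  have h1 : Integrable fun x : E3 => (fun r => profile f r / r) ‖x‖ := by
    simpa only [← hf.eq_profile] using hI
  replace h1 := (integrable_norm_iff (h := fun r => profile f r / r)).1 h1
  refine h1.congr_fun (fun r hr => ?_) measurableSet_Ioi
  have : r ≠ 0 := ne_of_gt hr
  simp only
  field_simp

/-- With `h = r f` and `G` its primitive from `0`, the projected state is `P₊(0, f) = (1/2)(-G/r,
f)`. After Fubini the cosine part gives `-π` times the sum of the tail integrals shifted by `τ` and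
by `-τ`, and the sine part gives `π` times the shift by `-τ` minus the shift by `τ`. The terms in
`-τ` cancel. -/
theorem waveFlowProjOut_eq_profile {f : E3 → ℝ} (hf : IsRadial f) {r₀ : ℝ} (hr₀ : 0 < r₀)
    (hz : ∀ᵐ x : E3, ‖x‖ < r₀ → f x = 0) (hI : Integrable fun x => f x / ‖x‖) (τ : ℝ) (φ : Test) :
    waveFlowProjOut τ f φ
      = -(2 * Real.pi) * ∫ r in Ioi (0 : ℝ), r * profile f r * tailMean φ (r + τ) := by
  set h : ℝ → ℝ := fun r => r * profile f r with hh
  have hint : IntegrableOn h (Ioi 0) := hf.integrableOn_mul_profile hI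
  have hzr : ∀ᵐ r : ℝ, 0 < r → r < r₀ → h r = 0 := by
    have : ∀ᵐ x : E3, ‖x‖ < r₀ → profile f ‖x‖ = 0 := by
      simpa only [← hf.eq_profile] using hz
    rw [ae_norm_iff (p := fun r => r < r₀ → profile f r = 0)] at this
    filter_upwards [this] with r hr h0 h1
    simp [hh, hr h0 h1]
  set G : ℝ → ℝ := fun r => ∫ ρ in (0 : ℝ)..r, h ρ with hG
  have hGb : ∀ r, 0 ≤ r → |G r| ≤ ∫ ρ in Ioi (0 : ℝ), |h ρ| := by
    intro r hr
    rw [hG]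
    simp only
    rw [intervalIntegral.integral_of_le hr]
    exact (norm_integral_le_integral_norm _).trans (setIntegral_mono_set hint.norm
      (Eventually.of_forall fun _ => norm_nonneg _) Ioc_subset_Ioi_self.eventuallyLE)
  -- Since `G` vanishes below `r₀`, the factor `1/r` in the first component is harmless: that
  -- component is bounded by a multiple of `1/r₀`.
  have hGz : ∀ r, 0 ≤ r → r < r₀ → G r = 0 := by
    intro r hr hr'
    rw [hG]; simp only
    rw [intervalIntegral.integral_zero_ae]
    filter_upwards [hzr] with ρ hρ hm
    rw [uIoc_of_le hr] at hm
    exact hρ hm.1 (hm.2.trans_lt hr')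
  have hGc : ContinuousOn G (Ici 0) := by
    have h1 : IntegrableOn h (Ici 0) := (integrableOn_Ici_iff_integrableOn_Ioi).2 hint
    intro x hx
    have h2 : ContinuousOn G (Icc 0 (x + 1)) := by
      have := intervalIntegral.continuousOn_primitive_interval (μ := volume) (f := h) (a := 0)
        (b := x + 1) (h1.mono_set (by
          rw [uIcc_of_le (by linarith [mem_Ici.1 hx])]; exact Icc_subset_Ici_self))
      rwa [uIcc_of_le (by linarith [mem_Ici.1 hx])] at this
    have h3 := h2 x ⟨hx, by linarith⟩
    refine h3.mono_of_mem_nhdsWithin ?_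
    have : Ici (0 : ℝ) ∩ Iio (x + 1) ⊆ Icc 0 (x + 1) := fun y hy => ⟨hy.1, le_of_lt hy.2⟩
    exact mem_of_superset (inter_mem_nhdsWithin _ (Iio_mem_nhds (by linarith))) this
  set g : E3 → ℝ := projOutFst 0 f with hg
  have hgx : ∀ x, g x = -(1 / 2) * (‖x‖⁻¹ * G ‖x‖) := by
    intro x
    simp only [hg, projOutFst, nonlocalOp, Pi.zero_apply, hG, hh]
    ring
  have hgr : IsRadial g := fun x y hxy => by rw [hgx, hgx, hxy]
  have hgp : ∀ r, 0 < r → profile g r = -(1 / 2) * (r⁻¹ * G r) := by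
    intro r hr
    unfold profile
    rw [hgx]
    simp [norm_smul, abs_of_pos hr]
  set B := ∫ ρ in Ioi (0 : ℝ), |h ρ| with hB
  have hB0 : 0 ≤ B := integral_nonneg fun _ => abs_nonneg _
  have hgl : LocallyIntegrable g := by
    have hgm : AEStronglyMeasurable g := by
      have h1 : Measurable (fun r : ℝ => G (max r 0)) := by
        have : Continuous fun r : ℝ => G (max r 0) :=
          hGc.comp_continuous (by fun_prop) fun r => mem_Ici.2 (le_max_right _ _)
        exact this.measurable
      have h2 : g = fun x => -(1 / 2) * (‖x‖⁻¹ * G (max ‖x‖ 0)) := by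
        funext x; rw [hgx, max_eq_left (norm_nonneg x)]
      rw [h2]
      have h3 : Measurable fun x : E3 => G (max ‖x‖ 0) := h1.comp measurable_norm
      exact (measurable_const.mul (measurable_norm.inv.mul h3)).aestronglyMeasurable
    refine LocallyIntegrable.mono (locallyIntegrable_const (r₀⁻¹ * B)) hgm
      (Eventually.of_forall fun x => ?_)
    rw [hgx, norm_mul, norm_mul, norm_neg, norm_inv, norm_norm,
      Real.norm_of_nonneg (by positivity : (0 : ℝ) ≤ 1 / 2),
      Real.norm_of_nonneg (by positivity : 0 ≤ r₀⁻¹ * B)]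
    rcases lt_or_ge ‖x‖ r₀ with hx | hx
    · rw [hGz _ (norm_nonneg x) hx]; simp; positivity
    · have h1 : ‖x‖⁻¹ * ‖G ‖x‖‖ ≤ r₀⁻¹ * B := by
        gcongr
        exact hGb _ (norm_nonneg x)
      have h2 : (0 : ℝ) ≤ ‖x‖⁻¹ * ‖G ‖x‖‖ := by positivity
      linarith
  have hfl : LocallyIntegrable f := by
    have h1 : LocallyIntegrable fun x => f x / ‖x‖ * ‖x‖ :=
      (hI.locallyIntegrable.locallyIntegrableOn univ).mul_continuousOn
        continuous_norm.continuousOn isOpen_univ.isLocallyClosed |> locallyIntegrableOn_univ.1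
    refine h1.congr ?_
    filter_upwards [hz] with x hx
    rcases lt_or_ge ‖x‖ r₀ with h | h
    · simp [hx h]
    · have : ‖x‖ ≠ 0 := (hr₀.trans_le h).ne'
      field_simp
  have e0 : waveFlowProjOut τ f φ = (∫ x, g x * cosProp τ φ x)
      + 1 / 2 * ∫ x, f x * sinProp τ φ x := by
    simp [waveFlowProjOut, waveFlow, projOutSnd, pairing, weakRadialDeriv, hg]
  have e1 : ∫ x, g x * cosProp τ φ x = -Real.pi *
      ((∫ z in Ioi (0 : ℝ), h z * tailMean φ (z + τ))
        + ∫ z in Ioi (0 : ℝ), h z * tailMean φ (z + -τ)) := by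
    rw [hgr.integral_mul (Test.integrable_mul hgl _), ← integral_primitive_mul_radDensity hint,
      ← integral_primitive_mul_radDensity hint]
    have hGi : ∀ τ', IntegrableOn (fun y => G y * radDensity φ (y + τ')) (Ioi 0) := by
      intro τ'
      refine Integrable.bdd_mul (c := B)
        ((integrable_radDensity φ).comp_add_right τ').integrableOn
        ((hGc.mono Ioi_subset_Ici_self).aestronglyMeasurable measurableSet_Ioi) ?_
      filter_upwards [ae_restrict_mem measurableSet_Ioi] with y hy
      exact hGb y (le_of_lt hy)
    rw [← integral_add (hGi τ) (hGi (-τ)), ← integral_const_mul, ← integral_const_mul]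
    refine setIntegral_congr_fun measurableSet_Ioi fun r hr => ?_
    have hr' : 0 < r := hr
    have h1 := mul_sphMean_cosProp τ φ r
    simp only [hgp r hr', radDensity, ← sub_eq_add_neg]
    have h2 : 4 * Real.pi * (r ^ 2 * (-(1 / 2) * (r⁻¹ * G r)) * sphMean (cosProp τ φ) r)
        = -(2 * Real.pi) * G r * (r * sphMean (cosProp τ φ) r) := by
      field_simp; ring
    rw [h2, h1]
    ring
  have htI : ∀ τ', IntegrableOn (fun z => h z * tailMean φ (z + τ')) (Ioi 0) := by
    intro τ'
    have hc := continuous_tailMean φ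
    refine Integrable.mul_bdd hint (c := ∫ r, |radDensity φ r|)
      (Continuous.aestronglyMeasurable (by fun_prop))
      (Eventually.of_forall fun z => abs_tailMean_le φ _)
  have e2 : ∫ x, f x * sinProp τ φ x = 2 * Real.pi *
      ((∫ z in Ioi (0 : ℝ), h z * tailMean φ (z + -τ))
        - ∫ z in Ioi (0 : ℝ), h z * tailMean φ (z + τ)) := by
    rw [hf.integral_mul (Test.integrable_mul hfl _), ← integral_sub (htI (-τ)) (htI τ),
      ← integral_const_mul, ← integral_const_mul]
    refine setIntegral_congr_fun measurableSet_Ioi fun r hr => ?_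
    have h1 := mul_sphMean_sinProp τ φ r
    have h2 := tailMean_sub φ (r - τ) (r + τ)
    unfold radDensity at h2
    rw [← h2] at h1
    simp only [hh, ← sub_eq_add_neg]
    have h3 : 4 * Real.pi * (r ^ 2 * profile f r * sphMean (sinProp τ φ) r)
      = 4 * Real.pi * (r * profile f r) * (r * sphMean (sinProp τ φ) r) := by ring
    rw [h3, h1]; ring
  rw [e0, e1, e2]
  ring

/-- The form on ℝ³, suited to solutions known only through `L^{N+2}` bounds; it serves the
uniqueness proof. -/
theorem waveFlowProjOut_eq {f : E3 → ℝ} (hf : IsRadial f) {r₀ : ℝ} (hr₀ : 0 < r₀)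
    (hz : ∀ᵐ x : E3, ‖x‖ < r₀ → f x = 0) (hI : Integrable fun x => f x / ‖x‖) (τ : ℝ) (φ : Test) :
    waveFlowProjOut τ f φ = -(1 / 2) * ∫ x, f x / ‖x‖ * tailMean φ (‖x‖ + τ) := by
  rw [waveFlowProjOut_eq_profile hf hr₀ hz hI]
  have h1 : ∀ x : E3, f x / ‖x‖ * tailMean φ (‖x‖ + τ)
      = (fun r => profile f r / r * tailMean φ (r + τ)) ‖x‖ := fun x => by
    simp only [← hf.eq_profile]
  simp only [h1]
  rw [integral_norm_polar (fun r => profile f r / r * tailMean φ (r + τ))]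
  have h2 : ∀ r ∈ Ioi (0 : ℝ), r ^ 2 * (profile f r / r * tailMean φ (r + τ))
      = r * profile f r * tailMean φ (r + τ) := by
    intro r hr
    have : r ≠ 0 := ne_of_gt hr
    field_simp
  rw [setIntegral_congr_fun measurableSet_Ioi h2]
  ring

/-! ### The power nonlinearity on the line -/

/-- The function `|x|^N x`. -/
def powNl (N x : ℝ) : ℝ := |x| ^ N * x

theorem abs_powNl {N : ℝ} (hN : 1 < N) (x : ℝ) : |powNl N x| = |x| ^ (N + 1) := by
  rw [powNl, abs_mul, abs_of_nonneg (by positivity : 0 ≤ |x| ^ N),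
    Real.rpow_add_one' (abs_nonneg x) (by linarith)]

theorem continuous_powNl {N : ℝ} (hN : 1 < N) : Continuous (powNl N) := by
  unfold powNl
  exact (continuous_abs.rpow_const fun x => Or.inr (by linarith)).mul continuous_id

theorem hasDerivAt_powNl {N : ℝ} (hN : 1 < N) (x : ℝ) :
    HasDerivAt (powNl N) ((N + 1) * |x| ^ N) x := by
  have h := (hasDerivAt_abs_rpow x hN).mul (hasDerivAt_id x)
  convert! h using 1
  simp only [id, mul_one]
  have : |x| ^ (N - 2) * x * x = |x| ^ N := by
    rw [mul_assoc, ← abs_mul_abs_self, ← sq, ← Real.rpow_natCast |x| 2]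
    rw [← Real.rpow_add' (abs_nonneg x) (by push_cast; linarith)]
    congr 1; push_cast; ring
  rw [mul_assoc, mul_assoc, ← mul_assoc (|x| ^ (N - 2)), this]
  ring

theorem abs_powNl_sub_le {N : ℝ} (hN : 1 < N) {x y m : ℝ} (hx : |x| ≤ m) (hy : |y| ≤ m) :
    |powNl N x - powNl N y| ≤ (N + 1) * m ^ N * |x - y| := by
  have h := (convex_Icc (-m) m).norm_image_sub_le_of_norm_hasDerivWithin_le (f := powNl N)
    (f' := fun x => (N + 1) * |x| ^ N) (C := (N + 1) * m ^ N)
    (fun z _ => (hasDerivAt_powNl hN z).hasDerivWithinAt) (fun z hz => ?_)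
    (abs_le.1 hy) (abs_le.1 hx)
  · simpa using h
  · have hz' : |z| ≤ m := abs_le.2 hz
    rw [Real.norm_of_nonneg (by positivity)]
    gcongr

theorem rpow_le_one_add_rpow {x p q : ℝ} (hx : 0 ≤ x) (hp : 0 ≤ p) (hpq : p ≤ q) :
    x ^ p ≤ 1 + x ^ q := by
  rcases le_or_gt x 1 with h | h
  · have := Real.rpow_le_one hx h hp
    have := Real.rpow_nonneg hx q
    linarith
  · have := Real.rpow_le_rpow_of_exponent_le h.le hpq
    linarith

theorem add_rpow_le_two_rpow_mul {x y p : ℝ} (hx : 0 ≤ x) (hy : 0 ≤ y) (hp : 0 ≤ p) :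
    (x + y) ^ p ≤ 2 ^ p * (x ^ p + y ^ p) := by
  have h1 : (x + y) ^ p ≤ (2 * max x y) ^ p := by
    refine Real.rpow_le_rpow (by positivity) ?_ hp
    linarith [le_max_left x y, le_max_right x y]
  rw [Real.mul_rpow (by norm_num) (by positivity)] at h1
  refine h1.trans ?_
  gcongr
  rcases max_cases x y with ⟨h, _⟩ | ⟨h, _⟩ <;> rw [h]
  · have := Real.rpow_nonneg hy p; linarith
  · have := Real.rpow_nonneg hx p; linarith

/-- A scaled form of Young's inequality. -/
theorem rpow_add_one_le {a l N : ℝ} (ha : 0 ≤ a) (hl : 0 < l) (hN : 0 ≤ N) :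
    a ^ (N + 1) ≤ l * a ^ (N + 2) + l ^ (-(N + 1)) := by
  have h0 : 0 ≤ l ^ (-(N + 1)) := by positivity
  have h2 : a ^ (N + 2) = a * a ^ (N + 1) := by
    rw [show N + 2 = (N + 1) + 1 by ring, Real.rpow_add_one' ha (by linarith), mul_comm]
  rcases le_or_gt 1 (l * a) with h | h
  · have : 1 * a ^ (N + 1) ≤ (l * a) * a ^ (N + 1) := by gcongr
    rw [h2]; linarith
  · have h1 : a ≤ l⁻¹ := by
      rw [← one_div, le_div_iff₀ hl]; linarith
    have h3 : a ^ (N + 1) ≤ l ^ (-(N + 1)) := by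
      rw [Real.rpow_neg hl.le, ← Real.inv_rpow hl.le]
      exact Real.rpow_le_rpow ha h1 (by linarith)
    have : 0 ≤ l * a ^ (N + 2) := by positivity
    linarith

/-! ### Radial retraction onto a ball -/

section Retraction

variable {E : Type*} [NormedAddCommGroup E] [NormedSpace ℝ E]

/-- The radial retraction onto the ball of radius `C`. -/
def radialRetract (C : ℝ) (x : E) : E := (C / max C ‖x‖) • x

theorem norm_radialRetract_le {C : ℝ} (hC : 0 < C) (x : E) : ‖radialRetract C x‖ ≤ C := by
  have hm : 0 < max C ‖x‖ := lt_max_of_lt_left hC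
  rw [radialRetract, norm_smul, Real.norm_of_nonneg (by positivity), div_mul_eq_mul_div,
    div_le_iff₀ hm]
  gcongr
  exact le_max_right _ _

theorem radialRetract_of_le {C : ℝ} (hC : 0 < C) {x : E} (hx : ‖x‖ ≤ C) :
    radialRetract C x = x := by
  rw [radialRetract, max_eq_left hx, div_self hC.ne', one_smul]

/-- Changing the point and changing the scaling factor each cost at most `‖x - y‖`. The constant 2
is valid in every normed space, in particular for the sup norm. -/
theorem norm_radialRetract_sub_le {C : ℝ} (hC : 0 < C) (x y : E) :
    ‖radialRetract C x - radialRetract C y‖ ≤ 2 * ‖x - y‖ := by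
  have hx : 0 < max C ‖x‖ := lt_max_of_lt_left hC
  have hy : 0 < max C ‖y‖ := lt_max_of_lt_left hC
  have h1 : radialRetract C x - radialRetract C y
      = (C / max C ‖x‖) • (x - y) + (C / max C ‖x‖ - C / max C ‖y‖) • y := by
    unfold radialRetract; module
  have hCx : C / max C ‖x‖ ≤ 1 := by rw [div_le_one hx]; exact le_max_left _ _
  have h2 : ‖(C / max C ‖x‖) • (x - y)‖ ≤ ‖x - y‖ := by
    rw [norm_smul, Real.norm_of_nonneg (by positivity)]
    exact mul_le_of_le_one_left (norm_nonneg _) hCx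
  have h3 : ‖(C / max C ‖x‖ - C / max C ‖y‖) • y‖ ≤ ‖x - y‖ := by
    have e : C / max C ‖x‖ - C / max C ‖y‖
        = (C / max C ‖x‖) * ((max C ‖y‖ - max C ‖x‖) / max C ‖y‖) := by
      field_simp
    rw [norm_smul, e, norm_mul, Real.norm_of_nonneg (by positivity : 0 ≤ C / max C ‖x‖),
      norm_div _ (max C ‖y‖), Real.norm_of_nonneg hy.le]
    have h4 : ‖max C ‖y‖ - max C ‖x‖‖ ≤ ‖x - y‖ := by
      rw [Real.norm_eq_abs]
      refine (abs_max_sub_max_le_max _ _ _ _).trans ?_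
      rw [sub_self, abs_zero, max_eq_right (abs_nonneg _), abs_sub_comm]
      exact abs_norm_sub_norm_le x y
    have h5 : ‖y‖ / max C ‖y‖ ≤ 1 := by rw [div_le_one hy]; exact le_max_right _ _
    calc C / max C ‖x‖ * (‖max C ‖y‖ - max C ‖x‖‖ / max C ‖y‖) * ‖y‖
        = C / max C ‖x‖ * ‖max C ‖y‖ - max C ‖x‖‖ * (‖y‖ / max C ‖y‖) := by ring
      _ ≤ 1 * ‖x - y‖ * 1 := by gcongr
      _ = ‖x - y‖ := by ring
  rw [h1]
  linarith [norm_add_le ((C / max C ‖x‖) • (x - y)) ((C / max C ‖x‖ - C / max C ‖y‖) • y)]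

end Retraction

/-! ### The equation along characteristics -/

/-- Initial data for the equation along characteristics: `w₀ = r u₀` on `r > R`. -/
structure CharData (N R : ℝ) (w₀ : ℝ → ℝ) : Prop where
  one_lt : 1 < N
  pos : 0 < R
  meas : Measurable w₀
  integrable : IntegrableOn (fun z => |w₀ z| ^ (N + 2) * z ^ (-N)) (Ioi R)

open scoped BoundedContinuousFunction

/-- The source `|W|^N W (z + t)^{-N}` on `z > R`, where `W = w₀ + V`. -/
def charSource (N R : ℝ) (w₀ : ℝ → ℝ) (t : ℝ) (V : ℝ →ᵇ ℝ) : ℝ → ℝ :=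
  (Ioi R).indicator fun z => powNl N (w₀ z + V z) * (z + t) ^ (-N)

/-- A function dominating the powers of `w₀ + V` for `|V| ≤ a`. -/
def charDom (N : ℝ) (w₀ : ℝ → ℝ) (a z : ℝ) : ℝ :=
  (1 + 2 ^ (N + 2) * (|w₀ z| ^ (N + 2) + a ^ (N + 2))) * z ^ (-N)

namespace CharData

variable {N R : ℝ} {w₀ : ℝ → ℝ} (D : CharData N R w₀)

include D

theorem integrableOn_rpow : IntegrableOn (fun z : ℝ => z ^ (-N)) (Ioi R) :=
  integrableOn_Ioi_rpow_of_lt (by linarith [D.one_lt]) D.pos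

theorem integrableOn_charDom (a : ℝ) : IntegrableOn (charDom N w₀ a) (Ioi R) := by
  have h := (D.integrableOn_rpow.const_mul (1 + 2 ^ (N + 2) * a ^ (N + 2))).add
    (D.integrable.const_mul (2 ^ (N + 2)))
  refine IntegrableOn.congr_fun h (fun z _ => ?_) measurableSet_Ioi
  simp only [Pi.add_apply, charDom]; ring

omit D in
theorem shift_rpow_le {N R : ℝ} (hN : 1 < N) (hR : 0 < R) {t z : ℝ} (ht : 0 ≤ t) (hz : z ∈ Ioi R) :
    (z + t) ^ (-N) ≤ z ^ (-N) :=
  Real.rpow_le_rpow_of_nonpos (hR.trans hz) (by linarith) (by linarith)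

/-- One integrable majorant serves the exponents `N` (Lipschitz bound), `N + 1` (source) and `N + 2`
(energy). -/
theorem mul_rpow_le_charDom {a b q z : ℝ} (ha : 0 ≤ a) (hz : z ∈ Ioi R)
    (hb0 : 0 ≤ b) (hb : b ≤ |w₀ z| + a) (hq0 : 0 ≤ q) (hq : q ≤ N + 2) :
    b ^ q * z ^ (-N) ≤ charDom N w₀ a z := by
  have hz0 : 0 < z := D.pos.trans hz
  have hN := D.one_lt
  unfold charDom
  gcongr
  calc b ^ q ≤ 1 + b ^ (N + 2) := rpow_le_one_add_rpow hb0 hq0 hq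
    _ ≤ 1 + (|w₀ z| + a) ^ (N + 2) := by gcongr
    _ ≤ _ := by
      gcongr
      exact add_rpow_le_two_rpow_mul (abs_nonneg _) ha (by linarith)

theorem charDom_nonneg {a z : ℝ} (ha : 0 ≤ a) (hz : z ∈ Ioi R) : 0 ≤ charDom N w₀ a z := by
  have hz0 : 0 < z := D.pos.trans hz
  unfold charDom; positivity

theorem measurable_charSource (t : ℝ) (V : ℝ →ᵇ ℝ) : Measurable (charSource N R w₀ t V) := by
  refine Measurable.indicator ?_ measurableSet_Ioi
  have h1 : Measurable fun z => w₀ z + V z := D.meas.add V.continuous.measurable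
  exact ((continuous_powNl D.one_lt).measurable.comp h1).mul
    ((measurable_id.add_const t).pow_const _)

omit D in
theorem abs_add_le (V : ℝ →ᵇ ℝ) {a : ℝ} (hV : ‖V‖ ≤ a) (z : ℝ) : |w₀ z + V z| ≤ |w₀ z| + a :=
  (_root_.abs_add_le _ _).trans (by gcongr; exact (V.norm_coe_le_norm z).trans hV)

theorem abs_charSource_le {t : ℝ} (ht : 0 ≤ t) {V : ℝ →ᵇ ℝ} {a : ℝ} (hV : ‖V‖ ≤ a) (z : ℝ) :
    |charSource N R w₀ t V z| ≤ (Ioi R).indicator (charDom N w₀ a) z := by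
  by_cases hz : z ∈ Ioi R
  · have hz0 : 0 < z := D.pos.trans hz
    have hN := D.one_lt
    rw [charSource, indicator_of_mem hz, indicator_of_mem hz, abs_mul, abs_powNl D.one_lt,
      abs_of_nonneg (by positivity : 0 ≤ (z + t) ^ (-N))]
    refine le_trans ?_ (D.mul_rpow_le_charDom ((norm_nonneg V).trans hV) hz (abs_nonneg _)
      (abs_add_le V hV z) (by linarith : 0 ≤ N + 1) (by linarith))
    exact mul_le_mul_of_nonneg_left (shift_rpow_le hN D.pos ht hz) (by positivity)
  · simp [charSource, hz]

theorem integrable_indicator_charDom (a : ℝ) : Integrable ((Ioi R).indicator (charDom N w₀ a)) :=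
  (integrable_indicator_iff measurableSet_Ioi).2 (D.integrableOn_charDom a)

theorem integrable_charSource {t : ℝ} (ht : 0 ≤ t) (V : ℝ →ᵇ ℝ) :
    Integrable (charSource N R w₀ t V) :=
  (D.integrable_indicator_charDom ‖V‖).mono' (D.measurable_charSource t V).aestronglyMeasurable
    (Eventually.of_forall fun z => D.abs_charSource_le ht le_rfl z)

end CharData

/-- The bounded continuous primitive from `R` of an integrable function. -/
def primitiveBCF (R : ℝ) (g : ℝ → ℝ) (hg : Integrable g) : ℝ →ᵇ ℝ :=
  BoundedContinuousFunction.ofNormedAddCommGroup (fun y => ∫ z in R..y, g z)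
    (intervalIntegral.continuous_primitive (fun _ _ => hg.intervalIntegrable) R)
    (∫ z, |g z|) fun _ => (intervalIntegral.norm_integral_le_integral_norm_uIoc).trans
      (setIntegral_le_integral hg.norm (Eventually.of_forall fun _ => norm_nonneg _))

theorem norm_primitiveBCF_sub_le {R : ℝ} {g h : ℝ → ℝ} (hg : Integrable g) (hh : Integrable h) :
    ‖primitiveBCF R g hg - primitiveBCF R h hh‖ ≤ ∫ z, |g z - h z| := by
  refine (BoundedContinuousFunction.norm_le (integral_nonneg fun _ => abs_nonneg _)).2 fun y => ?_
  change ‖(∫ z in R..y, g z) - ∫ z in R..y, h z‖ ≤ _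
  rw [← intervalIntegral.integral_sub hg.intervalIntegrable hh.intervalIntegrable]
  exact (intervalIntegral.norm_integral_le_integral_norm_uIoc).trans
      (setIntegral_le_integral (hg.sub hh).norm (Eventually.of_forall fun _ => norm_nonneg _))

theorem norm_primitiveBCF_le {R : ℝ} {g : ℝ → ℝ} (hg : Integrable g) :
    ‖primitiveBCF R g hg‖ ≤ ∫ z, |g z| := by
  refine (BoundedContinuousFunction.norm_le (integral_nonneg fun _ => abs_nonneg _)).2 fun y => ?_
  exact (intervalIntegral.norm_integral_le_integral_norm_uIoc).trans
      (setIntegral_le_integral hg.norm (Eventually.of_forall fun _ => norm_nonneg _))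

open Classical in
/-- The vector field `V ↦ -(1/2) ∫_R^y |W|^N W (z + t)^{-N} dz`, where `W = w₀ + V`. -/
def charField (N R : ℝ) (w₀ : ℝ → ℝ) (t : ℝ) (V : ℝ →ᵇ ℝ) : ℝ →ᵇ ℝ :=
  if h : Integrable (charSource N R w₀ t V) then (-(1 / 2) : ℝ) • primitiveBCF R _ h else 0

/-- The energy `∫_R^∞ |w₀ + V|^{N+2} (z + t)^{-N} dz`. -/
def charEnergy (N R : ℝ) (w₀ : ℝ → ℝ) (t : ℝ) (V : ℝ →ᵇ ℝ) : ℝ :=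
  ∫ z in Ioi R, |w₀ z + V z| ^ (N + 2) * (z + t) ^ (-N)

namespace CharData

variable {N R : ℝ} {w₀ : ℝ → ℝ} (D : CharData N R w₀)

include D

theorem charField_eq {t : ℝ} (ht : 0 ≤ t) (V : ℝ →ᵇ ℝ) : charField N R w₀ t V
    = (-(1 / 2) : ℝ) • primitiveBCF R _ (D.integrable_charSource ht V) := by
  rw [charField, dif_pos]

theorem charField_apply {t : ℝ} (ht : 0 ≤ t) (V : ℝ →ᵇ ℝ) (y : ℝ) : charField N R w₀ t V y
    = -(1 / 2) * ∫ z in R..y, charSource N R w₀ t V z := by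
  rw [D.charField_eq ht]; rfl

theorem norm_charField_sub_le {t s : ℝ} (ht : 0 ≤ t) (hs : 0 ≤ s) (V V' : ℝ →ᵇ ℝ) :
    ‖charField N R w₀ t V - charField N R w₀ s V'‖
      ≤ ∫ z, |charSource N R w₀ t V z - charSource N R w₀ s V' z| := by
  rw [D.charField_eq ht, D.charField_eq hs]
  have e := smul_sub (-(1 / 2) : ℝ) (primitiveBCF R _ (D.integrable_charSource ht V))
    (primitiveBCF R _ (D.integrable_charSource hs V'))
  rw [← e, norm_smul]
  have h := norm_primitiveBCF_sub_le (R := R) (D.integrable_charSource ht V)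
    (D.integrable_charSource hs V')
  have h0 := norm_nonneg (primitiveBCF R _ (D.integrable_charSource ht V) -
    primitiveBCF R _ (D.integrable_charSource hs V'))
  have : ‖(-(1 / 2) : ℝ)‖ = 1 / 2 := by norm_num
  rw [this]
  linarith

/-- The derivative of `|x|^N x` is `(N + 1)|x|^N`. The constant is uniform in `t ≥ 0` because `(z +
t)^{-N} ≤ z^{-N}`. -/
theorem charField_lipschitz {t a : ℝ} (ht : 0 ≤ t) {V V' : ℝ →ᵇ ℝ} (hV : ‖V‖ ≤ a)
    (hV' : ‖V'‖ ≤ a) :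
    ‖charField N R w₀ t V - charField N R w₀ t V'‖
      ≤ ((N + 1) * ∫ z in Ioi R, charDom N w₀ a z) * ‖V - V'‖ := by
  have hN := D.one_lt
  refine (D.norm_charField_sub_le ht ht V V').trans ?_
  rw [← integral_indicator measurableSet_Ioi, ← integral_const_mul, ← integral_mul_const]
  refine integral_mono ((D.integrable_charSource ht V).sub (D.integrable_charSource ht V')).abs
    (((D.integrable_indicator_charDom a).const_mul _).mul_const _) fun z => ?_
  by_cases hz : z ∈ Ioi R
  · have hz0 : 0 < z := D.pos.trans hz
    simp only [charSource, indicator_of_mem hz]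
    rw [← sub_mul, abs_mul, abs_of_nonneg (by positivity : 0 ≤ (z + t) ^ (-N))]
    have h1 := abs_powNl_sub_le hN (abs_add_le (w₀ := w₀) V hV z) (abs_add_le (w₀ := w₀) V' hV' z)
    have h2 := D.mul_rpow_le_charDom ((norm_nonneg V).trans hV) hz
      (by have := (norm_nonneg V).trans hV; positivity : 0 ≤ |w₀ z| + a) le_rfl
      (by linarith : 0 ≤ N) (by linarith)
    have h3 : |w₀ z + V z - (w₀ z + V' z)| ≤ ‖V - V'‖ := by
      rw [add_sub_add_left_eq_sub]
      exact (V - V').norm_coe_le_norm z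
    have ha : 0 ≤ a := (norm_nonneg V).trans hV
    calc |powNl N (w₀ z + V z) - powNl N (w₀ z + V' z)| * (z + t) ^ (-N)
        ≤ ((N + 1) * (|w₀ z| + a) ^ N * ‖V - V'‖) * z ^ (-N) := by
          refine mul_le_mul (h1.trans (by gcongr)) (shift_rpow_le hN D.pos ht hz) (by positivity)
            (by positivity)
      _ = (N + 1) * ((|w₀ z| + a) ^ N * z ^ (-N)) * ‖V - V'‖ := by ring
      _ ≤ _ := by gcongr
  · simp [charSource, hz]

theorem continuousOn_charField (V : ℝ →ᵇ ℝ) :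
    ContinuousOn (fun t => charField N R w₀ t V) (Ici 0) := by
  intro t ht
  have ht' : 0 ≤ t := ht
  rw [ContinuousWithinAt, tendsto_iff_norm_sub_tendsto_zero]
  have hb : ∀ s ∈ Ici (0 : ℝ), ∀ z, ‖|charSource N R w₀ s V z - charSource N R w₀ t V z|‖
      ≤ 2 * (Ioi R).indicator (charDom N w₀ ‖V‖) z := by
    intro s hs z
    rw [Real.norm_eq_abs, abs_abs]
    have h1 := D.abs_charSource_le (mem_Ici.1 hs) (le_refl ‖V‖) z
    have h2 := D.abs_charSource_le ht' (le_refl ‖V‖) z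
    linarith [abs_sub (charSource N R w₀ s V z) (charSource N R w₀ t V z)]
  have h1 : ContinuousWithinAt
      (fun s => ∫ z, |charSource N R w₀ s V z - charSource N R w₀ t V z|) (Ici 0) t := by
    refine continuousWithinAt_of_dominated
      (bound := fun z => 2 * (Ioi R).indicator (charDom N w₀ ‖V‖) z)
      (Eventually.of_forall fun s => ?_) ?_ ((D.integrable_indicator_charDom _).const_mul 2)
      (Eventually.of_forall fun z => ?_)
    · exact (((D.measurable_charSource s V).sub
        (D.measurable_charSource t V)).norm).aestronglyMeasurable
    · exact eventually_mem_nhdsWithin.mono fun s hs => Eventually.of_forall (hb s hs)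
    · by_cases hz : z ∈ Ioi R
      · have hz0 : 0 < z := D.pos.trans hz
        simp only [charSource, indicator_of_mem hz]
        have : ContinuousAt (fun s => |powNl N (w₀ z + V z) * (z + s) ^ (-N)
            - powNl N (w₀ z + V z) * (z + t) ^ (-N)|) t := by
          have : ContinuousAt (fun s : ℝ => (z + s) ^ (-N)) t :=
            ContinuousAt.rpow_const (by fun_prop) (Or.inl (by positivity))
          fun_prop
        exact this.continuousWithinAt
      · simp only [charSource, indicator_of_notMem hz, sub_self, abs_zero]
        exact continuousWithinAt_const
  have h2 : Tendsto (fun s => ∫ z, |charSource N R w₀ s V z - charSource N R w₀ t V z|)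
      (𝓝[Ici 0] t) (𝓝 0) := by
    have := h1.tendsto
    simpa using this
  refine squeeze_zero' (Eventually.of_forall fun s => norm_nonneg _) ?_ h2
  exact eventually_mem_nhdsWithin.mono fun s hs =>
    D.norm_charField_sub_le (mem_Ici.1 hs) ht' V V

theorem integrableOn_energy_pow {t a : ℝ} (ht : 0 ≤ t) {V : ℝ →ᵇ ℝ} (hV : ‖V‖ ≤ a) {q : ℝ}
    (hq0 : 0 ≤ q) (hq : q ≤ N + 2) :
    IntegrableOn (fun z => |w₀ z + V z| ^ q * (z + t) ^ (-N)) (Ioi R) := by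
  have h1 : Measurable fun z => w₀ z + V z := D.meas.add V.continuous.measurable
  refine (D.integrableOn_charDom a).mono' (((h1.norm.pow_const _).mul
    ((measurable_id.add_const t).pow_const _)).aestronglyMeasurable) ?_
  filter_upwards [ae_restrict_mem measurableSet_Ioi] with z hz
  have hz0 : 0 < z := D.pos.trans hz
  rw [Real.norm_of_nonneg (by positivity)]
  refine le_trans ?_ (D.mul_rpow_le_charDom ((norm_nonneg V).trans hV) hz (abs_nonneg _)
      (abs_add_le V hV z) hq0 hq)
  exact mul_le_mul_of_nonneg_left (shift_rpow_le D.one_lt D.pos ht hz) (by positivity)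

theorem charEnergy_nonneg {t : ℝ} (ht : 0 ≤ t) (V : ℝ →ᵇ ℝ) : 0 ≤ charEnergy N R w₀ t V :=
  setIntegral_nonneg measurableSet_Ioi fun z hz => by
    have hz0 : 0 < z := D.pos.trans hz
    positivity

theorem integral_shift_rpow {t : ℝ} (ht : 0 ≤ t) :
    ∫ z in Ioi R, (z + t) ^ (-N) = (R + t) ^ (1 - N) / (N - 1) := by
  have h := (measurePreserving_add_right (volume : Measure ℝ) t).setIntegral_preimage_emb
    (measurableEmbedding_addRight t) (fun z => z ^ (-N)) (Ioi (R + t))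
  rw [preimage_add_const_Ioi, add_sub_cancel_right] at h
  rw [h, integral_Ioi_rpow_of_lt (by linarith [D.one_lt]) (by linarith [D.pos])]
  rw [show -N + 1 = -(N - 1) by ring, neg_div_neg_eq]
  congr 2; ring

theorem integrableOn_shift_rpow {t : ℝ} (ht : 0 ≤ t) :
    IntegrableOn (fun z => (z + t) ^ (-N)) (Ioi R) := by
  refine D.integrableOn_rpow.mono'
    (((measurable_id.add_const t).pow_const _).aestronglyMeasurable) ?_
  filter_upwards [ae_restrict_mem measurableSet_Ioi] with z hz
  have hz0 : 0 < z := D.pos.trans hz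
  rw [Real.norm_of_nonneg (by positivity)]
  exact shift_rpow_le D.one_lt D.pos ht hz

/-- Young's inequality with a free parameter `l` passes from the exponent `N + 1` to the energy.
Global existence uses `l = 1`; decay uses a power of `R + t`. -/
theorem integral_abs_charSource_le {t l : ℝ} (ht : 0 ≤ t) (hl : 0 < l) (V : ℝ →ᵇ ℝ) :
    ∫ z, |charSource N R w₀ t V z|
      ≤ l * charEnergy N R w₀ t V + l ^ (-(N + 1)) * ((R + t) ^ (1 - N) / (N - 1)) := by
  have hN := D.one_lt
  have h1 : ∀ z, |charSource N R w₀ t V z|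
      = (Ioi R).indicator (fun z => |w₀ z + V z| ^ (N + 1) * (z + t) ^ (-N)) z := by
    intro z
    by_cases hz : z ∈ Ioi R
    · have hz0 : 0 < z := D.pos.trans hz
      rw [charSource, indicator_of_mem hz, indicator_of_mem hz, abs_mul, abs_powNl hN,
        abs_of_nonneg (by positivity : 0 ≤ (z + t) ^ (-N))]
    · simp [charSource, hz]
  simp only [h1]
  rw [integral_indicator measurableSet_Ioi, ← D.integral_shift_rpow ht, charEnergy,
    ← integral_const_mul, ← integral_const_mul, ← integral_add
      ((D.integrableOn_energy_pow ht le_rfl (by linarith) le_rfl).const_mul l)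
      ((D.integrableOn_shift_rpow ht).const_mul _)]
  refine setIntegral_mono_on (D.integrableOn_energy_pow ht le_rfl (by linarith) (by linarith))
    (((D.integrableOn_energy_pow ht le_rfl (by linarith) le_rfl).const_mul l).add
      ((D.integrableOn_shift_rpow ht).const_mul _)) measurableSet_Ioi fun z hz => ?_
  have hz0 : 0 < z := D.pos.trans hz
  have h2 := rpow_add_one_le (abs_nonneg (w₀ z + V z)) hl (by linarith : 0 ≤ N)
  calc |w₀ z + V z| ^ (N + 1) * (z + t) ^ (-N)
      ≤ (l * |w₀ z + V z| ^ (N + 2) + l ^ (-(N + 1))) * (z + t) ^ (-N) := by gcongr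
    _ = _ := by ring

theorem norm_charField_le {t l : ℝ} (ht : 0 ≤ t) (hl : 0 < l) (V : ℝ →ᵇ ℝ) :
    ‖charField N R w₀ t V‖
      ≤ l * charEnergy N R w₀ t V + l ^ (-(N + 1)) * ((R + t) ^ (1 - N) / (N - 1)) := by
  refine le_trans ?_ (D.integral_abs_charSource_le ht hl V)
  rw [D.charField_eq ht, norm_smul]
  have h := norm_primitiveBCF_le (R := R) (D.integrable_charSource ht V)
  have h0 := norm_nonneg (primitiveBCF R _ (D.integrable_charSource ht V))
  have : ‖(-(1 / 2) : ℝ)‖ = 1 / 2 := by norm_num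
  rw [this]
  linarith

end CharData

theorem integrableOn_primitive_mul_self {g : ℝ → ℝ} {R : ℝ} (hg : IntegrableOn g (Ioi R)) :
    IntegrableOn (fun y => (∫ z in R..y, g z) * g y) (Ioi R) := by
  have hb : ∀ y ∈ Ioi R, |∫ z in R..y, g z| ≤ ∫ z in Ioi R, |g z| := by
    intro y hy
    rw [intervalIntegral.integral_of_le (le_of_lt hy)]
    exact (norm_integral_le_integral_norm _).trans (setIntegral_mono_set hg.norm
      (Eventually.of_forall fun _ => norm_nonneg _) Ioc_subset_Ioi_self.eventuallyLE)
  have hm : AEStronglyMeasurable (fun y => ∫ z in R..y, g z) (volume.restrict (Ioi R)) := by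
    have hi : Integrable ((Ioi R).indicator g) := (integrable_indicator_iff measurableSet_Ioi).2 hg
    have hc := intervalIntegral.continuous_primitive (fun a b => hi.intervalIntegrable (a := a)
      (b := b)) R
    refine hc.aestronglyMeasurable.congr ?_
    filter_upwards [ae_restrict_mem measurableSet_Ioi] with y hy
    refine intervalIntegral.integral_congr_ae (Eventually.of_forall fun z hz => ?_)
    rw [uIoc_of_le (le_of_lt hy)] at hz
    exact indicator_of_mem (mem_Ioi.2 hz.1) g
  refine Integrable.bdd_mul hg hm (c := ∫ z in Ioi R, |g z|) ?_
  filter_upwards [ae_restrict_mem measurableSet_Ioi] with y hy using hb y hy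

/-- Formally `∫ G G' = (1/2) (∫ g)²` for `G' = g`. With `g` merely integrable this comes from
Fubini, in the form `I = (∫ g)² - I`. -/
theorem integral_primitive_mul_self_nonneg {g : ℝ → ℝ} {R : ℝ} (hg : IntegrableOn g (Ioi R)) :
    0 ≤ ∫ y in Ioi R, (∫ z in R..y, g z) * g y := by
  have h1 := integral_primitive_mul hg hg
  have hGg := integrableOn_primitive_mul_self hg
  have h2 : ∫ z in Ioi R, g z * ∫ y in Ioi z, g y
      = (∫ z in Ioi R, g z) * (∫ z in Ioi R, g z) - ∫ y in Ioi R, (∫ z in R..y, g z) * g y := by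
    rw [← integral_mul_const, ← integral_sub (hg.mul_const _) hGg]
    refine setIntegral_congr_fun measurableSet_Ioi fun z hz => ?_
    have h3 := intervalIntegral.integral_Ioi_sub_Ioi' (a := R) (b := z) hg
      (hg.mono_set (Ioi_subset_Ioi (le_of_lt hz)))
    rw [← h3]; ring
  have := mul_self_nonneg (∫ z in Ioi R, g z)
  linarith

theorem hasDerivAt_shift_rpow {z s N : ℝ} (h : 0 < z + s) :
    HasDerivAt (fun s => (z + s) ^ (-N)) (-N * (z + s) ^ (-N - 1)) s := by
  have := ((hasDerivAt_id s).const_add z).rpow_const (p := -N) (Or.inl h.ne')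
  simpa using this

namespace CharData

variable {N R : ℝ} {w₀ : ℝ → ℝ} (D : CharData N R w₀)

include D

theorem hasDerivAt_charEnergy {T a B : ℝ} {V V' : ℝ → ℝ →ᵇ ℝ}
    (hV : ∀ s ∈ Ioo 0 T, HasDerivAt V (V' s) s) (ha : ∀ s ∈ Ioo 0 T, ‖V s‖ ≤ a)
    (hB : ∀ s ∈ Ioo 0 T, ‖V' s‖ ≤ B) {t : ℝ} (ht : t ∈ Ioo 0 T) :
    IntegrableOn (fun z => (N + 2) * powNl N (w₀ z + V t z) * V' t z * (z + t) ^ (-N)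
        + |w₀ z + V t z| ^ (N + 2) * (-N * (z + t) ^ (-N - 1))) (Ioi R) ∧
    HasDerivAt (fun s => charEnergy N R w₀ s (V s))
      (∫ z in Ioi R, ((N + 2) * powNl N (w₀ z + V t z) * V' t z * (z + t) ^ (-N)
        + |w₀ z + V t z| ^ (N + 2) * (-N * (z + t) ^ (-N - 1)))) t := by
  have hN := D.one_lt
  have hR := D.pos
  have ha0 : 0 ≤ a := (norm_nonneg _).trans (ha t ht)
  have hB0 : 0 ≤ B := (norm_nonneg _).trans (hB t ht)
  have hWm : ∀ s, Measurable fun z => w₀ z + V s z := fun s =>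
    D.meas.add (V s).continuous.measurable
  refine (hasDerivAt_integral_of_dominated_loc_of_deriv_le (μ := volume.restrict (Ioi R))
    (F := fun s z => |w₀ z + V s z| ^ (N + 2) * (z + s) ^ (-N))
    (F' := fun s z => (N + 2) * powNl N (w₀ z + V s z) * V' s z * (z + s) ^ (-N)
        + |w₀ z + V s z| ^ (N + 2) * (-N * (z + s) ^ (-N - 1)))
    -- The first term bounds the contribution of `V'`. The second bounds the derivative of the
    -- weight, through `(z + s)^{-N-1} ≤ z^{-N} R⁻¹`.
    (bound := fun z => ((N + 2) * B + N * R⁻¹) * charDom N w₀ a z)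
    (s := Ioo 0 T) (isOpen_Ioo.mem_nhds ht) ?_ ?_ ?_ ?_ ?_ ?_)
  · exact Eventually.of_forall fun s => (((hWm s).norm.pow_const _).mul
      ((measurable_id.add_const s).pow_const _)).aestronglyMeasurable
  · exact D.integrableOn_energy_pow ht.1.le (ha t ht) (by linarith) le_rfl
  · refine Measurable.aestronglyMeasurable ?_
    refine Measurable.add (Measurable.mul (Measurable.mul (measurable_const.mul
      ((continuous_powNl hN).measurable.comp (hWm t))) (V' t).continuous.measurable)
      ((measurable_id.add_const t).pow_const _)) (Measurable.mul ((hWm t).norm.pow_const _)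
      (measurable_const.mul ((measurable_id.add_const t).pow_const _)))
  · filter_upwards [ae_restrict_mem measurableSet_Ioi] with z hz s hs
    have hz0 : 0 < z := hR.trans hz
    have hzs : 0 < z + s := by linarith [hs.1]
    have hW := abs_add_le (w₀ := w₀) (V s) (ha s hs) z
    have h1 := D.mul_rpow_le_charDom ha0 hz (abs_nonneg _) hW (by linarith : 0 ≤ N + 1)
      (by linarith)
    have h2 := D.mul_rpow_le_charDom ha0 hz (abs_nonneg _) hW (by linarith : 0 ≤ N + 2) le_rfl
    have h3 : |V' s z| ≤ B := ((V' s).norm_coe_le_norm z).trans (hB s hs)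
    have h4 := shift_rpow_le hN hR hs.1.le hz
    have h5 : (z + s) ^ (-N - 1) ≤ z ^ (-N) * R⁻¹ := by
      rw [Real.rpow_sub_one hzs.ne', div_eq_mul_inv]
      refine mul_le_mul h4 ?_ (by positivity) (by positivity)
      exact inv_anti₀ hR (by linarith [mem_Ioi.1 hz, hs.1])
    rw [add_mul ((N + 2) * B)]
    refine (norm_add_le (E := ℝ) _ _).trans ?_
    refine add_le_add ?_ ?_
    · rw [norm_mul, norm_mul, norm_mul, Real.norm_of_nonneg (by linarith : 0 ≤ N + 2),
        Real.norm_eq_abs (powNl _ _), abs_powNl hN,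
        Real.norm_of_nonneg (by positivity : 0 ≤ (z + s) ^ (-N))]
      calc (N + 2) * |w₀ z + V s z| ^ (N + 1) * ‖V' s z‖ * (z + s) ^ (-N)
          ≤ (N + 2) * |w₀ z + V s z| ^ (N + 1) * B * z ^ (-N) := by
            exact mul_le_mul (mul_le_mul_of_nonneg_left h3 (by positivity)) h4 (by positivity)
              (by positivity)
        _ = (N + 2) * B * (|w₀ z + V s z| ^ (N + 1) * z ^ (-N)) := by ring
        _ ≤ _ := by gcongr
    · rw [norm_mul, norm_mul, norm_neg, Real.norm_of_nonneg (by linarith : 0 ≤ N),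
        Real.norm_of_nonneg (by positivity : 0 ≤ (z + s) ^ (-N - 1)),
        Real.norm_of_nonneg (by positivity : 0 ≤ |w₀ z + V s z| ^ (N + 2))]
      calc |w₀ z + V s z| ^ (N + 2) * (N * (z + s) ^ (-N - 1))
          ≤ |w₀ z + V s z| ^ (N + 2) * (N * (z ^ (-N) * R⁻¹)) := by gcongr
        _ = N * R⁻¹ * (|w₀ z + V s z| ^ (N + 2) * z ^ (-N)) := by ring
        _ ≤ _ := by gcongr
  · exact (D.integrableOn_charDom a).const_mul _
  · filter_upwards [ae_restrict_mem measurableSet_Ioi] with z hz s hs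
    have hz0 : 0 < z := hR.trans hz
    have hzs : 0 < z + s := by linarith [hs.1]
    have h1 : HasDerivAt (fun s => w₀ z + V s z) (V' s z) s :=
      ((BoundedContinuousFunction.evalCLM (β := ℝ) ℝ z).hasFDerivAt.comp_hasDerivAt s
        (hV s hs)).const_add (w₀ z)
    have h2 := ((hasDerivAt_abs_rpow (w₀ z + V s z) (by linarith : 1 < N + 2)).comp s h1).mul
      (hasDerivAt_shift_rpow (N := N) hzs)
    convert! h2 using 1
    rw [show N + 2 - 2 = N by ring, powNl]
    simp only [Function.comp_apply]
    ring

theorem continuousOn_charEnergy {T a : ℝ} {V : ℝ → ℝ →ᵇ ℝ} (hV : ContinuousOn V (Icc 0 T))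
    (ha : ∀ s ∈ Icc 0 T, ‖V s‖ ≤ a) :
    ContinuousOn (fun s => charEnergy N R w₀ s (V s)) (Icc 0 T) := by
  have hN := D.one_lt
  have hR := D.pos
  refine continuousOn_of_dominated (bound := charDom N w₀ a) (fun s hs => ?_) (fun s hs => ?_)
    (D.integrableOn_charDom a) ?_
  · exact (D.integrableOn_energy_pow hs.1 (ha s hs) (by linarith) le_rfl).aestronglyMeasurable
  · filter_upwards [ae_restrict_mem measurableSet_Ioi] with z hz
    have hz0 : 0 < z := hR.trans hz
    have hs0 := hs.1
    rw [Real.norm_of_nonneg (by positivity)]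
    refine le_trans ?_ (D.mul_rpow_le_charDom ((norm_nonneg _).trans (ha s hs)) hz (abs_nonneg _)
      (abs_add_le (V s) (ha s hs) z) (by linarith) le_rfl)
    exact mul_le_mul_of_nonneg_left (shift_rpow_le hN hR hs.1 hz) (by positivity)
  · filter_upwards [ae_restrict_mem measurableSet_Ioi] with z hz
    have hz0 : 0 < z := hR.trans hz
    have h1 : ContinuousOn (fun s => V s z) (Icc 0 T) :=
      (BoundedContinuousFunction.evalCLM (β := ℝ) ℝ z).continuous.comp_continuousOn hV
    refine ContinuousOn.mul (ContinuousOn.rpow_const (by fun_prop) fun s _ => Or.inr (by linarith))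
      (ContinuousOn.rpow_const (by fun_prop) fun s hs => Or.inl (by linarith [hs.1]))

/-- The nonnegative factor `χ` leaves the sign of the energy derivative unchanged, so monotonicity
also holds for the vector field retracted to a ball. That is the field for which a solution is first
obtained. -/
theorem charEnergy_antitoneOn {T a B : ℝ} {V : ℝ → ℝ →ᵇ ℝ} {χ : ℝ → ℝ}
    (hχ : ∀ s, 0 ≤ χ s)
    (hV : ∀ s ∈ Icc 0 T, HasDerivWithinAt V (χ s • charField N R w₀ s (V s)) (Icc 0 T) s)
    (ha : ∀ s ∈ Icc 0 T, ‖V s‖ ≤ a)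
    (hB : ∀ s ∈ Icc 0 T, ‖χ s • charField N R w₀ s (V s)‖ ≤ B) :
    AntitoneOn (fun s => charEnergy N R w₀ s (V s)) (Icc 0 T) := by
  have hN := D.one_lt
  have hR := D.pos
  have hVo : ∀ s ∈ Ioo 0 T, HasDerivAt V (χ s • charField N R w₀ s (V s)) s := fun s hs =>
    (hV s (Ioo_subset_Icc_self hs)).hasDerivAt (Icc_mem_nhds hs.1 hs.2)
  have hd := fun t (ht : t ∈ Ioo 0 T) => D.hasDerivAt_charEnergy hVo
    (fun s hs => ha s (Ioo_subset_Icc_self hs)) (fun s hs => hB s (Ioo_subset_Icc_self hs)) ht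
  refine antitoneOn_of_deriv_nonpos (convex_Icc 0 T)
    (D.continuousOn_charEnergy (fun s hs => (hV s hs).continuousWithinAt) ha) ?_ ?_
  · rw [interior_Icc]
    exact fun s hs => (hd s hs).2.differentiableAt.differentiableWithinAt
  · rw [interior_Icc]
    intro t ht
    rw [(hd t ht).2.deriv]
    have hg := D.integrable_charSource ht.1.le (V t)
    have key := integral_primitive_mul_self_nonneg (hg.integrableOn (s := Ioi R))
    -- The contribution of the decreasing weight is nonpositive and is dropped. What remains is
    -- `-((N+2) χ / 2) G g`, with `g` the source and `G` its primitive.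
    have hle : ∫ z in Ioi R, ((N + 2) * powNl N (w₀ z + V t z) *
          (χ t • charField N R w₀ t (V t)) z * (z + t) ^ (-N)
        + |w₀ z + V t z| ^ (N + 2) * (-N * (z + t) ^ (-N - 1)))
        ≤ ∫ z in Ioi R, (-((N + 2) * χ t / 2)) *
          ((∫ x in R..z, charSource N R w₀ t (V t) x) * charSource N R w₀ t (V t) z) := by
      refine setIntegral_mono_on (hd t ht).1
        ((integrableOn_primitive_mul_self hg.integrableOn).const_mul _) measurableSet_Ioi
        fun z hz => ?_
      have hz0 : 0 < z := hR.trans hz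
      have ht0 := ht.1
      have h1 : (χ t • charField N R w₀ t (V t)) z
          = χ t * (-(1 / 2) * ∫ x in R..z, charSource N R w₀ t (V t) x) := by
        rw [← D.charField_apply ht.1.le]; rfl
      have h2 : charSource N R w₀ t (V t) z = powNl N (w₀ z + V t z) * (z + t) ^ (-N) := by
        rw [charSource, indicator_of_mem hz]
      have h3 : 0 ≤ |w₀ z + V t z| ^ (N + 2) * (N * (z + t) ^ (-N - 1)) := by positivity
      rw [h1, h2]
      rw [neg_mul N, mul_neg]
      linarith
    refine hle.trans ?_
    rw [integral_const_mul]
    have := hχ t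
    have h0 : 0 ≤ (N + 2) * χ t / 2 := by positivity
    have := mul_nonneg h0 key
    linarith

end CharData

/-- `V` solves the equation along characteristics on `[0, T]`. -/
def IsCharSol (N R : ℝ) (w₀ : ℝ → ℝ) (T : ℝ) (V : ℝ → ℝ →ᵇ ℝ) : Prop :=
  V 0 = 0 ∧ ∀ t ∈ Icc 0 T, HasDerivWithinAt V (charField N R w₀ t (V t)) (Icc 0 T) t

theorem IsCharSol.continuousOn {N R : ℝ} {w₀ : ℝ → ℝ} {T : ℝ} {V : ℝ → ℝ →ᵇ ℝ}
    (h : IsCharSol N R w₀ T V) : ContinuousOn V (Icc 0 T) :=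
  fun t ht => (h.2 t ht).continuousWithinAt

theorem IsCharSol.mono {N R : ℝ} {w₀ : ℝ → ℝ} {T T' : ℝ} {V : ℝ → ℝ →ᵇ ℝ}
    (h : IsCharSol N R w₀ T V) (hT : T' ≤ T) : IsCharSol N R w₀ T' V :=
  ⟨h.1, fun t ht => (h.2 t ⟨ht.1, ht.2.trans hT⟩).mono (Icc_subset_Icc_right hT)⟩

theorem exists_norm_bound_of_continuousOn {E : Type*} [NormedAddCommGroup E] {V : ℝ → E} {T : ℝ}
    (h : ContinuousOn V (Icc 0 T)) : ∃ a, 0 ≤ a ∧ ∀ t ∈ Icc 0 T, ‖V t‖ ≤ a := by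
  obtain ⟨a, ha⟩ := isCompact_Icc.exists_bound_of_continuousOn h
  exact ⟨max a 0, le_max_right _ _, fun t ht => (ha t ht).trans (le_max_left _ _)⟩

namespace CharData

variable {N R : ℝ} {w₀ : ℝ → ℝ} (D : CharData N R w₀)

include D

theorem lipschitzOnWith_charField {t a : ℝ} (ht : 0 ≤ t) :
    LipschitzOnWith (((N + 1) * ∫ z in Ioi R, charDom N w₀ a z).toNNReal)
      (charField N R w₀ t) (Metric.closedBall 0 a) := by
  refine LipschitzOnWith.of_dist_le_mul fun V hV V' hV' => ?_
  rw [dist_eq_norm, dist_eq_norm]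
  rw [mem_closedBall_zero_iff] at hV hV'
  have ha : 0 ≤ a := (norm_nonneg V).trans hV
  have hN := D.one_lt
  rw [Real.coe_toNNReal _ (mul_nonneg (by linarith)
    (setIntegral_nonneg measurableSet_Ioi fun z hz => D.charDom_nonneg ha hz))]
  exact D.charField_lipschitz ht hV hV'

/-- The field is only locally Lipschitz, so Picard–Lindelöf on all of `[0, T]` is applied to the
field retracted to the ball of radius `C`. Its solution has decreasing energy, the energy bounds the
original field by `C`, and hence the retraction was never active. -/
theorem exists_isCharSol {T : ℝ} (hT : 0 ≤ T) : ∃ V, IsCharSol N R w₀ T V ∧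
    ∀ t ∈ Icc 0 T, charEnergy N R w₀ t (V t) ≤ charEnergy N R w₀ 0 0 := by
  have hN := D.one_lt
  have hR := D.pos
  -- The bound of `norm_charField_le` with `l = 1`, at its largest for `t = 0`; the extra 1 ensures
  -- positivity.
  set C : ℝ := charEnergy N R w₀ 0 0 + R ^ (1 - N) / (N - 1) + 1 with hCdef
  have hE0 := D.charEnergy_nonneg le_rfl 0
  have hC : 0 < C := by
    have : 0 ≤ R ^ (1 - N) / (N - 1) := div_nonneg (by positivity) (by linarith)
    linarith
  set K := ((N + 1) * ∫ z in Ioi R, charDom N w₀ (C * T) z).toNNReal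
  have hlip : LipschitzWith 2 (radialRetract C : (ℝ →ᵇ ℝ) → (ℝ →ᵇ ℝ)) :=
    LipschitzWith.of_dist_le_mul fun x y => by
      rw [dist_eq_norm, dist_eq_norm]; exact norm_radialRetract_sub_le hC x y
  -- Speed at most `C` keeps the path in the ball of radius `C * T`, on which the field is
  -- `K`-Lipschitz; the retraction doubles the constant.
  have hPL : IsPicardLindelof (fun t V => radialRetract C (charField N R w₀ t V))
      (tmin := 0) (tmax := T) ⟨0, left_mem_Icc.2 hT⟩ 0 (C * T).toNNReal 0 C.toNNReal (2 * K) := by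
    refine ⟨fun t ht => ?_, fun V _ => ?_, fun t _ V _ => ?_, ?_⟩
    · refine hlip.lipschitzOnWith.comp (t := univ) ?_ (mapsTo_univ _ _)
      rw [Real.coe_toNNReal _ (by positivity)]
      exact D.lipschitzOnWith_charField ht.1
    · exact hlip.continuous.comp_continuousOn
        ((D.continuousOn_charField V).mono Icc_subset_Ici_self)
    · rw [Real.coe_toNNReal _ hC.le]
      exact norm_radialRetract_le hC _
    · rw [Real.coe_toNNReal _ hC.le, Real.coe_toNNReal _ (by positivity)]
      simp [hT]
  obtain ⟨V, hV0, hV⟩ := hPL.exists_eq_forall_mem_Icc_hasDerivWithinAt₀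
  simp only at hV0
  have hVc : ContinuousOn V (Icc 0 T) := fun t ht => (hV t ht).continuousWithinAt
  obtain ⟨a, -, ha⟩ := exists_norm_bound_of_continuousOn hVc
  have hanti := D.charEnergy_antitoneOn (T := T) (a := a) (B := C) (V := V)
    (χ := fun s => C / max C ‖charField N R w₀ s (V s)‖)
    (fun s => div_nonneg hC.le (le_max_of_le_left hC.le)) hV ha
    (fun s _ => norm_radialRetract_le hC _)
  have hE : ∀ t ∈ Icc 0 T, charEnergy N R w₀ t (V t) ≤ charEnergy N R w₀ 0 0 := by
    intro t ht
    have := hanti (left_mem_Icc.2 hT) ht ht.1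
    simp only at this
    rwa [hV0] at this
  refine ⟨V, ⟨hV0, fun t ht => ?_⟩, hE⟩
  have h1 : ‖charField N R w₀ t (V t)‖ ≤ C := by
    have h2 := D.norm_charField_le ht.1 one_pos (V t)
    rw [Real.one_rpow, one_mul, one_mul] at h2
    have h3 : (R + t) ^ (1 - N) ≤ R ^ (1 - N) :=
      Real.rpow_le_rpow_of_nonpos hR (by linarith [ht.1]) (by linarith)
    have h4 : (R + t) ^ (1 - N) / (N - 1) ≤ R ^ (1 - N) / (N - 1) :=
      div_le_div_of_nonneg_right h3 (by linarith)
    linarith [hE t ht]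
  have h5 := hV t ht
  rwa [radialRetract_of_le hC h1] at h5

theorem isCharSol_unique {T : ℝ} {V V' : ℝ → ℝ →ᵇ ℝ} (hV : IsCharSol N R w₀ T V)
    (hV' : IsCharSol N R w₀ T V') : EqOn V V' (Icc 0 T) := by
  obtain ⟨a, -, ha⟩ := exists_norm_bound_of_continuousOn hV.continuousOn
  obtain ⟨a', -, ha'⟩ := exists_norm_bound_of_continuousOn hV'.continuousOn
  have hd : ∀ {U : ℝ → ℝ →ᵇ ℝ}, IsCharSol N R w₀ T U → ∀ t ∈ Ico 0 T,
      HasDerivWithinAt U (charField N R w₀ t (U t)) (Ici t) t := by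
    intro U hU t ht
    refine (hU.2 t (Ico_subset_Icc_self ht)).mono_of_mem_nhdsWithin ?_
    have : Ici t ∩ Iio T ⊆ Icc 0 T := fun x hx => ⟨ht.1.trans hx.1, le_of_lt hx.2⟩
    exact mem_of_superset (inter_mem_nhdsWithin _ (Iio_mem_nhds ht.2)) this
  refine ODE_solution_unique_of_mem_Icc_right
    (s := fun _ => Metric.closedBall 0 (max a a'))
    (fun t ht => D.lipschitzOnWith_charField ht.1) hV.continuousOn (hd hV) (fun t ht => ?_)
    hV'.continuousOn (hd hV') (fun t ht => ?_) (hV.1.trans hV'.1.symm)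
  · exact mem_closedBall_zero_iff.2 ((ha t (Ico_subset_Icc_self ht)).trans (le_max_left _ _))
  · exact mem_closedBall_zero_iff.2 ((ha' t (Ico_subset_Icc_self ht)).trans (le_max_right _ _))

theorem exists_global : ∃ V : ℝ → ℝ →ᵇ ℝ, (∀ T, IsCharSol N R w₀ T V) ∧
    ∀ t, 0 ≤ t → charEnergy N R w₀ t (V t) ≤ charEnergy N R w₀ 0 0 := by
  choose U hU hUE using fun n : ℕ => D.exists_isCharSol (T := n + 1) (by positivity)
  have hUeq : ∀ m n : ℕ, ∀ t ∈ Icc (0 : ℝ) (m + 1), t ≤ n + 1 → U m t = U n t := by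
    intro m n t ht htn
    exact D.isCharSol_unique ((hU m).mono (T' := t) ht.2) ((hU n).mono htn) ⟨ht.1, le_rfl⟩
  -- `U n` solves on `[0, n + 1]`, so the index `⌊t⌋₊` always reaches beyond `t`, and by uniqueness
  -- any larger index gives the same value.
  set V : ℝ → ℝ →ᵇ ℝ := fun t => U ⌊t⌋₊ t with hVdef
  have hVU : ∀ n : ℕ, ∀ t ∈ Icc (0 : ℝ) (n + 1), V t = U n t := fun n t ht =>
    hUeq _ n t ⟨ht.1, (Nat.lt_floor_add_one t).le⟩ ht.2
  refine ⟨V, fun T => ⟨?_, fun t ht => ?_⟩, fun t ht => ?_⟩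
  · simp only [hVdef]; exact (hU _).1
  · set m := ⌊T⌋₊ with hm
    have hTm : T ≤ m + 1 := (Nat.lt_floor_add_one T).le
    have htm : t ∈ Icc (0 : ℝ) (m + 1) := ⟨ht.1, ht.2.trans hTm⟩
    have h := ((hU m).2 t htm).mono (Icc_subset_Icc_right hTm)
    rw [← hVU m t htm] at h
    exact h.congr (fun s hs => hVU m s ⟨hs.1, hs.2.trans hTm⟩) (hVU m t htm)
  · have htm : t ∈ Icc (0 : ℝ) ((⌊t⌋₊ : ℝ) + 1) := ⟨ht, (Nat.lt_floor_add_one t).le⟩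
    rw [hVU _ t htm]
    exact hUE _ t htm

theorem continuousOn_uncurry_charField (T a : ℝ) :
    ContinuousOn (Function.uncurry (charField N R w₀))
      (Icc 0 T ×ˢ Metric.closedBall (0 : ℝ →ᵇ ℝ) a) := by
  generalize hK : ((N + 1) * ∫ z in Ioi R, charDom N w₀ a z).toNNReal = K
  refine continuousOn_prod_of_continuousOn_lipschitzOnWith' _ K (fun t ht => ?_) (fun U _ => ?_)
  · have := D.lipschitzOnWith_charField (a := a) ht.1
    rw [hK] at this
    exact this
  · exact (D.continuousOn_charField U).mono Icc_subset_Ici_self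

theorem continuousOn_charField_comp {T : ℝ} {V : ℝ → ℝ →ᵇ ℝ} (hV : ContinuousOn V (Icc 0 T)) :
    ContinuousOn (fun s => charField N R w₀ s (V s)) (Icc 0 T) := by
  obtain ⟨a, -, ha⟩ := exists_norm_bound_of_continuousOn hV
  have h2 : ContinuousOn (fun s => (s, V s)) (Icc 0 T) := continuousOn_id.prodMk hV
  have h3 := (D.continuousOn_uncurry_charField T a).comp h2 fun s hs =>
    ⟨hs, mem_closedBall_zero_iff.2 (ha s hs)⟩
  exact h3

theorem intervalIntegrable_charField {T : ℝ} (hT : 0 ≤ T) {V : ℝ → ℝ →ᵇ ℝ}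
    (hV : ContinuousOn V (Icc 0 T)) :
    IntervalIntegrable (fun s => charField N R w₀ s (V s)) volume 0 T :=
  ContinuousOn.intervalIntegrable (by rw [uIcc_of_le hT]; exact D.continuousOn_charField_comp hV)

theorem integral_charField {T : ℝ} (hT : 0 ≤ T) {V : ℝ → ℝ →ᵇ ℝ} (hV : IsCharSol N R w₀ T V) :
    ∫ s in (0 : ℝ)..T, charField N R w₀ s (V s) = V T := by
  have h := intervalIntegral.integral_eq_sub_of_hasDerivAt_of_le hT hV.continuousOn
    (fun t ht => (hV.2 t (Ioo_subset_Icc_self ht)).hasDerivAt (Icc_mem_nhds ht.1 ht.2))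
    (D.intervalIntegrable_charField hT hV.continuousOn)
  rw [h, hV.1, sub_zero]

/-- Testing a solution against an integrable density. -/
theorem integral_mul_eq {T : ℝ} (hT : 0 ≤ T) {V : ℝ → ℝ →ᵇ ℝ} (hV : IsCharSol N R w₀ T V)
    {c : ℝ → ℝ} (hc : Integrable c) :
    ∫ y in Ioi R, V T y * c y
      = ∫ s in (0 : ℝ)..T, ∫ y in Ioi R, charField N R w₀ s (V s) y * c y := by
  have hi : ∀ U : ℝ →ᵇ ℝ, IntegrableOn (fun y => U y * c y) (Ioi R) := fun U =>
    Integrable.bdd_mul hc.integrableOn U.continuous.aestronglyMeasurable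
      (Eventually.of_forall fun y => U.norm_coe_le_norm y)
  -- Integration against `c` is a bounded functional for the sup norm, so it commutes with the
  -- Bochner integral in time.
  let L : (ℝ →ᵇ ℝ) →L[ℝ] ℝ := LinearMap.mkContinuous
    { toFun := fun U => ∫ y in Ioi R, U y * c y
      map_add' := fun U U' => by
        rw [← integral_add (hi U) (hi U')]
        congr 1; funext y; simp only [BoundedContinuousFunction.coe_add, Pi.add_apply]; ring
      map_smul' := fun r U => by
        simp only [RingHom.id_apply, smul_eq_mul]
        rw [← integral_const_mul]
        congr 1; funext y
        simp only [BoundedContinuousFunction.coe_smul, smul_eq_mul]; ring }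
    (∫ y in Ioi R, |c y|) fun U => by
      simp only [LinearMap.coe_mk, AddHom.coe_mk]
      refine (norm_integral_le_integral_norm _).trans ?_
      rw [← integral_mul_const]
      refine integral_mono (hi U).norm (hc.abs.integrableOn.mul_const _) fun y => ?_
      simp only [norm_mul]
      rw [mul_comm]
      exact mul_le_mul_of_nonneg_left (U.norm_coe_le_norm y) (norm_nonneg _)
  have h := L.intervalIntegral_comp_comm (D.intervalIntegrable_charField hT hV.continuousOn)
  rw [D.integral_charField hT hV] at h
  exact h.symm

end CharData

/-! ### From characteristics back to functions on ℝ³. -/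

theorem setIntegral_Ioi_comp_add (f : ℝ → ℝ) (a t : ℝ) :
    ∫ z in Ioi a, f (z + t) = ∫ r in Ioi (a + t), f r := by
  have h := (measurePreserving_add_right (volume : Measure ℝ) t).setIntegral_preimage_emb
    (measurableEmbedding_addRight t) f (Ioi (a + t))
  rwa [preimage_add_const_Ioi, add_sub_cancel_right] at h

theorem integrableOn_Ioi_comp_add {f : ℝ → ℝ} {a t : ℝ} :
    IntegrableOn (fun z => f (z + t)) (Ioi a) ↔ IntegrableOn f (Ioi (a + t)) := by
  have h := (measurePreserving_add_right (volume : Measure ℝ) t).integrableOn_comp_preimage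
    (measurableEmbedding_addRight t) (f := f) (s := Ioi (a + t))
  rwa [preimage_add_const_Ioi, add_sub_cancel_right] at h

theorem setIntegral_Ioi_indicator_shift (f : ℝ → ℝ) {R t : ℝ} (h : 0 ≤ R + t) :
    ∫ r in Ioi 0, (Ioi (R + t)).indicator f r = ∫ z in Ioi R, f (z + t) := by
  rw [setIntegral_indicator measurableSet_Ioi, inter_eq_self_of_subset_right (Ioi_subset_Ioi h),
    setIntegral_Ioi_comp_add]

theorem integrableOn_Ioi_indicator_shift {f : ℝ → ℝ} {R t : ℝ} (h : 0 ≤ R + t) :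
    IntegrableOn ((Ioi (R + t)).indicator f) (Ioi 0) ↔
      IntegrableOn (fun z => f (z + t)) (Ioi R) := by
  rw [integrableOn_Ioi_comp_add, integrableOn_indicator_iff measurableSet_Ioi,
    inter_eq_self_of_subset_left (Ioi_subset_Ioi h)]

theorem isRadial_comp_norm (h : ℝ → ℝ) : IsRadial fun x => h ‖x‖ := fun x y hxy => by
  simp only [hxy]

theorem profile_comp_norm (h : ℝ → ℝ) {r : ℝ} (hr : 0 ≤ r) : profile (fun x => h ‖x‖) r = h r := by
  simp [profile, norm_smul, abs_of_nonneg hr]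

section Norm

variable {N : ℝ}

theorem toReal_exponent (hN : 1 < N) : (ENNReal.ofReal (N + 2)).toReal = N + 2 :=
  ENNReal.toReal_ofReal (by linarith)

theorem exponent_ne_zero (hN : 1 < N) : ENNReal.ofReal (N + 2) ≠ 0 := by
  simp only [ne_eq, ENNReal.ofReal_eq_zero, not_le]; linarith

theorem one_le_exponent (hN : 1 < N) : 1 ≤ ENNReal.ofReal (N + 2) :=
  ENNReal.one_le_ofReal.2 (by linarith)

theorem memLp_exponent_iff (hN : 1 < N) {f : E3 → ℝ} (hf : AEStronglyMeasurable f) :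
    MemLp f (ENNReal.ofReal (N + 2)) ↔ Integrable fun x => |f x| ^ (N + 2) := by
  rw [← integrable_norm_rpow_iff hf (exponent_ne_zero hN) ENNReal.ofReal_ne_top,
    toReal_exponent hN]
  rfl

theorem eLpNorm_exponent_eq (hN : 1 < N) {f : E3 → ℝ} (hf : MemLp f (ENNReal.ofReal (N + 2))) :
    eLpNorm f (ENNReal.ofReal (N + 2)) volume
      = ENNReal.ofReal ((∫ x, |f x| ^ (N + 2)) ^ (N + 2)⁻¹) := by
  rw [hf.eLpNorm_eq_integral_rpow_norm (exponent_ne_zero hN) ENNReal.ofReal_ne_top,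
    toReal_exponent hN]
  rfl

end Norm

/-- The radial profile at time `t` of the solution with values `W = w₀ + V` along
characteristics. -/
def charProfile (R : ℝ) (w₀ : ℝ → ℝ) (V : ℝ → ℝ →ᵇ ℝ) (t : ℝ) : ℝ → ℝ :=
  (Ioi (R + t)).indicator fun r => (w₀ (r - t) + V t (r - t)) / r

/-- The solution with values `W = w₀ + V` along characteristics. -/
def charFun (R : ℝ) (w₀ : ℝ → ℝ) (V : ℝ → ℝ →ᵇ ℝ) (t : ℝ) (x : E3) : ℝ :=
  charProfile R w₀ V t ‖x‖

theorem isRadial_charFun (R : ℝ) (w₀ : ℝ → ℝ) (V : ℝ → ℝ →ᵇ ℝ) (t : ℝ) :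
    IsRadial (charFun R w₀ V t) := isRadial_comp_norm _

theorem profile_charFun (R : ℝ) (w₀ : ℝ → ℝ) (V : ℝ → ℝ →ᵇ ℝ) (t : ℝ) {r : ℝ} (hr : 0 ≤ r) :
    profile (charFun R w₀ V t) r = charProfile R w₀ V t r := profile_comp_norm _ hr

theorem charFun_eq_zero {R : ℝ} (w₀ : ℝ → ℝ) (V : ℝ → ℝ →ᵇ ℝ) {t : ℝ} (ht : 0 ≤ t) {x : E3}
    (hx : ‖x‖ < R) : charFun R w₀ V t x = 0 := by
  unfold charFun charProfile
  exact indicator_of_notMem (by simp only [mem_Ioi, not_lt]; linarith) _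

namespace CharData

variable {N R : ℝ} {w₀ : ℝ → ℝ} (D : CharData N R w₀)

include D

theorem measurable_charFun (V : ℝ → ℝ →ᵇ ℝ) (t : ℝ) : Measurable (charFun R w₀ V t) := by
  have h1 : Measurable (charProfile R w₀ V t) := by
    refine Measurable.indicator ?_ measurableSet_Ioi
    have h2 : Measurable fun r : ℝ => r - t := measurable_id.sub_const t
    exact ((D.meas.comp h2).add ((V t).continuous.measurable.comp h2)).div measurable_id
  exact h1.comp measurable_norm

theorem aestronglyMeasurable_charFun {V : ℝ → ℝ →ᵇ ℝ} (hV : ContinuousOn V (Ici 0)) :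
    AEStronglyMeasurable (fun p : ℝ × E3 => charFun R w₀ V p.1 p.2)
      ((volume.restrict (Ici 0)).prod volume) := by
  -- Freezing `V` at negative times makes it continuous on the whole line; joint measurability then
  -- follows from continuity of evaluation.
  have hVc : Continuous fun t : ℝ => V (max t 0) :=
    hV.comp_continuous (by fun_prop) fun t => mem_Ici.2 (le_max_right _ _)
  have h1 : Measurable fun p : ℝ × E3 => ‖p.2‖ - p.1 := Continuous.measurable (by fun_prop)
  have h2 : Measurable fun p : ℝ × E3 => (V (max p.1 0)) (‖p.2‖ - p.1) := by
    refine Continuous.measurable ?_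
    have : Continuous fun p : ℝ × E3 => (V (max p.1 0), ‖p.2‖ - p.1) :=
      (hVc.comp continuous_fst).prodMk (by fun_prop)
    exact (continuous_eval (F := ℝ →ᵇ ℝ)).comp this
  have h3 : Measurable fun p : ℝ × E3 => {p : ℝ × E3 | R + p.1 < ‖p.2‖}.indicator
      (fun p => (w₀ (‖p.2‖ - p.1) + (V (max p.1 0)) (‖p.2‖ - p.1)) / ‖p.2‖) p := by
    refine Measurable.indicator (((D.meas.comp h1).add h2).div measurable_snd.norm) ?_
    exact measurableSet_lt (by fun_prop) (by fun_prop)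
  refine h3.aestronglyMeasurable.congr ?_
  have h4 : ∀ᵐ t ∂(volume.restrict (Ici (0 : ℝ))), 0 ≤ t := ae_restrict_mem measurableSet_Ici
  filter_upwards [Measure.quasiMeasurePreserving_fst.ae h4] with p hp
  simp only [charFun, charProfile, indicator, mem_Ioi, mem_ofPred_eq, max_eq_left hp]

/-- The weight of the energy is explained by `r² |W/r|^{N+2} = |W|^{N+2} r^{-N}` at `r = z + t`. -/
theorem integrable_charFun_rpow (V : ℝ → ℝ →ᵇ ℝ) {t : ℝ} (ht : 0 ≤ t) :
    Integrable (fun x => |charFun R w₀ V t x| ^ (N + 2)) ∧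
    ∫ x, |charFun R w₀ V t x| ^ (N + 2) = 4 * Real.pi * charEnergy N R w₀ t (V t) := by
  have hN := D.one_lt
  have hR := D.pos
  have e : (fun r => r ^ 2 * |charProfile R w₀ V t r| ^ (N + 2)) = (Ioi (R + t)).indicator
      fun r => |w₀ (r - t) + V t (r - t)| ^ (N + 2) * r ^ (-N) := by
    funext r
    by_cases hr : r ∈ Ioi (R + t)
    · have hr0 : 0 < r := by linarith [mem_Ioi.1 hr]
      rw [charProfile, indicator_of_mem hr, indicator_of_mem hr, abs_div, abs_of_pos hr0,
        Real.div_rpow (abs_nonneg _) hr0.le, Real.rpow_neg hr0.le, Real.rpow_add hr0]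
      norm_num
      field_simp
    · rw [charProfile, indicator_of_notMem hr, indicator_of_notMem hr, abs_zero,
        Real.zero_rpow (by linarith), mul_zero]
  have e2 : ∀ z : ℝ, |w₀ (z + t - t) + V t (z + t - t)| ^ (N + 2) * (z + t) ^ (-N)
      = |w₀ z + V t z| ^ (N + 2) * (z + t) ^ (-N) := fun z => by rw [add_sub_cancel_right]
  constructor
  · refine (integrable_norm_iff (h := fun r => |charProfile R w₀ V t r| ^ (N + 2))).2 ?_
    rw [e, integrableOn_Ioi_indicator_shift (by linarith)]
    simp only [e2]
    exact D.integrableOn_energy_pow ht le_rfl (by linarith) le_rfl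
  · refine (integral_norm_polar (fun r => |charProfile R w₀ V t r| ^ (N + 2))).trans ?_
    rw [e, setIntegral_Ioi_indicator_shift _ (by linarith)]
    simp only [e2]
    rfl

theorem memLp_charFun (V : ℝ → ℝ →ᵇ ℝ) {t : ℝ} (ht : 0 ≤ t) :
    MemLp (charFun R w₀ V t) (ENNReal.ofReal (N + 2)) :=
  (memLp_exponent_iff D.one_lt (D.measurable_charFun V t).aestronglyMeasurable).2
    (D.integrable_charFun_rpow V ht).1

theorem eLpNorm_charFun (V : ℝ → ℝ →ᵇ ℝ) {t : ℝ} (ht : 0 ≤ t) :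
    eLpNorm (charFun R w₀ V t) (ENNReal.ofReal (N + 2)) volume
      = ENNReal.ofReal ((4 * Real.pi * charEnergy N R w₀ t (V t)) ^ (N + 2)⁻¹) := by
  rw [eLpNorm_exponent_eq D.one_lt (D.memLp_charFun V ht), (D.integrable_charFun_rpow V ht).2]

theorem pairing_charFun (V : ℝ → ℝ →ᵇ ℝ) {t : ℝ} (ht : 0 ≤ t) (φ : Test) :
    pairing (charFun R w₀ V t) φ
      = 4 * Real.pi * ∫ z in Ioi R, (w₀ z + V t z) * radDensity φ (z + t) := by
  have hR := D.pos
  have hloc := (D.memLp_charFun V ht).locallyIntegrable (one_le_exponent D.one_lt)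
  rw [pairing, (isRadial_charFun R w₀ V t).integral_mul (Test.integrable_mul hloc φ)]
  congr 1
  have e : ∀ r ∈ Ioi (0 : ℝ), r ^ 2 * profile (charFun R w₀ V t) r * sphMean φ r
      = (Ioi (R + t)).indicator (fun r => (w₀ (r - t) + V t (r - t)) * radDensity φ r) r := by
    intro r hr
    have hr0 : (0 : ℝ) < r := hr
    rw [profile_charFun _ _ _ _ hr0.le, charProfile]
    by_cases hr : r ∈ Ioi (R + t)
    · rw [indicator_of_mem hr, indicator_of_mem hr, radDensity]
      field_simp
    · rw [indicator_of_notMem hr, indicator_of_notMem hr]; ring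
  rw [setIntegral_congr_fun measurableSet_Ioi e, setIntegral_Ioi_indicator_shift _ (by linarith)]
  simp only [add_sub_cancel_right]

theorem nonlin_charFun (V : ℝ → ℝ →ᵇ ℝ) (t : ℝ) {r : ℝ} (hr : 0 < r) :
    r * profile (nonlin N (charFun R w₀ V t)) r
      = (Ioi (R + t)).indicator (fun r => charSource N R w₀ t (V t) (r - t)) r := by
  have hR := D.pos
  have hN := D.one_lt
  have h1 : profile (nonlin N (charFun R w₀ V t)) r
      = |charProfile R w₀ V t r| ^ N * charProfile R w₀ V t r := by
    rw [← profile_charFun R w₀ V t hr.le]; rfl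
  rw [h1, charProfile]
  by_cases hm : r ∈ Ioi (R + t)
  · have hm' : r - t ∈ Ioi R := by rw [mem_Ioi] at hm ⊢; linarith
    rw [indicator_of_mem hm, indicator_of_mem hm, charSource, indicator_of_mem hm', powNl,
      sub_add_cancel, abs_div, abs_of_pos hr, Real.div_rpow (abs_nonneg _) hr.le,
      Real.rpow_neg hr.le]
    field_simp
  · rw [indicator_of_notMem hm, indicator_of_notMem hm]; ring

theorem integrable_nonlin_charFun_div (V : ℝ → ℝ →ᵇ ℝ) {t : ℝ} (ht : 0 ≤ t) :
    Integrable fun x => nonlin N (charFun R w₀ V t) x / ‖x‖ := by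
  have hR := D.pos
  have hr : IsRadial (fun x => nonlin N (charFun R w₀ V t) x / ‖x‖) := by
    intro x y hxy
    simp only [nonlin, isRadial_charFun R w₀ V t x y hxy, hxy]
  rw [hr.integrable_iff]
  have e : EqOn ((Ioi (R + t)).indicator (fun r => charSource N R w₀ t (V t) (r - t)))
      (fun r => r ^ 2 * profile (fun x => nonlin N (charFun R w₀ V t) x / ‖x‖) r) (Ioi 0) := by
    intro r hr0
    have hr0' : (0 : ℝ) < r := hr0
    rw [← D.nonlin_charFun V t hr0']
    simp only [profile, norm_smul, PiLp.norm_single, norm_one, mul_one,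
      Real.norm_of_nonneg hr0'.le]
    field_simp
  refine IntegrableOn.congr_fun ?_ e measurableSet_Ioi
  rw [integrableOn_Ioi_indicator_shift (by linarith)]
  simp only [add_sub_cancel_right]
  exact (D.integrable_charSource ht (V t)).integrableOn

/-- A source at time `s` and radius `z + s` acts at time `t` through the tail integral from `(z + s)
+ (t - s) = z + t`. The dependence on `s` in the shift disappears, so in the variable `z` the
Duhamel term is the time integral of `charField`. -/
theorem waveFlowProjOut_charFun (V : ℝ → ℝ →ᵇ ℝ) {s : ℝ} (hs : 0 ≤ s) (t : ℝ) (φ : Test) :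
    waveFlowProjOut (t - s) (nonlin N (charFun R w₀ V s)) φ
      = 4 * Real.pi * ∫ y in Ioi R, charField N R w₀ s (V s) y * radDensity φ (y + t) := by
  have hR := D.pos
  have hrad : IsRadial (nonlin N (charFun R w₀ V s)) := by
    intro x y hxy
    simp only [nonlin, isRadial_charFun R w₀ V s x y hxy]
  rw [waveFlowProjOut_eq_profile hrad hR (Eventually.of_forall fun x hx => by
    simp only [nonlin, charFun_eq_zero w₀ V hs hx, mul_zero])
    (D.integrable_nonlin_charFun_div V hs)]
  have e : ∀ r ∈ Ioi (0 : ℝ), r * profile (nonlin N (charFun R w₀ V s)) r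
        * tailMean φ (r + (t - s))
      = (Ioi (R + s)).indicator
        (fun r => charSource N R w₀ s (V s) (r - s) * tailMean φ (r + (t - s))) r := by
    intro r hr
    rw [D.nonlin_charFun V s hr]
    by_cases hm : r ∈ Ioi (R + s)
    · rw [indicator_of_mem hm, indicator_of_mem hm]
    · rw [indicator_of_notMem hm, indicator_of_notMem hm, zero_mul]
  rw [setIntegral_congr_fun measurableSet_Ioi e, setIntegral_Ioi_indicator_shift _ (by linarith)]
  have e2 : ∀ z : ℝ, charSource N R w₀ s (V s) (z + s - s) * tailMean φ (z + s + (t - s))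
      = charSource N R w₀ s (V s) z * tailMean φ (z + t) := fun z => by
    rw [add_sub_cancel_right, add_add_sub_cancel]
  simp only [e2]
  rw [← integral_primitive_mul_radDensity (D.integrable_charSource hs (V s)).integrableOn,
    ← integral_const_mul, ← integral_const_mul]
  congr 1
  funext y
  rw [D.charField_apply hs]
  ring

end CharData

/-! ### The initial data and verification of the equation. -/

/-- Radial data vanishing near the origin come from data along characteristics. -/
theorem exists_charData {N : ℝ} (hN : 1 < N) {R : ℝ} (hR : 0 < R) {u₀ : E3 → ℝ}
    (hrad : IsRadial u₀) (hLp : MemLp u₀ (ENNReal.ofReal (N + 2))) :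
    ∃ w₀ : ℝ → ℝ, CharData N R w₀ ∧ ∀ᵐ r : ℝ, 0 < r → r * profile u₀ r = w₀ r := by
  obtain ⟨h, hm, he⟩ := hrad.aestronglyMeasurable_profile hLp.1
  rw [EventuallyEq, ae_restrict_iff' measurableSet_Ioi] at he
  refine ⟨fun r => r * h r, ⟨hN, hR, measurable_id.mul hm.measurable, ?_⟩, ?_⟩
  · have h1 := (memLp_exponent_iff hN hLp.1).1 hLp
    have h2 : IsRadial fun x => |u₀ x| ^ (N + 2) := fun x y hxy => by
      simp only [hrad x y hxy]
    rw [h2.integrable_iff] at h1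
    refine (h1.mono_set (Ioi_subset_Ioi hR.le)).congr ?_
    rw [EventuallyEq, ae_restrict_iff' measurableSet_Ioi]
    filter_upwards [he] with r hr hrR
    have hr0 : 0 < r := hR.trans hrR
    have h3 : profile (fun x => |u₀ x| ^ (N + 2)) r = |h r| ^ (N + 2) := by
      rw [← hr hr0]; rfl
    rw [h3, abs_mul, abs_of_pos hr0, Real.mul_rpow hr0.le (abs_nonneg _), Real.rpow_add hr0,
      Real.rpow_neg hr0.le]
    norm_num
    field_simp
  · filter_upwards [he] with r hr hr0
    rw [hr hr0]

section Data

variable {N R : ℝ} {w₀ : ℝ → ℝ} {u₀ : E3 → ℝ}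

/-- A general integrand vanishing with its second argument covers both the tested free flow and the
`L^{N+2}` norm. -/
theorem integral_profile_eq (hR : 0 < R) (hrad : IsRadial u₀)
    (hs : ∀ᵐ x : E3, ‖x‖ < R → u₀ x = 0)
    (hw : ∀ᵐ r : ℝ, 0 < r → r * profile u₀ r = w₀ r) (F : ℝ → ℝ → ℝ) (hF : ∀ r, F r 0 = 0) :
    ∫ r in Ioi (0 : ℝ), F r (r * profile u₀ r) = ∫ r in Ioi R, F r (w₀ r) := by
  have hz : ∀ᵐ r : ℝ, 0 < r → r < R → profile u₀ r = 0 := by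
    have : ∀ᵐ x : E3, ‖x‖ < R → profile u₀ ‖x‖ = 0 := by
      simpa only [← hrad.eq_profile] using hs
    exact (ae_norm_iff (p := fun r => r < R → profile u₀ r = 0)).1 this
  have h1 : ∫ r in Ioi R, F r (w₀ r) = ∫ r in Ioi 0, (Ioi R).indicator (fun r => F r (w₀ r)) r := by
    rw [setIntegral_indicator measurableSet_Ioi, inter_eq_self_of_subset_right
      (Ioi_subset_Ioi hR.le)]
  rw [h1]
  refine setIntegral_congr_ae measurableSet_Ioi ?_
  have hne : ∀ᵐ r : ℝ, r ≠ R := by simp [ae_iff]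
  filter_upwards [hz, hw, hne] with r h2 h3 h4 h0
  have h0' : 0 < r := h0
  rcases lt_or_gt_of_ne h4 with h | h
  · rw [indicator_of_notMem (by simp only [mem_Ioi, not_lt]; exact h.le), h2 h0' h, mul_zero, hF]
  · rw [indicator_of_mem (mem_Ioi.2 h), h3 h0']

theorem waveFlow_eq_charData (D : CharData N R w₀) (hrad : IsRadial u₀) {u₁ : Distr}
    (hout : IsOutgoing u₀ u₁) (hLp : MemLp u₀ (ENNReal.ofReal (N + 2)))
    (hs : ∀ᵐ x : E3, ‖x‖ < R → u₀ x = 0)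
    (hw : ∀ᵐ r : ℝ, 0 < r → r * profile u₀ r = w₀ r) (t : ℝ) (φ : Test) :
    waveFlow t (pairing u₀) u₁ φ = 4 * Real.pi * ∫ z in Ioi R, w₀ z * radDensity φ (z + t) := by
  rw [waveFlow_outgoing hrad hout (hLp.locallyIntegrable (one_le_exponent D.one_lt)) D.pos hs]
  congr 1
  exact integral_profile_eq D.pos hrad hs hw (fun r p => p * ((r + t) * sphMean φ (r + t)))
    (by simp)

theorem eLpNorm_eq_charData (D : CharData N R w₀) (hrad : IsRadial u₀)
    (hLp : MemLp u₀ (ENNReal.ofReal (N + 2)))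
    (hs : ∀ᵐ x : E3, ‖x‖ < R → u₀ x = 0)
    (hw : ∀ᵐ r : ℝ, 0 < r → r * profile u₀ r = w₀ r) :
    eLpNorm u₀ (ENNReal.ofReal (N + 2)) volume
      = ENNReal.ofReal ((4 * Real.pi * charEnergy N R w₀ 0 0) ^ (N + 2)⁻¹) := by
  have hN := D.one_lt
  have hR := D.pos
  have h2 : IsRadial fun x => |u₀ x| ^ (N + 2) := fun x y hxy => by
    simp only [hrad x y hxy]
  rw [eLpNorm_exponent_eq D.one_lt hLp, h2.integral_eq]
  have h3 := integral_profile_eq D.pos hrad hs hw (fun r p => |p| ^ (N + 2) * (r + 0) ^ (-N))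
    (fun r => by rw [abs_zero, Real.zero_rpow (by linarith), zero_mul])
  have h4 : ∀ r ∈ Ioi (0 : ℝ), r ^ 2 * profile (fun x => |u₀ x| ^ (N + 2)) r
      = |r * profile u₀ r| ^ (N + 2) * (r + 0) ^ (-N) := by
    intro r hr
    have hr0 : 0 < r := hr
    have h3 : profile (fun x => |u₀ x| ^ (N + 2)) r = |profile u₀ r| ^ (N + 2) := rfl
    rw [h3, abs_mul, abs_of_pos hr0, Real.mul_rpow hr0.le (abs_nonneg _), Real.rpow_add hr0,
      add_zero, Real.rpow_neg hr0.le]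
    norm_num
    field_simp
  rw [setIntegral_congr_fun measurableSet_Ioi h4, h3, charEnergy]
  simp

theorem CharData.integrableOn_mul_radDensity (D : CharData N R w₀) (φ : Test) (t : ℝ) :
    IntegrableOn (fun z => w₀ z * radDensity φ (z + t)) (Ioi R) := by
  have hN := D.one_lt
  have hR := D.pos
  have h1 : IntegrableOn (fun z => w₀ z * z ^ (-N)) (Ioi R) := by
    have h := D.integrableOn_energy_pow (V := 0) le_rfl norm_zero.le zero_le_one (by linarith)
    refine Integrable.mono' h (D.meas.mul (measurable_id.pow_const _)).aestronglyMeasurable ?_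
    filter_upwards [ae_restrict_mem measurableSet_Ioi] with z hz
    have hz0 : 0 < z := hR.trans hz
    rw [norm_mul, Real.norm_of_nonneg (by positivity : 0 ≤ z ^ (-N))]
    simp
  -- Only `w₀ z^{-N}` is known to be integrable; the missing factor `z^N` is absorbed by the
  -- compactly supported density.
  have hc : Continuous fun z : ℝ => (max z 0) ^ N * radDensity φ (z + t) := by
    have := continuous_radDensity φ
    have h2 : Continuous fun z : ℝ => (max z 0) ^ N :=
      (continuous_id.max continuous_const).rpow_const fun z => Or.inr (by linarith)
    fun_prop
  obtain ⟨C, hC⟩ := hc.bounded_above_of_compact_support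
    ((hasCompactSupport_radDensity φ).comp_homeomorph (Homeomorph.addRight t)).mul_left
  refine (Integrable.mul_bdd h1 hc.aestronglyMeasurable (Eventually.of_forall hC)).congr ?_
  filter_upwards [ae_restrict_mem measurableSet_Ioi] with z hz
  have hz0 : 0 < z := hR.trans hz
  rw [max_eq_left hz0.le, Real.rpow_neg hz0.le]
  field_simp

theorem isSolution_charFun (D : CharData N R w₀) (hrad : IsRadial u₀) {u₁ : Distr}
    (hout : IsOutgoing u₀ u₁) (hLp : MemLp u₀ (ENNReal.ofReal (N + 2)))
    (hs : ∀ᵐ x : E3, ‖x‖ < R → u₀ x = 0)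
    (hw : ∀ᵐ r : ℝ, 0 < r → r * profile u₀ r = w₀ r) {V : ℝ → ℝ →ᵇ ℝ}
    (hV : ∀ T, IsCharSol N R w₀ T V)
    (hE : ∀ t, 0 ≤ t → charEnergy N R w₀ t (V t) ≤ charEnergy N R w₀ 0 0) :
    IsSolution N u₀ u₁ (Ici 0) (charFun R w₀ V) where
  radial t _ := isRadial_charFun R w₀ V t
  aestronglyMeasurable := by
    refine D.aestronglyMeasurable_charFun fun t ht => ?_
    have h1 := (hV (t + 1)).continuousOn t ⟨ht, by linarith⟩
    refine h1.mono_of_mem_nhdsWithin ?_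
    have : Ici (0 : ℝ) ∩ Iio (t + 1) ⊆ Icc 0 (t + 1) := fun x hx => ⟨hx.1, le_of_lt hx.2⟩
    exact mem_of_superset (inter_mem_nhdsWithin _ (Iio_mem_nhds (by linarith))) this
  memLp t ht := D.memLp_charFun V ht
  bounded T := by
    refine ⟨(4 * Real.pi * charEnergy N R w₀ 0 0) ^ (N + 2)⁻¹, fun t ht _ => ?_⟩
    rw [D.eLpNorm_charFun V ht]
    have h0 := D.charEnergy_nonneg ht (V t)
    have := D.one_lt
    have := Real.pi_pos
    refine ENNReal.ofReal_le_ofReal (Real.rpow_le_rpow (by positivity) ?_ (by positivity))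
    exact mul_le_mul_of_nonneg_left (hE t ht) (by positivity)
  vanish_near_zero := ⟨R, D.pos, fun t ht => Eventually.of_forall fun x hx =>
    charFun_eq_zero w₀ V ht hx⟩
  equation t ht φ := by
    have ht' : 0 ≤ t := ht
    have hc : Integrable fun y => radDensity φ (y + t) := (integrable_radDensity φ).comp_add_right t
    rw [D.pairing_charFun V ht, waveFlow_eq_charData D hrad hout hLp hs hw t φ]
    have e : ∫ s in (0 : ℝ)..t, waveFlowProjOut (t - s) (nonlin N (charFun R w₀ V s)) φ
        = ∫ s in (0 : ℝ)..t, 4 * Real.pi *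
          ∫ y in Ioi R, charField N R w₀ s (V s) y * radDensity φ (y + t) := by
      refine intervalIntegral.integral_congr fun s hs => ?_
      rw [uIcc_of_le ht'] at hs
      exact D.waveFlowProjOut_charFun V hs.1 t φ
    rw [e, intervalIntegral.integral_const_mul, ← D.integral_mul_eq ht' (hV t) hc, ← mul_add,
      ← integral_add]
    · congr 2; funext y; ring
    · exact D.integrableOn_mul_radDensity φ t
    · exact Integrable.bdd_mul hc.integrableOn (V t).continuous.aestronglyMeasurable
        (Eventually.of_forall fun y => (V t).norm_coe_le_norm y)

end Data

/-! ### Decay for `N > 4`. -/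

namespace CharData

variable {N R : ℝ} {w₀ : ℝ → ℝ} (D : CharData N R w₀)

include D

/-- The choice `l = (R + t)^{3/(N+2) - 1}` balances Young's inequality: `l^{-(N+1)} (R + t)^{1-N}`
is the same power of `R + t`. -/
theorem norm_charField_le_rpow {t : ℝ} (ht : 0 ≤ t) (V : ℝ →ᵇ ℝ) :
    ‖charField N R w₀ t V‖
      ≤ (charEnergy N R w₀ t V + (N - 1)⁻¹) * (R + t) ^ (3 / (N + 2) - 1) := by
  have hN := D.one_lt
  have hRt : 0 < R + t := by linarith [D.pos]
  have h := D.norm_charField_le ht (Real.rpow_pos_of_pos hRt (3 / (N + 2) - 1)) V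
  rw [← Real.rpow_mul hRt.le, ← mul_div_assoc, ← Real.rpow_add hRt] at h
  have e : (3 / (N + 2) - 1) * -(N + 1) + (1 - N) = 3 / (N + 2) - 1 := by field_simp; ring
  rw [e] at h
  refine h.trans (le_of_eq ?_)
  ring

theorem norm_charSol_le {V : ℝ → ℝ →ᵇ ℝ} (hV : ∀ T, IsCharSol N R w₀ T V)
    (hE : ∀ t, 0 ≤ t → charEnergy N R w₀ t (V t) ≤ charEnergy N R w₀ 0 0) {t : ℝ} (ht : 0 ≤ t) :
    ‖V t‖ ≤ (charEnergy N R w₀ 0 0 + (N - 1)⁻¹) * ((N + 2) / 3) * (R + t) ^ (3 / (N + 2)) := by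
  have hN := D.one_lt
  have hR := D.pos
  set C := charEnergy N R w₀ 0 0 + (N - 1)⁻¹ with hC
  have hC0 : 0 ≤ C := add_nonneg (D.charEnergy_nonneg le_rfl 0) (inv_nonneg.2 (by linarith))
  have hα : 0 < 3 / (N + 2) := by positivity
  have hb : ∀ s ∈ Ioc 0 t, ‖charField N R w₀ s (V s)‖ ≤ C * (s + R) ^ (3 / (N + 2) - 1) := by
    intro s hs
    refine (D.norm_charField_le_rpow hs.1.le (V s)).trans ?_
    have hs0 := hs.1
    rw [add_comm s R]
    gcongr
    linarith [hE s hs.1.le]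
  have hi : IntervalIntegrable (fun s : ℝ => C * (s + R) ^ (3 / (N + 2) - 1)) volume 0 t := by
    refine ContinuousOn.intervalIntegrable ?_
    rw [uIcc_of_le ht]
    refine continuousOn_const.mul (ContinuousOn.rpow_const (by fun_prop) fun s hs => Or.inl ?_)
    linarith [hs.1]
  have h := intervalIntegral.norm_integral_le_of_norm_le ht
    (Eventually.of_forall hb) hi
  rw [D.integral_charField ht (hV t), intervalIntegral.integral_const_mul,
    intervalIntegral.integral_comp_add_right (fun s => s ^ (3 / (N + 2) - 1)),
    integral_rpow (Or.inl (by linarith)), sub_add_cancel, zero_add] at h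
  refine h.trans ?_
  have h1 : 0 ≤ R ^ (3 / (N + 2)) := by positivity
  rw [mul_assoc, add_comm t R]
  refine mul_le_mul_of_nonneg_left ?_ hC0
  rw [div_le_iff₀ hα]
  have : (N + 2) / 3 * (R + t) ^ (3 / (N + 2)) * (3 / (N + 2)) = (R + t) ^ (3 / (N + 2)) := by
    field_simp
  rw [this]
  linarith

theorem charEnergy_le {t : ℝ} (ht : 0 ≤ t) (V : ℝ →ᵇ ℝ) :
    charEnergy N R w₀ t V ≤ 2 ^ (N + 2) *
      (charEnergy N R w₀ t 0 + ‖V‖ ^ (N + 2) * ((R + t) ^ (1 - N) / (N - 1))) := by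
  have hN := D.one_lt
  have i1 := D.integrableOn_energy_pow ht (norm_zero (E := ℝ →ᵇ ℝ)).le
    (by linarith : 0 ≤ N + 2) le_rfl
  have i2 := (D.integrableOn_shift_rpow ht).const_mul (‖V‖ ^ (N + 2))
  rw [← D.integral_shift_rpow ht, charEnergy, charEnergy, ← integral_const_mul,
    ← integral_add i1 i2, ← integral_const_mul]
  refine setIntegral_mono_on (D.integrableOn_energy_pow ht le_rfl (by linarith) le_rfl)
    ((i1.add i2).const_mul _) measurableSet_Ioi fun z hz => ?_
  have hz0 : 0 < z := D.pos.trans hz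
  have h1 : |w₀ z + V z| ^ (N + 2) ≤ 2 ^ (N + 2) * (|w₀ z| ^ (N + 2) + ‖V‖ ^ (N + 2)) :=
    (Real.rpow_le_rpow (abs_nonneg _) (abs_add_le V le_rfl z) (by linarith)).trans
      (add_rpow_le_two_rpow_mul (abs_nonneg _) (norm_nonneg _) (by linarith))
  calc |w₀ z + V z| ^ (N + 2) * (z + t) ^ (-N)
      ≤ 2 ^ (N + 2) * (|w₀ z| ^ (N + 2) + ‖V‖ ^ (N + 2)) * (z + t) ^ (-N) := by gcongr
    _ = _ := by simp only [BoundedContinuousFunction.coe_zero, Pi.zero_apply, add_zero]; ring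

/-- For `V = 0` the integrand tends to zero pointwise and is dominated by its value at `t = 0`; no
rate is available. -/
theorem tendsto_charEnergy_zero :
    Tendsto (fun t => charEnergy N R w₀ t 0) atTop (𝓝 0) := by
  have hN := D.one_lt
  have h := tendsto_integral_filter_of_dominated_convergence
    (μ := volume.restrict (Ioi R)) (l := atTop)
    (F := fun (t : ℝ) z => |w₀ z + (0 : ℝ →ᵇ ℝ) z| ^ (N + 2) * (z + t) ^ (-N)) (f := fun _ => 0)
    (fun z => |w₀ z| ^ (N + 2) * z ^ (-N)) ?_ ?_ D.integrable ?_
  · simpa [charEnergy] using h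
  · filter_upwards [eventually_ge_atTop 0] with t ht
    exact (D.integrableOn_energy_pow ht le_rfl (by linarith) le_rfl).aestronglyMeasurable
  · filter_upwards [eventually_ge_atTop 0] with t ht
    filter_upwards [ae_restrict_mem measurableSet_Ioi] with z hz
    have hz0 : 0 < z := D.pos.trans hz
    simp only [BoundedContinuousFunction.coe_zero, Pi.zero_apply, add_zero]
    rw [Real.norm_of_nonneg (by positivity)]
    exact mul_le_mul_of_nonneg_left (shift_rpow_le hN D.pos ht hz) (by positivity)
  · refine Eventually.of_forall fun z => ?_
    have h1 := (tendsto_rpow_neg_atTop (by linarith : 0 < N)).comp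
      (tendsto_atTop_add_const_left atTop z tendsto_id)
    simpa using h1.const_mul (|w₀ z + (0 : ℝ →ᵇ ℝ) z| ^ (N + 2))

/-- By `norm_charSol_le` the factor `‖V‖^{N+2}` grows at most like `(R + t)^3`, while the total
weight is of order `(R + t)^{1-N}`. The product `(R + t)^{4-N}` tends to zero exactly when `N > 4`.
-/
theorem tendsto_charEnergy (hN4 : 4 < N) {V : ℝ → ℝ →ᵇ ℝ} (hV : ∀ T, IsCharSol N R w₀ T V)
    (hE : ∀ t, 0 ≤ t → charEnergy N R w₀ t (V t) ≤ charEnergy N R w₀ 0 0) :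
    Tendsto (fun t => charEnergy N R w₀ t (V t)) atTop (𝓝 0) := by
  have hR := D.pos
  set C := (charEnergy N R w₀ 0 0 + (N - 1)⁻¹) * ((N + 2) / 3) with hC
  have hC0 : 0 ≤ C := mul_nonneg (add_nonneg (D.charEnergy_nonneg le_rfl 0)
    (inv_nonneg.2 (by linarith))) (by linarith)
  have h1 : Tendsto (fun t => (R + t) ^ (-(N - 4))) atTop (𝓝 0) :=
    (tendsto_rpow_neg_atTop (by linarith : 0 < N - 4)).comp
      (tendsto_atTop_add_const_left atTop R tendsto_id)
  have h2 : Tendsto (fun t => 2 ^ (N + 2) * (charEnergy N R w₀ t 0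
      + C ^ (N + 2) / (N - 1) * (R + t) ^ (-(N - 4)))) atTop (𝓝 0) := by
    simpa using (D.tendsto_charEnergy_zero.add (h1.const_mul (C ^ (N + 2) / (N - 1)))).const_mul
      (2 ^ (N + 2))
  refine squeeze_zero' ?_ ?_ h2
  · filter_upwards [eventually_ge_atTop 0] with t ht
    exact D.charEnergy_nonneg ht _
  · filter_upwards [eventually_ge_atTop 0] with t ht
    have hRt : 0 < R + t := by linarith
    have hN1 : 0 < N - 1 := by linarith
    refine (D.charEnergy_le ht (V t)).trans ?_
    refine mul_le_mul_of_nonneg_left (add_le_add le_rfl ?_) (by positivity)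
    have h3 : ‖V t‖ ^ (N + 2) ≤ (C * (R + t) ^ (3 / (N + 2))) ^ (N + 2) :=
      Real.rpow_le_rpow (norm_nonneg _) (D.norm_charSol_le hV hE ht) (by linarith)
    rw [Real.mul_rpow hC0 (by positivity), ← Real.rpow_mul hRt.le,
      div_mul_cancel₀ _ (by linarith)] at h3
    have h4 : (R + t) ^ (-(N - 4)) = (R + t) ^ (3 : ℝ) * (R + t) ^ (1 - N) := by
      rw [← Real.rpow_add hRt]; congr 1; ring
    rw [h4]
    calc ‖V t‖ ^ (N + 2) * ((R + t) ^ (1 - N) / (N - 1))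
        ≤ C ^ (N + 2) * (R + t) ^ (3 : ℝ) * ((R + t) ^ (1 - N) / (N - 1)) := by gcongr
      _ = _ := by ring

theorem tendsto_eLpNorm_charFun (hN4 : 4 < N) {V : ℝ → ℝ →ᵇ ℝ} (hV : ∀ T, IsCharSol N R w₀ T V)
    (hE : ∀ t, 0 ≤ t → charEnergy N R w₀ t (V t) ≤ charEnergy N R w₀ 0 0) :
    Tendsto (fun t => eLpNorm (charFun R w₀ V t) (ENNReal.ofReal (N + 2)) volume)
      atTop (𝓝 0) := by
  have hp : 0 < (N + 2)⁻¹ := inv_pos.2 (by linarith)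
  have h1 : Tendsto (fun t => (4 * Real.pi * charEnergy N R w₀ t (V t)) ^ (N + 2)⁻¹)
      atTop (𝓝 0) := by
    have := ((D.tendsto_charEnergy hN4 hV hE).const_mul (4 * Real.pi)).rpow_const
      (p := (N + 2)⁻¹) (Or.inr hp.le)
    rwa [mul_zero, Real.zero_rpow hp.ne'] at this
  have h2 := ENNReal.tendsto_ofReal h1
  rw [ENNReal.ofReal_zero] at h2
  refine h2.congr' ?_
  filter_upwards [eventually_ge_atTop 0] with t ht
  exact (D.eLpNorm_charFun V ht).symm

end CharData

/-! ### Uniqueness -/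

theorem mul_rpow_le_add_rpow {a b i j : ℝ} (ha : 0 ≤ a) (hb : 0 ≤ b) (hi : 0 ≤ i) (hj : 0 ≤ j) :
    a ^ i * b ^ j ≤ a ^ (i + j) + b ^ (i + j) := by
  rcases le_total a b with h | h
  · calc a ^ i * b ^ j ≤ b ^ i * b ^ j := by gcongr
      _ = b ^ (i + j) := (Real.rpow_add_of_nonneg hb hi hj).symm
      _ ≤ _ := le_add_of_nonneg_left (by positivity)
  · calc a ^ i * b ^ j ≤ a ^ i * a ^ j := by gcongr
      _ = a ^ (i + j) := (Real.rpow_add_of_nonneg ha hi hj).symm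
      _ ≤ _ := le_add_of_nonneg_right (by positivity)

/-- A locally integrable function with nonnegative integrals against nonnegative test functions is
nonnegative almost everywhere. -/
theorem ae_nonneg_of_forall_test {g : E3 → ℝ} (hg : LocallyIntegrable g)
    (h : ∀ φ : Test, (∀ x, 0 ≤ φ x) → 0 ≤ ∫ x, g x * φ x) : ∀ᵐ x, 0 ≤ g x := by
  -- Shrinking bumps with a fixed ratio of radii: convolution with them converges almost everywhere
  -- by Lebesgue differentiation, and each value is a test against a nonnegative function.
  let b : ℕ → ContDiffBump (0 : E3) := fun n =>
    ⟨1 / (n + 1), 2 / (n + 1), by positivity, by gcongr; norm_num⟩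
  have hb : Tendsto (fun n => (b n).rOut) atTop (𝓝 0) := by
    have := (tendsto_one_div_add_atTop_nhds_zero_nat (𝕜 := ℝ)).const_mul 2
    simpa [b, div_eq_mul_inv] using this
  have hK : ∀ᶠ n in atTop, (b n).rOut ≤ 2 * (b n).rIn := Eventually.of_forall fun n => by
    simp only [b]; ring_nf; rfl
  filter_upwards [ContDiffBump.ae_convolution_tendsto_right_of_locallyIntegrable
    (μ := volume) hb hK hg]
    with x hx
  refine ge_of_tendsto' hx fun n => ?_
  have hs : HasCompactSupport fun y => (b n).normed volume (x - y) :=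
    (b n).hasCompactSupport_normed.comp_homeomorph (Homeomorph.subLeft x)
  let φ : Test := ⟨fun y => (b n).normed volume (x - y),
    (b n).contDiff_normed.comp (contDiff_const.sub contDiff_id), hs, fun _ _ => trivial⟩
  have h1 := h φ fun y => (b n).nonneg_normed _
  rw [MeasureTheory.convolution_eq_swap]
  refine h1.trans (le_of_eq (integral_congr_ae (Eventually.of_forall fun y => ?_)))
  simp only [ContinuousLinearMap.lsmul_apply, smul_eq_mul]
  exact mul_comm _ _

theorem ae_abs_le_of_forall_test {g k : E3 → ℝ} (hg : LocallyIntegrable g)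
    (hk : LocallyIntegrable k) (h : ∀ φ : Test, |∫ x, g x * φ x| ≤ ∫ x, k x * |φ x|) :
    ∀ᵐ x, |g x| ≤ k x := by
  have hφ : ∀ φ : Test, (∀ x, 0 ≤ φ x) → |∫ x, g x * φ x| ≤ ∫ x, k x * φ x := fun φ h0 => by
    simpa only [abs_of_nonneg (h0 _)] using h φ
  have h1 : ∀ᵐ x, 0 ≤ k x - g x := ae_nonneg_of_forall_test (hk.sub hg) fun φ h0 => by
    simp only [sub_mul]
    rw [integral_sub (Test.integrable_mul hk φ) (Test.integrable_mul hg φ)]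
    linarith [(abs_le.1 (hφ φ h0)).2]
  have h2 : ∀ᵐ x, 0 ≤ k x + g x := ae_nonneg_of_forall_test (hk.add hg) fun φ h0 => by
    simp only [add_mul]
    rw [integral_add (Test.integrable_mul hk φ) (Test.integrable_mul hg φ)]
    linarith [(abs_le.1 (hφ φ h0)).1]
  filter_upwards [h1, h2] with x h1 h2
  exact abs_le.2 ⟨by linarith, by linarith⟩

theorem locallyIntegrable_inv_norm : LocallyIntegrable fun x : E3 => ‖x‖⁻¹ := by
  refine (locallyIntegrable_iff).2 fun K hK => ?_
  obtain ⟨M, hM⟩ := hK.isBounded.subset_closedBall (0 : E3)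
  refine IntegrableOn.mono_set ?_ hM
  rw [← integrable_indicator_iff measurableSet_closedBall]
  have e : (Metric.closedBall (0 : E3) M).indicator (fun x => ‖x‖⁻¹)
      = fun x => (Iic M).indicator (fun r => r⁻¹) ‖x‖ := by
    funext x; simp [indicator]
  rw [e, integrable_norm_iff]
  have e2 : ∀ r ∈ Ioi (0 : ℝ), (Iic M).indicator (fun r => r) r
      = r ^ 2 * (Iic M).indicator (fun r => r⁻¹) r := by
    intro r hr
    have : r ≠ 0 := ne_of_gt hr
    by_cases h : r ∈ Iic M
    · rw [indicator_of_mem h, indicator_of_mem h]; field_simp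
    · rw [indicator_of_notMem h, indicator_of_notMem h, mul_zero]
  refine IntegrableOn.congr_fun ?_ e2 measurableSet_Ioi
  rw [integrableOn_indicator_iff measurableSet_Iic, inter_comm, Ioi_inter_Iic]
  exact (continuous_id.integrableOn_Icc (a := 0) (b := M)).mono_set Ioc_subset_Icc_self

theorem integrable_inv_norm_mul_abs (φ : Test) : Integrable fun x => ‖x‖⁻¹ * |φ x| := by
  refine (Test.integrable_mul locallyIntegrable_inv_norm φ).abs.congr
    (Eventually.of_forall fun x => ?_)
  simp [abs_mul]

/-- In polar coordinates the right side is `∫_0^∞ r M(r) dr` with `M` the spherical mean of `|φ|`.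
The bound is linear in `|φ|` with weight `‖x‖⁻¹`, so by duality an estimate of the Duhamel term
becomes a pointwise bound by `‖x‖⁻¹`. -/
theorem abs_tailMean_le_integral (φ : Test) {a : ℝ} (ha : 0 ≤ a) :
    |tailMean φ a| ≤ (4 * Real.pi)⁻¹ * ∫ x, ‖x‖⁻¹ * |φ x| := by
  have hπ := Real.pi_pos
  have hr : IsRadial fun x => ‖x‖⁻¹ := fun x y h => by simp only [h]
  rw [hr.integral_mul (integrable_inv_norm_mul_abs φ), inv_mul_cancel_left₀ (by positivity)]
  have hc : Continuous fun x => |φ x| := φ.continuous.abs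
  have hp : ∀ r ∈ Ioi (0 : ℝ), r * sphMean (fun x => |φ x|) r
      = r ^ 2 * profile (fun x => ‖x‖⁻¹) r * sphMean (fun x => |φ x|) r := by
    intro r hr
    have hr0 : 0 < r := hr
    rw [profile_comp_norm (fun r => r⁻¹) hr0.le]
    field_simp
  have hb : ∀ r, |radDensity φ r| ≤ |r| * sphMean (fun x => |φ x|) r := by
    intro r
    rw [radDensity, abs_mul]
    refine mul_le_mul_of_nonneg_left ?_ (abs_nonneg r)
    rw [sphMean, abs_mul, abs_of_pos (by positivity : 0 < (4 * Real.pi)⁻¹), sphMean]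
    exact mul_le_mul_of_nonneg_left abs_integral_le_integral_abs (by positivity)
  have hi : IntegrableOn (fun r => r * sphMean (fun x => |φ x|) r) (Ioi 0) := by
    obtain ⟨M, hM, hM0, -⟩ := exists_radDensity_eq_zero φ
    have h1 : Continuous fun r => r * sphMean (fun x => |φ x|) r := by fun_prop
    refine (h1.integrable_of_hasCompactSupport (HasCompactSupport.intro
      (isCompact_Icc (a := -M) (b := M)) fun r hr => ?_)).integrableOn
    have hr' : M < |r| := by
      by_contra h
      exact hr (abs_le.1 (not_lt.1 h))
    rw [sphMean_congr (g := fun _ => 0) (fun x hx => by rw [hM0 x (hx ▸ hr'), abs_zero]),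
      sphMean_const, mul_zero]
  rw [← setIntegral_congr_fun measurableSet_Ioi hp]
  calc |tailMean φ a| ≤ ∫ r in Ioi a, |radDensity φ r| := abs_integral_le_integral_abs
    _ ≤ ∫ r in Ioi 0, |radDensity φ r| :=
      setIntegral_mono_set (integrable_radDensity φ).abs.integrableOn
        (Eventually.of_forall fun _ => abs_nonneg _) (Ioi_subset_Ioi ha).eventuallyLE
    _ ≤ _ := by
      refine setIntegral_mono_on (integrable_radDensity φ).abs.integrableOn hi measurableSet_Ioi
        fun r hr => ?_
      have hr0 : 0 < r := hr
      simpa only [abs_of_pos hr0] using hb r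

theorem abs_waveFlowProjOut_sub_le {f g : E3 → ℝ} (hf : IsRadial f) (hg : IsRadial g) {r : ℝ}
    (hr : 0 < r) (hzf : ∀ᵐ x, ‖x‖ < r → f x = 0) (hzg : ∀ᵐ x, ‖x‖ < r → g x = 0)
    (hIf : Integrable fun x => f x / ‖x‖) (hIg : Integrable fun x => g x / ‖x‖)
    {τ : ℝ} (hτ : 0 ≤ τ) (φ : Test) :
    |waveFlowProjOut τ f φ - waveFlowProjOut τ g φ|
      ≤ (∫ x, |f x - g x| / ‖x‖) * ((8 * Real.pi)⁻¹ * ∫ x, ‖x‖⁻¹ * |φ x|) := by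
  have hc := continuous_tailMean φ
  have hm : AEStronglyMeasurable fun x : E3 => tailMean φ (‖x‖ + τ) :=
    Continuous.aestronglyMeasurable (by fun_prop)
  have hb : ∀ᵐ x : E3, ‖tailMean φ (‖x‖ + τ)‖ ≤ (4 * Real.pi)⁻¹ * ∫ x, ‖x‖⁻¹ * |φ x| :=
    Eventually.of_forall fun x => abs_tailMean_le_integral φ (by positivity)
  rw [waveFlowProjOut_eq hf hr hzf hIf, waveFlowProjOut_eq hg hr hzg hIg, ← mul_sub,
    ← integral_sub (hIf.mul_bdd hm hb) (hIg.mul_bdd hm hb), abs_mul]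
  have e : ∀ x : E3, |f x / ‖x‖ - g x / ‖x‖| = |f x - g x| / ‖x‖ := fun x => by
    rw [← sub_div, abs_div, abs_norm]
  have hd := (hIf.sub hIg).abs
  simp only [Pi.sub_apply, e] at hd
  have h1 : |∫ x, (f x / ‖x‖ * tailMean φ (‖x‖ + τ) - g x / ‖x‖ * tailMean φ (‖x‖ + τ))|
      ≤ ∫ x, |f x - g x| / ‖x‖ * ((4 * Real.pi)⁻¹ * ∫ x, ‖x‖⁻¹ * |φ x|) := by
    rw [← Real.norm_eq_abs]
    refine norm_integral_le_of_norm_le (hd.mul_const _) ?_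
    filter_upwards [hb] with x hx
    rw [← sub_mul, norm_mul, Real.norm_eq_abs, e]
    exact mul_le_mul_of_nonneg_left hx (by positivity)
  rw [integral_mul_const] at h1
  have h2 : |(-(1 / 2) : ℝ)| = 1 / 2 := by norm_num
  rw [h2]
  refine (mul_le_mul_of_nonneg_left h1 (by norm_num)).trans (le_of_eq ?_)
  rw [show (8 * Real.pi)⁻¹ = 1 / 2 * (4 * Real.pi)⁻¹ by
    have := Real.pi_pos; field_simp; norm_num]
  ring

theorem IsRadial.nonlin {u : E3 → ℝ} (hu : IsRadial u) (N : ℝ) :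
    IsRadial (OutgoingWave.nonlin N u) :=
  fun x y h => by simp only [OutgoingWave.nonlin, hu x y h]

theorem abs_nonlin {N : ℝ} (hN : 1 < N) (u : E3 → ℝ) (x : E3) :
    |nonlin N u x| = |u x| ^ (N + 1) := abs_powNl hN (u x)

/-- A function dominating the nonlinear quantities built from two functions of `L^{N+2}`
vanishing on the ball of radius `r`. -/
def pairDom (N r : ℝ) (u v : E3 → ℝ) (x : E3) : ℝ :=
  (|u x| + |v x|) ^ (N + 2) + (Ici r).indicator (fun ρ => ρ ^ (-(N + 2))) ‖x‖

section Dom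

variable {N r : ℝ} {u v : E3 → ℝ}

theorem integrable_indicator_norm_rpow (hN : 1 < N) (hr : 0 < r) :
    Integrable fun x : E3 => (Ici r).indicator (fun ρ => ρ ^ (-(N + 2))) ‖x‖ := by
  rw [integrable_norm_iff]
  have e : (fun ρ : ℝ => ρ ^ 2 * (Ici r).indicator (fun ρ => ρ ^ (-(N + 2))) ρ)
      = (Ici r).indicator fun ρ => ρ ^ (-N) := by
    funext ρ
    by_cases h : ρ ∈ Ici r
    · have h0 : 0 < ρ := hr.trans_le h
      rw [indicator_of_mem h, indicator_of_mem h, ← Real.rpow_natCast ρ 2, ← Real.rpow_add h0]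
      congr 1; push_cast; ring
    · rw [indicator_of_notMem h, indicator_of_notMem h, mul_zero]
  rw [e]
  refine Integrable.integrableOn ((integrable_indicator_iff measurableSet_Ici).2 ?_)
  rw [integrableOn_Ici_iff_integrableOn_Ioi]
  exact integrableOn_Ioi_rpow_of_lt (by linarith) hr

theorem integrable_pairDom (hN : 1 < N) (hr : 0 < r) (hu : MemLp u (ENNReal.ofReal (N + 2)))
    (hv : MemLp v (ENNReal.ofReal (N + 2))) : Integrable (pairDom N r u v) := by
  have hm : MemLp (fun x => |u x| + |v x|) (ENNReal.ofReal (N + 2)) := hu.abs.add hv.abs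
  have h := (memLp_exponent_iff hN hm.1).1 hm
  refine (Integrable.congr h (Eventually.of_forall fun x => ?_)).add
    (integrable_indicator_norm_rpow hN hr)
  simp only
  rw [abs_of_nonneg (by positivity : 0 ≤ |u x| + |v x|)]

theorem integral_rpow_le_of_eLpNorm_le (hN : 1 < N) (hu : MemLp u (ENNReal.ofReal (N + 2))) {C : ℝ}
    (hC : eLpNorm u (ENNReal.ofReal (N + 2)) volume ≤ ENNReal.ofReal C) :
    ∫ x, |u x| ^ (N + 2) ≤ (max C 0) ^ (N + 2) := by
  replace hC := hC.trans (ENNReal.ofReal_le_ofReal (le_max_left C 0))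
  rw [eLpNorm_exponent_eq hN hu, ENNReal.ofReal_le_ofReal_iff (le_max_right _ _)] at hC
  have h0 : 0 ≤ ∫ x, |u x| ^ (N + 2) := integral_nonneg fun x => by positivity
  have h := Real.rpow_le_rpow (by positivity) hC (by linarith : 0 ≤ N + 2)
  rwa [Real.rpow_inv_rpow h0 (by linarith)] at h

theorem integral_pairDom_le (hN : 1 < N) (hr : 0 < r) (hu : MemLp u (ENNReal.ofReal (N + 2)))
    (hv : MemLp v (ENNReal.ofReal (N + 2))) :
    ∫ x, pairDom N r u v x ≤ 2 ^ (N + 2) * ((∫ x, |u x| ^ (N + 2)) + ∫ x, |v x| ^ (N + 2))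
      + ∫ x : E3, (Ici r).indicator (fun ρ => ρ ^ (-(N + 2))) ‖x‖ := by
  have hu' := (memLp_exponent_iff hN hu.1).1 hu
  have hv' := (memLp_exponent_iff hN hv.1).1 hv
  have hi := integrable_indicator_norm_rpow hN hr
  have hs : Integrable fun x => 2 ^ (N + 2) * (|u x| ^ (N + 2) + |v x| ^ (N + 2)) :=
    (hu'.add hv').const_mul _
  rw [← integral_add hu' hv', ← integral_const_mul, ← integral_add hs hi]
  refine integral_mono (integrable_pairDom hN hr hu hv) (hs.add hi) fun x => ?_
  exact add_le_add (add_rpow_le_two_rpow_mul (abs_nonneg _) (abs_nonneg _) (by linarith)) le_rfl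

theorem pairDom_nonneg (x : E3) : 0 ≤ pairDom N r u v x := by
  refine add_nonneg (by positivity) (indicator_apply_nonneg fun _ => ?_)
  positivity

/-- Used with `(i, j) = (N + 1, 1)` for the nonlinear term itself and with `(N, 2)` for the
difference of two nonlinear terms. -/
theorem rpow_mul_inv_norm_le_pairDom {i j : ℝ} (hi : 0 ≤ i) (hj : 0 ≤ j) (hij : i + j = N + 2)
    {x : E3} (hx : r ≤ ‖x‖) :
    (|u x| + |v x|) ^ i * (‖x‖⁻¹) ^ j ≤ pairDom N r u v x := by
  refine (mul_rpow_le_add_rpow (by positivity) (by positivity) hi hj).trans ?_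
  rw [pairDom, indicator_of_mem (mem_Ici.2 hx), hij, Real.inv_rpow (norm_nonneg x),
    Real.rpow_neg (norm_nonneg x)]

theorem abs_nonlin_div_le_pairDom (hN : 1 < N) {x : E3} (hx : ‖x‖ < r → u x = 0) :
    |nonlin N u x| / ‖x‖ ≤ pairDom N r u v x := by
  rw [abs_nonlin hN]
  rcases lt_or_ge ‖x‖ r with h | h
  · rw [hx h, abs_zero, Real.zero_rpow (by linarith), zero_div]
    exact pairDom_nonneg x
  · refine le_trans ?_ (rpow_mul_inv_norm_le_pairDom (i := N + 1) (j := 1) (by linarith)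
      zero_le_one (by ring) h)
    rw [Real.rpow_one, div_eq_mul_inv]
    gcongr
    exact le_add_of_nonneg_right (abs_nonneg _)

/-- The assumed bound on `u - v` supplies a second factor `‖x‖⁻¹`, so the difference is again
controlled by the integrable `pairDom`, with a gain of the small factor `A`. -/
theorem abs_nonlin_sub_div_le_pairDom (hN : 1 < N) {x : E3} (hx : ‖x‖ < r → u x = 0)
    (hx' : ‖x‖ < r → v x = 0) {A : ℝ} (hA : 0 ≤ A) (h : |u x - v x| ≤ A * ‖x‖⁻¹) :
    |nonlin N u x - nonlin N v x| / ‖x‖ ≤ (N + 1) * A * pairDom N r u v x := by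
  rcases lt_or_ge ‖x‖ r with hr | hr
  · simp only [nonlin, hx hr, hx' hr, sub_self, abs_zero, zero_div]
    exact mul_nonneg (mul_nonneg (by linarith) hA) (pairDom_nonneg x)
  · have h1 := abs_powNl_sub_le hN (x := u x) (y := v x) (m := |u x| + |v x|)
      (le_add_of_nonneg_right (abs_nonneg _)) (le_add_of_nonneg_left (abs_nonneg _))
    have h2 := rpow_mul_inv_norm_le_pairDom (N := N) (r := r) (u := u) (v := v) (i := N) (j := 2)
      (by linarith) zero_le_two rfl hr
    rw [Real.rpow_two] at h2
    calc |nonlin N u x - nonlin N v x| / ‖x‖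
        ≤ ((N + 1) * (|u x| + |v x|) ^ N * (A * ‖x‖⁻¹)) * ‖x‖⁻¹ := by
          rw [div_eq_mul_inv]
          gcongr
          exact h1.trans (by gcongr)
      _ = (N + 1) * A * ((|u x| + |v x|) ^ N * ‖x‖⁻¹ ^ 2) := by ring
      _ ≤ _ := by gcongr

theorem integrable_nonlin_div (hN : 1 < N) (hr : 0 < r) (hu : MemLp u (ENNReal.ofReal (N + 2)))
    (hz : ∀ᵐ x : E3, ‖x‖ < r → u x = 0) : Integrable fun x => nonlin N u x / ‖x‖ := by
  have hm : AEStronglyMeasurable fun x => nonlin N u x / ‖x‖ := by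
    have h1 : AEStronglyMeasurable (nonlin N u) :=
      (continuous_powNl hN).comp_aestronglyMeasurable hu.1
    have h2 : AEStronglyMeasurable fun x : E3 => ‖x‖⁻¹ :=
      measurable_norm.inv.aestronglyMeasurable
    simp only [div_eq_mul_inv]
    exact h1.mul h2
  refine (integrable_pairDom hN hr hu hu).mono' hm ?_
  filter_upwards [hz] with x hx
  rw [norm_div, norm_norm]
  exact abs_nonlin_div_le_pairDom hN hx

end Dom

namespace IsSolution

variable {N : ℝ} {u₀ : E3 → ℝ} {u₁ : Distr} {u v : ℝ → E3 → ℝ}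

theorem mono {I J : Set ℝ} (h : IsSolution N u₀ u₁ I u) (hJ : J ⊆ I) :
    IsSolution N u₀ u₁ J u where
  radial t ht := h.radial t (hJ ht)
  aestronglyMeasurable := h.aestronglyMeasurable.mono_ac
    ((Measure.restrict_mono hJ le_rfl).absolutelyContinuous.prod Measure.AbsolutelyContinuous.rfl)
  memLp t ht := h.memLp t (hJ ht)
  bounded T := (h.bounded T).imp fun _ hC t ht => hC t (hJ ht)
  vanish_near_zero := h.vanish_near_zero.imp fun _ hr => ⟨hr.1, fun t ht => hr.2 t (hJ ht)⟩
  equation t ht := h.equation t (hJ ht)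

theorem exists_integral_rpow_le (hN : 1 < N) {T : ℝ} (h : IsSolution N u₀ u₁ (Icc 0 T) u) :
    ∃ B, ∀ t ∈ Icc 0 T, ∫ x, |u t x| ^ (N + 2) ≤ B := by
  obtain ⟨C, hC⟩ := h.bounded T
  exact ⟨_, fun t ht => integral_rpow_le_of_eLpNorm_le hN (h.memLp t ht) (hC t ht ht.2)⟩

/-- The Duhamel integrand is integrable in time. -/
theorem intervalIntegrable_waveFlowProjOut (hN : 1 < N) {T : ℝ}
    (h : IsSolution N u₀ u₁ (Icc 0 T) u) {t : ℝ} (ht : t ∈ Icc 0 T) (φ : Test) :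
    IntervalIntegrable (fun s => waveFlowProjOut (t - s) (nonlin N (u s)) φ) volume 0 t := by
  obtain ⟨r, hr, hz⟩ := h.vanish_near_zero
  obtain ⟨B, hB⟩ := h.exists_integral_rpow_le hN
  have hsub : Ioc 0 t ⊆ Icc 0 T := fun s hs => ⟨hs.1.le, hs.2.trans ht.2⟩
  have hc := continuous_tailMean φ
  rw [intervalIntegrable_iff_integrableOn_Ioc_of_le ht.1]
  have hI : ∀ s ∈ Icc 0 T, Integrable fun x => nonlin N (u s) x / ‖x‖ := fun s hs =>
    integrable_nonlin_div hN hr (h.memLp s hs) (hz s hs)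
  have hm : AEStronglyMeasurable (fun s => -(1 / 2) * ∫ x, nonlin N (u s) x / ‖x‖ *
      tailMean φ (‖x‖ + (t - s))) (volume.restrict (Ioc 0 t)) := by
    refine AEStronglyMeasurable.const_mul ?_ _
    refine AEStronglyMeasurable.integral_prod_right'
      (f := fun p : ℝ × E3 => nonlin N (u p.1) p.2 / ‖p.2‖ * tailMean φ (‖p.2‖ + (t - p.1))) ?_
    have h1 : AEStronglyMeasurable (fun p : ℝ × E3 => nonlin N (u p.1) p.2)
        ((volume.restrict (Ioc 0 t)).prod volume) :=
      (continuous_powNl hN).comp_aestronglyMeasurable (h.mono hsub).aestronglyMeasurable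
    have h2 : Measurable fun p : ℝ × E3 => ‖p.2‖⁻¹ := measurable_snd.norm.inv
    have h3 : Continuous fun p : ℝ × E3 => tailMean φ (‖p.2‖ + (t - p.1)) := by fun_prop
    simp only [div_eq_mul_inv]
    exact (h1.mul h2.aestronglyMeasurable).mul h3.aestronglyMeasurable
  set S := ∫ r, |radDensity φ r|
  set K := 2 ^ (N + 2) * (B + B)
      + ∫ x : E3, (Ici r).indicator (fun ρ => ρ ^ (-(N + 2))) ‖x‖ with hK
  have hS : 0 ≤ S := integral_nonneg fun _ => abs_nonneg _
  refine Integrable.mono' (integrable_const (1 / 2 * (K * S))) (hm.congr ?_) ?_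
  · filter_upwards [ae_restrict_mem measurableSet_Ioc] with s hs
    exact (waveFlowProjOut_eq ((h.radial s (hsub hs)).nonlin N) hr
      ((hz s (hsub hs)).mono fun x hx hxr => by simp only [nonlin, hx hxr, mul_zero])
      (hI s (hsub hs)) _ φ).symm
  · filter_upwards [ae_restrict_mem measurableSet_Ioc] with s hs
    have hs' := hsub hs
    have hL := h.memLp s hs'
    rw [waveFlowProjOut_eq ((h.radial s hs').nonlin N) hr
      ((hz s hs').mono fun x hx hxr => by simp only [nonlin, hx hxr, mul_zero])
      (hI s hs'), norm_mul, norm_neg, Real.norm_of_nonneg (by norm_num : (0 : ℝ) ≤ 1 / 2)]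
    refine mul_le_mul_of_nonneg_left ?_ (by norm_num)
    have h1 : ‖∫ x, nonlin N (u s) x / ‖x‖ * tailMean φ (‖x‖ + (t - s))‖
        ≤ ∫ x, pairDom N r (u s) (u s) x * S := by
      refine norm_integral_le_of_norm_le ((integrable_pairDom hN hr hL hL).mul_const S) ?_
      filter_upwards [hz s hs'] with x hx
      rw [norm_mul, norm_div, norm_norm]
      exact mul_le_mul (abs_nonlin_div_le_pairDom hN hx) (abs_tailMean_le φ _) (abs_nonneg _)
        (pairDom_nonneg x)
    rw [integral_mul_const] at h1
    refine h1.trans (mul_le_mul_of_nonneg_right ((integral_pairDom_le hN hr hL hL).trans ?_) hS)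
    rw [hK]
    have := hB s hs'
    gcongr

/-- If the nonlinear terms of two solutions are close, so are the solutions. -/
theorem ae_abs_sub_le (hN : 1 < N) {T : ℝ} (hu : IsSolution N u₀ u₁ (Icc 0 T) u)
    (hv : IsSolution N u₀ u₁ (Icc 0 T) v) {Γ : ℝ → ℝ} (hΓ : Continuous Γ)
    (hle : ∀ s ∈ Icc 0 T, ∫ x, |nonlin N (u s) x - nonlin N (v s) x| / ‖x‖ ≤ Γ s)
    {t : ℝ} (ht : t ∈ Icc 0 T) :
    ∀ᵐ x, |u t x - v t x| ≤ (8 * Real.pi)⁻¹ * (∫ s in (0 : ℝ)..t, Γ s) * ‖x‖⁻¹ := by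
  obtain ⟨r, hr, hz⟩ := hu.vanish_near_zero
  obtain ⟨r', hr', hz'⟩ := hv.vanish_near_zero
  have hlu := (hu.memLp t ht).locallyIntegrable (one_le_exponent hN)
  have hlv := (hv.memLp t ht).locallyIntegrable (one_le_exponent hN)
  have hk : LocallyIntegrable fun x : E3 =>
      (8 * Real.pi)⁻¹ * (∫ s in (0 : ℝ)..t, Γ s) * ‖x‖⁻¹ := by
    exact locallyIntegrable_inv_norm.smul ((8 * Real.pi)⁻¹ * ∫ s in (0 : ℝ)..t, Γ s)
  refine ae_abs_le_of_forall_test (hlu.sub hlv) hk fun φ => ?_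
  set S := ∫ x, ‖x‖⁻¹ * |φ x| with hS
  have hS0 : 0 ≤ S := integral_nonneg fun x => by positivity
  have hπ := Real.pi_pos
  -- The free flow of the common data cancels in the difference of the two equations.
  have e1 : ∫ x, (u t x - v t x) * φ x = ∫ s in (0 : ℝ)..t,
      (waveFlowProjOut (t - s) (nonlin N (u s)) φ
        - waveFlowProjOut (t - s) (nonlin N (v s)) φ) := by
    rw [intervalIntegral.integral_sub (hu.intervalIntegrable_waveFlowProjOut hN ht φ)
      (hv.intervalIntegrable_waveFlowProjOut hN ht φ)]
    have h1 := hu.equation t ht φ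
    have h2 := hv.equation t ht φ
    simp only [sub_mul]
    rw [integral_sub (Test.integrable_mul hlu φ) (Test.integrable_mul hlv φ)]
    unfold pairing at h1 h2
    linarith
  have e2 : ∫ x, (8 * Real.pi)⁻¹ * (∫ s in (0 : ℝ)..t, Γ s) * ‖x‖⁻¹ * |φ x|
      = ∫ s in (0 : ℝ)..t, Γ s * ((8 * Real.pi)⁻¹ * S) := by
    simp only [mul_assoc _ _ |φ _|]
    rw [integral_const_mul, intervalIntegral.integral_mul_const]
    ring
  rw [e1, e2, ← Real.norm_eq_abs]
  refine intervalIntegral.norm_integral_le_of_norm_le ht.1 (Eventually.of_forall fun s hs => ?_)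
    ((hΓ.mul continuous_const).intervalIntegrable _ _)
  have hs' : s ∈ Icc 0 T := ⟨hs.1.le, hs.2.trans ht.2⟩
  have hm := lt_min hr hr'
  have hzu : ∀ᵐ x, ‖x‖ < min r r' → u s x = 0 :=
    (hz s hs').mono fun x hx h => hx (h.trans_le (min_le_left _ _))
  have hzv : ∀ᵐ x, ‖x‖ < min r r' → v s x = 0 :=
    (hz' s hs').mono fun x hx h => hx (h.trans_le (min_le_right _ _))
  have h := abs_waveFlowProjOut_sub_le ((hu.radial s hs').nonlin N) ((hv.radial s hs').nonlin N)
    hm (hzu.mono fun x hx h => by simp only [nonlin, hx h, mul_zero])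
    (hzv.mono fun x hx h => by simp only [nonlin, hx h, mul_zero])
    (integrable_nonlin_div hN hm (hu.memLp s hs') hzu)
    (integrable_nonlin_div hN hm (hv.memLp s hs') hzv) (sub_nonneg.2 hs.2) φ
  exact h.trans (mul_le_mul_of_nonneg_right (hle s hs') (by positivity))

/-- Solutions on `[0, T]` with the same data coincide. -/
theorem ae_eq (hN : 1 < N) {T : ℝ} (hu : IsSolution N u₀ u₁ (Icc 0 T) u)
    (hv : IsSolution N u₀ u₁ (Icc 0 T) v) : ∀ t ∈ Icc 0 T, u t =ᵐ[volume] v t := by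
  obtain ⟨r₁, hr₁, hz₁⟩ := hu.vanish_near_zero
  obtain ⟨r₂, hr₂, hz₂⟩ := hv.vanish_near_zero
  obtain ⟨B, hB⟩ := hu.exists_integral_rpow_le hN
  obtain ⟨B', hB'⟩ := hv.exists_integral_rpow_le hN
  set r := min r₁ r₂
  have hr : 0 < r := lt_min hr₁ hr₂
  have hzu : ∀ s ∈ Icc 0 T, ∀ᵐ x, ‖x‖ < r → u s x = 0 := fun s hs =>
    (hz₁ s hs).mono fun x hx h => hx (h.trans_le (min_le_left _ _))
  have hzv : ∀ s ∈ Icc 0 T, ∀ᵐ x, ‖x‖ < r → v s x = 0 := fun s hs =>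
    (hz₂ s hs).mono fun x hx h => hx (h.trans_le (min_le_right _ _))
  set K := 2 ^ (N + 2) * (B + B')
      + ∫ x : E3, (Ici r).indicator (fun ρ => ρ ^ (-(N + 2))) ‖x‖ with hK
  have hI : ∀ s ∈ Icc 0 T, Integrable (pairDom N r (u s) (v s)) := fun s hs =>
    integrable_pairDom hN hr (hu.memLp s hs) (hv.memLp s hs)
  have hKs : ∀ s ∈ Icc 0 T, ∫ x, pairDom N r (u s) (v s) x ≤ K := fun s hs => by
    refine (integral_pairDom_le hN hr (hu.memLp s hs) (hv.memLp s hs)).trans ?_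
    rw [hK]
    have := hB s hs
    have := hB' s hs
    gcongr
  have hπ := Real.pi_pos
  intro t₀ ht₀
  have hK0 : 0 ≤ K := (integral_nonneg fun x => pairDom_nonneg x).trans (hKs t₀ ht₀)
  have hT : 0 ≤ T := ht₀.1.trans ht₀.2
  have hN1 : 0 < N + 1 := by linarith
  set κ := (8 * Real.pi)⁻¹ * ((N + 1) * K) with hκ
  -- The crude bound that starts the iteration: each nonlinear term contributes at most `K`, over a
  -- time at most `T`.
  set A := (8 * Real.pi)⁻¹ * (2 * K * T) with hA
  have hA0 : 0 ≤ A := by positivity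
  have hκ0 : 0 ≤ κ := by positivity
  -- Iterated Gronwall argument. The bound at stage `n` makes the nonlinear terms close at every
  -- time `s`; integrating `s ^ n` through `ae_abs_sub_le` gains a factor `κ t / (n + 1)`.
  have main : ∀ n : ℕ, ∀ t ∈ Icc 0 T,
      ∀ᵐ x, |u t x - v t x| ≤ A * ((κ * t) ^ n / n.factorial) * ‖x‖⁻¹ := by
    intro n
    induction n with
    | zero =>
      intro t ht
      have h := ae_abs_sub_le hN hu hv (Γ := fun _ => 2 * K) continuous_const (fun s hs => ?_) ht
      · filter_upwards [h] with x hx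
        refine hx.trans ?_
        rw [intervalIntegral.integral_const, smul_eq_mul, sub_zero, pow_zero, Nat.factorial_zero,
          Nat.cast_one, div_one, mul_one, hA, mul_comm t]
        have := ht.2
        gcongr
      · refine le_trans ?_ (mul_le_mul_of_nonneg_left (hKs s hs) zero_le_two)
        rw [← integral_const_mul]
        refine integral_mono_of_nonneg (Eventually.of_forall fun x => by positivity)
          ((hI s hs).const_mul 2) ?_
        filter_upwards [hzu s hs, hzv s hs] with x hxu hxv
        have h1 := abs_nonlin_div_le_pairDom (v := v s) hN hxu
        have h2 := abs_nonlin_div_le_pairDom (v := u s) hN hxv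
        have h3 : pairDom N r (v s) (u s) x = pairDom N r (u s) (v s) x := by
          unfold pairDom; rw [add_comm |v s x|]
        have h4 : |nonlin N (u s) x - nonlin N (v s) x| / ‖x‖
            ≤ |nonlin N (u s) x| / ‖x‖ + |nonlin N (v s) x| / ‖x‖ := by
          rw [← add_div]
          gcongr
          exact abs_sub _ _
        linarith
    | succ n ih =>
      intro t ht
      have h := ae_abs_sub_le hN hu hv
        (Γ := fun s => (N + 1) * K * A * κ ^ n / n.factorial * s ^ n) (by fun_prop)
        (fun s hs => ?_) ht
      · filter_upwards [h] with x hx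
        refine hx.trans (le_of_eq ?_)
        have e : (8 * Real.pi)⁻¹ * ((N + 1) * K * A * κ ^ n / n.factorial *
            (t ^ (n + 1) / (n + 1))) = κ * (A * κ ^ n / n.factorial * (t ^ (n + 1) / (n + 1))) := by
          rw [hκ]; ring
        rw [intervalIntegral.integral_const_mul, integral_pow, zero_pow n.succ_ne_zero, sub_zero, e,
          Nat.factorial_succ]
        push_cast
        clear_value κ
        field_simp
        ring
      · have hs0 := hs.1
        have hAn : 0 ≤ A * ((κ * s) ^ n / n.factorial) := by positivity
        have h1 : ∫ x, |nonlin N (u s) x - nonlin N (v s) x| / ‖x‖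
            ≤ ∫ x, (N + 1) * (A * ((κ * s) ^ n / n.factorial)) * pairDom N r (u s) (v s) x := by
          refine integral_mono_of_nonneg (Eventually.of_forall fun x => by positivity)
            ((hI s hs).const_mul _) ?_
          filter_upwards [hzu s hs, hzv s hs, ih s hs] with x hxu hxv hx
          exact abs_nonlin_sub_div_le_pairDom hN hxu hxv hAn hx
        rw [integral_const_mul] at h1
        refine h1.trans ((mul_le_mul_of_nonneg_left (hKs s hs) (by positivity)).trans
          (le_of_eq ?_))
        rw [mul_pow]
        ring
  have hall := ae_all_iff.2 fun n => main n t₀ ht₀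
  filter_upwards [hall] with x hx
  have hlim : Tendsto (fun n : ℕ => A * ((κ * t₀) ^ n / n.factorial) * ‖x‖⁻¹) atTop (𝓝 0) := by
    simpa using ((FloorSemiring.tendsto_pow_div_factorial_atTop (κ * t₀)).const_mul A).mul_const
      ‖x‖⁻¹
  have := ge_of_tendsto' hlim hx
  exact sub_eq_zero.1 (abs_nonpos_iff.1 this)

end IsSolution

end OutgoingWave

end

theorem theorem1p2 (N : ℝ) (hN : 2 < N) (R : ℝ) (hR : 0 < R)
    (u₀ : OutgoingWave.E3 → ℝ) (u₁ : OutgoingWave.Distr)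
    (hrad : OutgoingWave.IsRadial u₀)
    (hout : OutgoingWave.IsOutgoing u₀ u₁)
    (hLp : MemLp u₀ (ENNReal.ofReal (N + 2)) volume)
    (hsupp : ∀ᵐ x : OutgoingWave.E3, ‖x‖ < R → u₀ x = 0) :
    ∃ u : ℝ → OutgoingWave.E3 → ℝ,
      OutgoingWave.IsSolution N u₀ u₁ (Ici 0) u ∧
      (∀ T : ℝ, 0 ≤ T → ∀ v : ℝ → OutgoingWave.E3 → ℝ,
        OutgoingWave.IsSolution N u₀ u₁ (Icc 0 T) v → ∀ t ∈ Icc 0 T, v t =ᵐ[volume] u t) ∧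
      (∀ t : ℝ, 0 ≤ t → eLpNorm (u t) (ENNReal.ofReal (N + 2)) volume
        ≤ eLpNorm u₀ (ENNReal.ofReal (N + 2)) volume) ∧
      (4 < N → Tendsto (fun t : ℝ => eLpNorm (u t) (ENNReal.ofReal (N + 2)) volume)
        atTop (𝓝 0)) := by
  have hN1 : 1 < N := by linarith
  obtain ⟨w₀, D, hw⟩ := OutgoingWave.exists_charData hN1 hR hrad hLp
  obtain ⟨V, hV, hE⟩ := D.exists_global
  have hsol := OutgoingWave.isSolution_charFun D hrad hout hLp hsupp hw hV hE
  refine ⟨OutgoingWave.charFun R w₀ V, hsol, fun T _ v hv =>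
    hv.ae_eq hN1 (hsol.mono Icc_subset_Ici_self), fun t ht => ?_,
    fun hN4 => D.tendsto_eLpNorm_charFun hN4 hV hE⟩
  rw [D.eLpNorm_charFun V ht, OutgoingWave.eLpNorm_eq_charData D hrad hLp hsupp hw]
  have h0 := D.charEnergy_nonneg ht (V t)
  have := Real.pi_pos
  refine ENNReal.ofReal_le_ofReal (Real.rpow_le_rpow (by positivity) ?_
    (inv_nonneg.2 (by linarith)))
  exact mul_le_mul_of_nonneg_left (hE t ht) (by positivity)
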